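/- **Setting.** Let $(\mathcal C,\otimes,1)$ be an abelian closed symmetric monoidal category with all small limits and colimits in which filtered colimits commute with finite limits, and in which every object is a directed colimit of its finitely generated subobjects. (An object $M$ of an abelian category is *finitely generated* if $\mathrm{Hom}(M,-)$ commutes with colimits of filtered systems of monomorphisms.) Let $Comm(\mathcal C)$ be the category of commutative monoids in $\mathcal C$; for $A\in Comm(\mathcal C)$ let $A\text{-}Mod$ be the symmetric monoidal category of $A$-modules with $\otimes_A$, and let $\underline{Hom}_A(M,N)\in\mathcal C$ be its internal hom. Functors called symmetric monoidal are strong and additive. **Schemes.** A morphism $Spec(B)\to Spec(A)$ of affine schemes (objects of $Comm(\mathcal C)^{op}$) is a Zariski open immersion if $A\to B$ is a flat epimorphism of finite presentation; a Zariski covering of $Spec(A)$ is a family of Zariski open immersions $Spec(A_i)\to Spec(A)$ with a finite subfamily for which the functors $-\otimes_AA_j$ are jointly conservative on $A\text{-}Mod$. Sheaves are taken for the resulting topology. A Zariski open of $Spec(A)$ is a subsheaf that is the image of a family of Zariski open immersions of affines, and $F\to G$ is an open immersion if, for every $Spec(A)\to G$, the map $F\times_GSpec(A)\to Spec(A)$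 is the inclusion of a Zariski open. A scheme is a sheaf $X$ with a family of open immersions from affine schemes that is jointly epimorphic in sheaves (an affine cover). $ZarAff(X)$ denotes the open immersions $U=Spec(\mathcal O(U))\to X$ with $U$ affine. $X$ is quasi-compact if every affine cover has a finite subcover; semi-separated if $U\times_XV\in ZarAff(X)$ for all $U,V\in ZarAff(X)$; Noetherian if $\mathcal O(U)$ is Noetherian for all $U\in ZarAff(X)$, where $A\in Comm(\mathcal C)$ is Noetherian if every finitely generated $A$-module is the cokernel of a morphism $A^m\to A^n$ with $m,n\ge 1$. A field object is a nonzero Noetherian $K\in Comm(\mathcal C)$ such that every monomorphism $I\to K$ in $K\text{-}Mod$ is zero or an isomorphism. **Quasi-coherent sheaves.** An object $\mathcal M$ of $QCoh(X)$ consists of $\mathcal O(U)$-modules $\mathcal M(U)$, $U\in ZarAff(X)$, with functorial restrictions inducing isomorphisms $\mathcal O(V)\otimes_{\mathcal O(U)}\mathcal M(U)\to\mathcal M(V)$; the tensor product is $(\mathcal M\otimes\mathcal N)(U)=\mathcal M(U)\otimes_{\mathcal O(U)}\mathcal N(U)$. For $i:U\to X$ in $ZarAff(X)$ the functor $i^*:QCoh(X)\to\mathcal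 O(U)\text{-}Mod$ is $\mathcal M\mapsto\mathcal M(U)$. A pullback functor along $f:Y\to X$ is a functor $f^*:QCoh(X)\to QCoh(Y)$ together with semilinear maps $\mathcal M(W)\to(f^*\mathcal M)(T)$, one for every morphism $T\to W$ over $f$ with $T\in ZarAff(Y)$, $W\in ZarAff(X)$, which are natural in $\mathcal M$, compatible with restrictions in $T$ and in $W$, and induce isomorphisms $\mathcal O(T)\otimes_{\mathcal O(W)}\mathcal M(W)\to(f^*\mathcal M)(T)$. For $Y=Spec(A)$, $QCoh(Y)$ is identified with $A\text{-}Mod$ by global sections. **Normal functors.** A normal functor $(G,\tau):B\text{-}Mod\to A\text{-}Mod$ is a functor $G$ with morphisms $\tau_{M,N}:\underline{Hom}_B(M,N)\to\underline{Hom}_A(GM,GN)$ in $\mathcal C$, natural in $M$ and $N$, compatible with internal composition and with the identities $1\to\underline{Hom}_B(M,M)$, and carrying the morphism $1\to\underline{Hom}_B(M,N)$ defined by a module morphism $u:M\to N$ to the one defined by $G(u)$. A functor $F:QCoh(X)\to A\text{-}Mod$ is local with respect to $i:U\to X$ in $ZarAff(X)$ if $i^*$ has a right adjoint $i_*$ and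 $F\to F i_*i^*$ is an isomorphism. $F$ is normal if for every such $i$ with respect to which $F$ is local there is a normal functor $(G^U,\tau^U):\mathcal O(U)\text{-}Mod\to A\text{-}Mod$ with $F\cong G^U\circ i^*$. **Theorem.** Let $X$ be a quasi-compact, semi-separated and Noetherian scheme over $(\mathcal C,\otimes,1)$, let $K$ be a field object of $(\mathcal C,\otimes,1)$ and let $f:Spec(K)\to X$ be a morphism of schemes. Then the pullback functor along $f$ exists, and every pullback functor $f^*:QCoh(X)\to QCoh(Spec(K))=K\text{-}Mod$ is cocontinuous (it preserves all small colimits), symmetric monoidal (for the structure compatible with the maps $\mathcal M(W)\to f^*\mathcal M$) and normal. -/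

import Mathlib

open CategoryTheory MonoidalCategory Limits Opposite

universe v u

set_option linter.unusedSectionVars false
set_option linter.unusedVariables false

namespace SymMonGeom

open MonObj

section Modules

variable {C : Type u} [Category.{v} C] [MonoidalCategory C]

section Action

variable {A : C} [MonObj A]

/-- The action map `A ⊗ M ⟶ M` of a module object. -/
def act (M : Mod C A) : A ⊗ M.X ⟶ M.X := ModObj.smul (M := A) (X := M.X)

lemma one_act (M : Mod C A) : η[A] ▷ M.X ≫ act M = (λ_ M.X).hom := ModObj.one_smul_self A M.X

lemma mul_act (M : Mod C A) : μ[A] ▷ M.X ≫ act M = (α_ A A M.X).hom ≫ A ◁ act M ≫ act M :=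
  ModObj.mul_smul_self A M.X

/-- Constructor for module objects. -/
def mkMod (X : C) (a : A ⊗ X ⟶ X) (h1 : η[A] ▷ X ≫ a = (λ_ X).hom)
    (h2 : μ[A] ▷ X ≫ a = (α_ A A X).hom ≫ A ◁ a ≫ a) : Mod C A :=
  letI : ModObj A X := { smul := a, one_smul := h1, mul_smul := h2 }
  ⟨X⟩

lemma act_mkMod (X : C) (a : A ⊗ X ⟶ X) (h1 h2) : act (mkMod X a h1 h2) = a := rfl

variable (A) in
/-- `A` as a module over itself. -/
abbrev reg : Mod C A :=
  letI : ModObj A A := .regular A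
  ⟨A⟩

lemma act_regular : act (reg A) = μ[A] := rfl

/-- `s` is `f`-semilinear: it is a morphism of `A`-modules from `M` to the restriction of scalars
of `N` along `f`.  For `f = 𝟙 A` this is `A`-linearity. -/
def IsSemi {A B : C} [MonObj A] [MonObj B] (f : A ⟶ B) {M : Mod C A} {N : Mod C B}
    (s : M.X ⟶ N.X) : Prop :=
  act M ≫ s = A ◁ s ≫ f ▷ N.X ≫ act N

lemma isSemi_hom {M N : Mod C A} (f : M ⟶ N) : IsSemi (𝟙 A) f.hom := by
  have h : act M ≫ f.hom = A ◁ f.hom ≫ act N := f.isModHom.smul_hom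
  simp [IsSemi, h]

/-- An `A`-linear morphism in `C` as a morphism of modules. -/
def mkHom {M N : Mod C A} (f : M.X ⟶ N.X) (h : IsSemi (𝟙 A) f) : M ⟶ N :=
  Mod.Hom.mk' f (by
    have : act M ≫ f = A ◁ f ≫ act N := by simpa [IsSemi] using h
    exact this)

@[simp] lemma mkHom_hom {M N : Mod C A} (f : M.X ⟶ N.X) (h : IsSemi (𝟙 A) f) :
    (mkHom f h).hom = f := rfl

lemma act_hom {M N : Mod C A} (f : M ⟶ N) : act M ≫ f.hom = A ◁ f.hom ≫ act N :=
  f.isModHom.smul_hom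

/-- Restriction of scalars of a module object along a morphism of monoids. -/
abbrev res {B : C} [MonObj B] (f : A ⟶ B) [IsMonHom f] (N : Mod C B) : Mod C A :=
  letI : ModObj A N.X := Mod.scalarRestriction f N.X
  ⟨N.X⟩

lemma act_res {B : C} [MonObj B] (f : A ⟶ B) [IsMonHom f] (M : Mod C B) :
    act (res f M) = f ▷ M.X ≫ act M := rfl

end Action

end Modules
section Tensor

variable {C : Type u} [Category.{v} C] [MonoidalCategory C] [SymmetricCategory C]

section

lemma th1 {X Y Z X' Y' : C} (a : X ⟶ Y) (b : Y ⟶ Z) (t : X' ⟶ Y') :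
    ((a ≫ b) ⊗ₘ t) = (a ⊗ₘ t) ≫ b ▷ Y' := by
  rw [MonoidalCategory.tensorHom_def, MonoidalCategory.tensorHom_def, comp_whiskerRight,
    Category.assoc, Category.assoc, whisker_exchange]

lemma th2 {X Y Z X' Y' : C} (a : X ⟶ Y) (b : Y ⟶ Z) (t : X' ⟶ Y') :
    (t ⊗ₘ (a ≫ b)) = (t ⊗ₘ a) ≫ Y' ◁ b := by
  rw [MonoidalCategory.tensorHom_def, MonoidalCategory.tensorHom_def, whiskerLeft_comp,
    Category.assoc]

variable {A : C} [MonObj A]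

/-- The right action `M ⊗ A ⟶ M` obtained from the left one by symmetry. -/
def ract (M : Mod C A) : M.X ⊗ A ⟶ M.X := (β_ M.X A).hom ≫ act M

lemma braid_act (M : Mod C A) : (β_ M.X A).hom ≫ act M = ract M := rfl

lemma braid_ract (M : Mod C A) : (β_ A M.X).hom ≫ ract M = act M := by
  simp [ract]

lemma ract_semi {B : C} [MonObj B] {f : A ⟶ B} {M : Mod C A} {N : Mod C B}
    {s : M.X ⟶ N.X} (h : IsSemi f s) : ract M ≫ s = (s ⊗ₘ f) ≫ ract N := by
  have h' : act M ≫ s = A ◁ s ≫ f ▷ N.X ≫ act N := h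
  simp only [ract, Category.assoc, h', MonoidalCategory.tensorHom_def]
  simp

lemma act_semi {B : C} [MonObj B] {f : A ⟶ B} {M : Mod C A} {N : Mod C B}
    {s : M.X ⟶ N.X} (h : IsSemi f s) : act M ≫ s = (f ⊗ₘ s) ≫ act N := by
  have h' : act M ≫ s = A ◁ s ≫ f ▷ N.X ≫ act N := h
  rw [h', MonoidalCategory.tensorHom_def']; simp

lemma isSemi_of {B : C} [MonObj B] {f : A ⟶ B} {M : Mod C A} {N : Mod C B}
    {s : M.X ⟶ N.X} (h : act M ≫ s = (f ⊗ₘ s) ≫ act N) : IsSemi f s := by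
  rw [IsSemi, h, MonoidalCategory.tensorHom_def']; simp

lemma act_ract [IsCommMonObj A] (M : Mod C A) :
    A ◁ ract M ≫ act M = (α_ _ _ _).inv ≫ act M ▷ A ≫ ract M := by
  have h1 : A ◁ act M ≫ act M = (α_ A A M.X).inv ≫ μ[A] ▷ M.X ≫ act M := by
    rw [mul_act]; simp
  have h2 := BraidedCategory.hexagon_reverse A M.X A
  have hc : (β_ A A).hom ≫ μ[A] = μ[A] := IsCommMonObj.mul_comm A
  simp only [ract, whiskerLeft_comp, Category.assoc, h1]
  rw [BraidedCategory.braiding_naturality_left_assoc, h1,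
    reassoc_of% h2, ← comp_whiskerRight_assoc, hc]

end

variable [MonoidalClosed C] [HasCoequalizers C]

variable {A : C} [MonObj A]

/-- The object underlying `M ⊗_A N`: the coequalizer of `M ⊗ A ⊗ N ⇉ M ⊗ N`. -/
noncomputable def tObj (M N : Mod C A) : C :=
  coequalizer (ract M ▷ N.X) ((α_ M.X A N.X).hom ≫ M.X ◁ act N)

/-- The universal balanced morphism. -/
noncomputable def tπ (M N : Mod C A) : M.X ⊗ N.X ⟶ tObj M N :=
  coequalizer.π _ _

/-- Balanced morphisms out of `M ⊗ N`. -/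
def IsBal (M N : Mod C A) {Q : C} (h : M.X ⊗ N.X ⟶ Q) : Prop :=
  ract M ▷ N.X ≫ h = (α_ M.X A N.X).hom ≫ M.X ◁ act N ≫ h

lemma tπ_bal (M N : Mod C A) :
    ract M ▷ N.X ≫ tπ M N = (α_ M.X A N.X).hom ≫ M.X ◁ act N ≫ tπ M N := by
  have := coequalizer.condition (ract M ▷ N.X) ((α_ M.X A N.X).hom ≫ M.X ◁ act N)
  rw [Category.assoc] at this
  exact this

noncomputable def tDesc {M N : Mod C A} {Q : C} (h : M.X ⊗ N.X ⟶ Q) (hh : IsBal M N h) :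
    tObj M N ⟶ Q :=
  coequalizer.desc h (by simpa [IsBal] using hh)

@[simp]
lemma tπ_tDesc {M N : Mod C A} {Q : C} (h : M.X ⊗ N.X ⟶ Q) (hh : IsBal M N h) :
    tπ M N ≫ tDesc h hh = h := coequalizer.π_desc _ _

instance (M N : Mod C A) : Epi (tπ M N) := coequalizer.π_epi

instance epi_whiskerLeft (Z : C) {X Y : C} (f : X ⟶ Y) [Epi f] : Epi (Z ◁ f) :=
  inferInstanceAs (Epi ((tensorLeft Z).map f))

instance epi_whiskerRight (Z : C) {X Y : C} (f : X ⟶ Y) [Epi f] : Epi (f ▷ Z) := by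
  have : f ▷ Z = (β_ _ _).hom ≫ Z ◁ f ≫ (β_ _ _).hom := by simp
  rw [this]; infer_instance

noncomputable def tDescL {M N : Mod C A} {Q : C} (Z : C) (h : Z ⊗ (M.X ⊗ N.X) ⟶ Q)
    (hh : Z ◁ (ract M ▷ N.X) ≫ h = Z ◁ ((α_ M.X A N.X).hom ≫ M.X ◁ act N) ≫ h) :
    Z ⊗ tObj M N ⟶ Q :=
  MonoidalClosed.uncurry (tDesc (MonoidalClosed.curry h) (by
    rw [IsBal, ← MonoidalClosed.curry_natural_left, hh, MonoidalClosed.curry_natural_left,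
      Category.assoc]))

@[simp]
lemma tπ_tDescL {M N : Mod C A} {Q : C} (Z : C) (h : Z ⊗ (M.X ⊗ N.X) ⟶ Q) (hh) :
    Z ◁ tπ M N ≫ tDescL Z h hh = h := by
  rw [tDescL, ← MonoidalClosed.uncurry_natural_left, tπ_tDesc, MonoidalClosed.uncurry_curry]

noncomputable def tDescR {M N : Mod C A} {Q : C} (Z : C) (h : (M.X ⊗ N.X) ⊗ Z ⟶ Q)
    (hh : (ract M ▷ N.X) ▷ Z ≫ h = ((α_ M.X A N.X).hom ≫ M.X ◁ act N) ▷ Z ≫ h) :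
    tObj M N ⊗ Z ⟶ Q :=
  (β_ _ _).hom ≫ tDescL Z ((β_ _ _).hom ≫ h) (by
    rw [BraidedCategory.braiding_naturality_right_assoc, hh,
      BraidedCategory.braiding_naturality_right_assoc])

@[simp]
lemma tπ_tDescR {M N : Mod C A} {Q : C} (Z : C) (h : (M.X ⊗ N.X) ⊗ Z ⟶ Q) (hh) :
    tπ M N ▷ Z ≫ tDescR Z h hh = h := by
  rw [tDescR, BraidedCategory.braiding_naturality_left_assoc, tπ_tDescL,
    SymmetricCategory.symmetry_assoc]

section
variable [IsCommMonObj A]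

noncomputable def tAct (M N : Mod C A) : A ⊗ tObj M N ⟶ tObj M N :=
  tDescL A ((α_ _ _ _).inv ≫ act M ▷ N.X ≫ tπ M N) (by
    have h1 : A ◁ (ract M ▷ N.X) ≫ (α_ _ _ _).inv ≫ act M ▷ N.X =
      (α_ _ _ _).inv ≫ (A ◁ ract M ≫ act M) ▷ N.X := by monoidal
    have h2 : A ◁ ((α_ M.X A N.X).hom ≫ M.X ◁ act N) ≫ (α_ _ _ _).inv ≫ act M ▷ N.X ≫ tπ M N =
      (α_ _ _ _).inv ≫ (α_ _ _ _).inv ▷ N.X ≫ (act M ▷ A) ▷ N.X ≫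
        (α_ M.X A N.X).hom ≫ M.X ◁ act N ≫ tπ M N := by
      have e1 : A ◁ ((α_ M.X A N.X).hom ≫ M.X ◁ act N) ≫ (α_ A M.X N.X).inv =
        A ◁ (α_ M.X A N.X).hom ≫ (α_ _ _ _).inv ≫ (A ⊗ M.X) ◁ act N := by monoidal
      rw [reassoc_of% e1, whisker_exchange_assoc]
      monoidal
    rw [reassoc_of% h1, act_ract, h2, ← tπ_bal]
    monoidal)

@[simp]
lemma tπ_tAct (M N : Mod C A) :
    A ◁ tπ M N ≫ tAct M N = (α_ _ _ _).inv ≫ act M ▷ N.X ≫ tπ M N := tπ_tDescL _ _ _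

noncomputable def tMod (M N : Mod C A) : Mod C A :=
  mkMod (tObj M N) (tAct M N)
    (by
      rw [← cancel_epi (_ ◁ tπ M N), whisker_exchange_assoc]
      simp
      rw [← comp_whiskerRight_assoc, one_act]; simp)
    (by
      have h1 : μ[A] ▷ (M.X ⊗ N.X) ≫ (α_ _ _ _).inv ≫ act M ▷ N.X =
        (α_ _ _ _).inv ≫ (μ[A] ▷ M.X ≫ act M) ▷ N.X := by monoidal
      have h2 : (A ⊗ A) ◁ tπ M N ≫ (α_ _ _ _).hom = (α_ _ _ _).hom ≫ A ◁ A ◁ tπ M N := by monoidal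
      rw [← cancel_epi (_ ◁ tπ M N), whisker_exchange_assoc, tπ_tAct, reassoc_of% h1, mul_act,
        reassoc_of% h2, ← whiskerLeft_comp_assoc, tπ_tAct]
      simp only [whiskerLeft_comp, Category.assoc, tπ_tAct]
      monoidal)

lemma act_tMod (M N : Mod C A) : act (tMod M N) = tAct M N := rfl

/-- The universal balanced morphism, with target the underlying object of the module `M ⊗_A N`. -/
noncomputable def tq (M N : Mod C A) : M.X ⊗ N.X ⟶ (tMod M N).X := tπ M N

instance (M N : Mod C A) : Epi (tq M N) := inferInstanceAs (Epi (tπ M N))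

lemma tq_bal (M N : Mod C A) :
    ract M ▷ N.X ≫ tq M N = (α_ M.X A N.X).hom ≫ M.X ◁ act N ≫ tq M N := tπ_bal M N

/-- The action on `M ⊗_A N` is through the left factor. -/
lemma tq_act (M N : Mod C A) :
    A ◁ tq M N ≫ act (tMod M N) = (α_ _ _ _).inv ≫ act M ▷ N.X ≫ tq M N := tπ_tAct M N

/-- The action on `M ⊗_A N` is also through the right factor. -/
lemma tq_ract (M N : Mod C A) :
    tq M N ▷ A ≫ ract (tMod M N) = (α_ _ _ _).hom ≫ M.X ◁ ract N ≫ tq M N := by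
  have h := BraidedCategory.hexagon_forward M.X N.X A
  have h' := BraidedCategory.hexagon_reverse M.X N.X A
  rw [ract, BraidedCategory.braiding_naturality_left_assoc, tq_act]
  have e : act M ▷ N.X ≫ tq M N = (β_ _ _).hom ▷ N.X ≫ ract M ▷ N.X ≫ tq M N := by
    rw [← comp_whiskerRight_assoc, braid_ract]
  rw [e, tq_bal]
  simp only [ract, whiskerLeft_comp, Category.assoc]
  have h2 : (β_ (M.X ⊗ N.X) A).hom ≫ (α_ A M.X N.X).inv ≫ (β_ A M.X).hom ▷ N.X ≫
      (α_ _ _ _).hom = (α_ _ _ _).hom ≫ M.X ◁ (β_ N.X A).hom := by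
    rw [← cancel_epi (α_ M.X N.X A).inv, reassoc_of% h', ← comp_whiskerRight_assoc,
      SymmetricCategory.symmetry]
    simp
  rw [reassoc_of% h2]

/-- Descent of a balanced morphism to the tensor product. -/
noncomputable def tD {M N : Mod C A} {Q : C} (h : M.X ⊗ N.X ⟶ Q) (hh : IsBal M N h) :
    (tMod M N).X ⟶ Q := tDesc h hh

@[simp]
lemma tq_tD {M N : Mod C A} {Q : C} (h : M.X ⊗ N.X ⟶ Q) (hh : IsBal M N h) :
    tq M N ≫ tD h hh = h := tπ_tDesc h hh

/-- A morphism out of `M ⊗_A N` is semilinear if it is semilinear in the left factor. -/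
lemma isSemi_of_tq {B : C} [MonObj B] {f : A ⟶ B} {M N : Mod C A} {P : Mod C B}
    (s : (tMod M N).X ⟶ P.X)
    (h : act M ▷ N.X ≫ tq M N ≫ s =
      (α_ _ _ _).hom ≫ A ◁ (tq M N ≫ s) ≫ f ▷ P.X ≫ act P) : IsSemi f s := by
  rw [IsSemi, ← cancel_epi (A ◁ tq M N), reassoc_of% tq_act, h]
  simp

section Functoriality

variable {B : C} [MonObj B] [IsCommMonObj B] {f : A ⟶ B} {M N : Mod C A} {M' N' : Mod C B}

/-- The tensor product of two semilinear morphisms. -/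
noncomputable def tMap (f : A ⟶ B) {M N : Mod C A} {M' N' : Mod C B} (s : M.X ⟶ M'.X)
    (t : N.X ⟶ N'.X) (hs : IsSemi f s) (ht : IsSemi f t) : (tMod M N).X ⟶ (tMod M' N').X :=
  tD ((s ⊗ₘ t) ≫ tq M' N') (by
    have e1 : ract M ▷ N.X ≫ (s ⊗ₘ t) = ((ract M ≫ s) ⊗ₘ t) := by
      simp [MonoidalCategory.tensorHom_def]
    have e2 : M.X ◁ act N ≫ (s ⊗ₘ t) = (s ⊗ₘ (act N ≫ t)) := by
      simp [MonoidalCategory.tensorHom_def']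
    rw [IsBal, reassoc_of% e1, reassoc_of% e2, ract_semi hs, act_semi ht]
    have e3 : (((s ⊗ₘ f) ≫ ract M') ⊗ₘ t) = ((s ⊗ₘ f) ⊗ₘ t) ≫ ract M' ▷ N'.X := th1 _ _ _
    have e4 : (s ⊗ₘ (f ⊗ₘ t) ≫ act N') = (s ⊗ₘ (f ⊗ₘ t)) ≫ M'.X ◁ act N' := th2 _ _ _
    rw [e3, e4, Category.assoc, tq_bal, Category.assoc, associator_naturality_assoc])

@[simp]
lemma tq_tMap (s : M.X ⟶ M'.X) (t : N.X ⟶ N'.X) (hs : IsSemi f s) (ht : IsSemi f t) :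
    tq M N ≫ tMap f s t hs ht = (s ⊗ₘ t) ≫ tq M' N' := tq_tD _ _

lemma tMap_semi (s : M.X ⟶ M'.X) (t : N.X ⟶ N'.X) (hs : IsSemi f s) (ht : IsSemi f t) :
    IsSemi f (tMap f s t hs ht) := by
  apply isSemi_of_tq
  rw [tq_tMap]
  have e1 : act M ▷ N.X ≫ (s ⊗ₘ t) = ((act M ≫ s) ⊗ₘ t) := by
    simp [MonoidalCategory.tensorHom_def]
  have e3 : (((f ⊗ₘ s) ≫ act M') ⊗ₘ t) = ((f ⊗ₘ s) ⊗ₘ t) ≫ act M' ▷ N'.X := th1 _ _ _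
  have e5 : (f ⊗ₘ (s ⊗ₘ t)) = A ◁ (s ⊗ₘ t) ≫ f ▷ (M'.X ⊗ N'.X) := by
    rw [MonoidalCategory.tensorHom_def' f]
  have e4 := associator_naturality f s t
  rw [reassoc_of% e1, act_semi hs, e3, Category.assoc, whiskerLeft_comp_assoc,
    whisker_exchange_assoc, tq_act, ← reassoc_of% e5, ← reassoc_of% e4]
  simp

end Functoriality

section Structure

variable (M N P Q : Mod C A)

noncomputable def assocAux : (tMod M N).X ⊗ P.X ⟶ (tMod M (tMod N P)).X :=
  tDescR P.X ((α_ _ _ _).hom ≫ M.X ◁ tq N P ≫ tq M (tMod N P)) (by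
    have e1 : (ract M ▷ N.X) ▷ P.X ≫ (α_ _ _ _).hom ≫ M.X ◁ tq N P =
        (α_ _ _ _).hom ≫ (M.X ⊗ A) ◁ tq N P ≫ ract M ▷ (tMod N P).X := by
      rw [whisker_exchange]; monoidal
    have e2 : ((α_ M.X A N.X).hom ≫ M.X ◁ act N) ▷ P.X ≫ (α_ _ _ _).hom ≫ M.X ◁ tq N P =
        (α_ _ _ _).hom ≫ (α_ _ _ _).hom ≫ M.X ◁ ((α_ _ _ _).inv ≫ act N ▷ P.X ≫ tq N P) := by
      monoidal
    rw [reassoc_of% e1, reassoc_of% e2, tq_bal, ← tq_act]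
    monoidal)

lemma tq_assocAux : tq M N ▷ P.X ≫ assocAux M N P =
    (α_ _ _ _).hom ≫ M.X ◁ tq N P ≫ tq M (tMod N P) := tπ_tDescR _ _ _

noncomputable def assocHom : (tMod (tMod M N) P).X ⟶ (tMod M (tMod N P)).X :=
  tD (assocAux M N P) (by
    rw [IsBal, ← cancel_epi ((tq M N ▷ A) ▷ P.X), ← comp_whiskerRight_assoc, tq_ract]
    have e1 : (tq M N ▷ A) ▷ P.X ≫ (α_ (tMod M N).X A P.X).hom ≫ (tMod M N).X ◁ act P =
        (α_ _ _ _).hom ≫ (M.X ⊗ N.X) ◁ act P ≫ tq M N ▷ P.X := by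
      rw [whisker_exchange]; monoidal
    rw [reassoc_of% e1, tq_assocAux]
    have e2 : ((α_ M.X N.X A).hom ≫ M.X ◁ ract N ≫ tq M N) ▷ P.X ≫ assocAux M N P =
        ((α_ M.X N.X A).hom ≫ M.X ◁ ract N) ▷ P.X ≫ tq M N ▷ P.X ≫ assocAux M N P := by
      simp
    rw [e2, tq_assocAux]
    have e3 : ((α_ M.X N.X A).hom ≫ M.X ◁ ract N) ▷ P.X ≫ (α_ _ _ _).hom ≫ M.X ◁ tq N P =
      (α_ _ _ _).hom ▷ _ ≫ (α_ _ _ _).hom ≫ M.X ◁ (ract N ▷ P.X ≫ tq N P) := by monoidal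
    rw [reassoc_of% e3, tq_bal]
    monoidal)

lemma tq_assocHom : tq M N ▷ P.X ≫ tq (tMod M N) P ≫ assocHom M N P =
    (α_ _ _ _).hom ≫ M.X ◁ tq N P ≫ tq M (tMod N P) := by
  rw [assocHom, tq_tD, tq_assocAux]

variable {M N P} in
lemma t3_ext {Z : C} {f g : (tMod (tMod M N) P).X ⟶ Z}
    (h : tq M N ▷ P.X ≫ tq (tMod M N) P ≫ f = tq M N ▷ P.X ≫ tq (tMod M N) P ≫ g) : f = g := by
  rwa [cancel_epi, cancel_epi] at h

lemma assocHom_semi : IsSemi (𝟙 A) (assocHom M N P) := by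
  apply isSemi_of_tq
  rw [← cancel_epi ((A ◁ tq M N) ▷ P.X), ← comp_whiskerRight_assoc, tq_act]
  have e1 : ((α_ A M.X N.X).inv ≫ act M ▷ N.X ≫ tq M N) ▷ P.X =
    (α_ A M.X N.X).inv ▷ P.X ≫ (act M ▷ N.X) ▷ P.X ≫ tq M N ▷ P.X := by simp
  rw [e1, Category.assoc, Category.assoc, tq_assocHom]
  have e2 : (A ◁ tq M N) ▷ P.X ≫ (α_ _ _ _).hom ≫
      A ◁ (tq (tMod M N) P ≫ assocHom M N P) = (α_ _ _ _).hom ≫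
      A ◁ (tq M N ▷ P.X ≫ tq (tMod M N) P ≫ assocHom M N P) := by monoidal
  rw [reassoc_of% e2, tq_assocHom]
  simp only [id_whiskerRight, Category.id_comp, whiskerLeft_comp, Category.assoc, tq_act]
  have e3 : A ◁ M.X ◁ tq N P ≫ (α_ _ _ _).inv ≫ act M ▷ (tMod N P).X =
    (α_ _ _ _).inv ≫ act M ▷ (N.X ⊗ P.X) ≫ M.X ◁ tq N P := by
    rw [← whisker_exchange]; monoidal
  rw [reassoc_of% e3]
  monoidal

noncomputable def assocInvAux : M.X ⊗ (tMod N P).X ⟶ (tMod (tMod M N) P).X :=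
  tDescL M.X ((α_ _ _ _).inv ≫ tq M N ▷ P.X ≫ tq (tMod M N) P) (by
    have e1 : M.X ◁ (ract N ▷ P.X) ≫ (α_ _ _ _).inv ≫ tq M N ▷ P.X =
        (α_ _ _ _).inv ≫ (α_ _ _ _).inv ▷ P.X ≫
          ((α_ _ _ _).hom ≫ M.X ◁ ract N ≫ tq M N) ▷ P.X := by
      monoidal
    have e2 : M.X ◁ ((α_ N.X A P.X).hom ≫ N.X ◁ act P) ≫ (α_ _ _ _).inv ≫ tq M N ▷ P.X =
        M.X ◁ (α_ N.X A P.X).hom ≫ (α_ _ _ _).inv ≫ tq M N ▷ (A ⊗ P.X) ≫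
          (tMod M N).X ◁ act P := by
      rw [← whisker_exchange]; monoidal
    rw [reassoc_of% e1, reassoc_of% e2, ← tq_ract]
    simp only [comp_whiskerRight, Category.assoc, tq_bal]
    monoidal)

lemma tq_assocInvAux : M.X ◁ tq N P ≫ assocInvAux M N P =
    (α_ _ _ _).inv ≫ tq M N ▷ P.X ≫ tq (tMod M N) P := tπ_tDescL _ _ _

noncomputable def assocInv : (tMod M (tMod N P)).X ⟶ (tMod (tMod M N) P).X :=
  tD (assocInvAux M N P) (by
    rw [IsBal, ← cancel_epi ((M.X ⊗ A) ◁ tq N P), whisker_exchange_assoc, tq_assocInvAux]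
    have e1 : (M.X ⊗ A) ◁ tq N P ≫ (α_ M.X A (tMod N P).X).hom ≫ M.X ◁ act (tMod N P) =
        (α_ _ _ _).hom ≫ M.X ◁ (A ◁ tq N P ≫ act (tMod N P)) := by monoidal
    rw [reassoc_of% e1, tq_act]
    simp only [whiskerLeft_comp, Category.assoc, tq_assocInvAux]
    have e2 : ract M ▷ (N.X ⊗ P.X) ≫ (α_ _ _ _).inv ≫ tq M N ▷ P.X =
      (α_ _ _ _).inv ≫ (ract M ▷ N.X ≫ tq M N) ▷ P.X := by monoidal
    rw [reassoc_of% e2, tq_bal]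
    monoidal)

lemma tq_assocInv : M.X ◁ tq N P ≫ tq M (tMod N P) ≫ assocInv M N P =
    (α_ _ _ _).inv ≫ tq M N ▷ P.X ≫ tq (tMod M N) P := by
  rw [assocInv, tq_tD, tq_assocInvAux]

/-- The associativity constraint of `⊗_A`. -/
noncomputable def assocIso : tMod (tMod M N) P ≅ tMod M (tMod N P) where
  hom := mkHom (assocHom M N P) (assocHom_semi M N P)
  inv := mkHom (assocInv M N P) (by
    have h := assocHom_semi M N P
    have h1 : assocHom M N P ≫ assocInv M N P = 𝟙 _ := t3_ext (by
      rw [reassoc_of% tq_assocHom, tq_assocInv]; simp)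
    have h2 : assocInv M N P ≫ assocHom M N P = 𝟙 _ := by
      rw [← cancel_epi (tq M (tMod N P)), ← cancel_epi (M.X ◁ tq N P), reassoc_of% tq_assocInv,
        tq_assocHom]; simp
    unfold IsSemi at h ⊢
    have : IsIso (assocHom M N P) := ⟨_, h1, h2⟩
    rw [← cancel_mono (assocHom M N P), Category.assoc, h2, ← cancel_epi (A ◁ assocHom M N P)]
    simp only [id_whiskerRight, Category.id_comp, Category.assoc, Category.comp_id] at h ⊢
    rw [h, ← whiskerLeft_comp_assoc, ← h, h1]
    simp)
  hom_inv_id := Mod.hom_ext _ _ (t3_ext (by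
    change tq M N ▷ P.X ≫ tq (tMod M N) P ≫ assocHom M N P ≫ assocInv M N P = _ ≫ _ ≫ 𝟙 _
    rw [reassoc_of% tq_assocHom, tq_assocInv]; simp))
  inv_hom_id := Mod.hom_ext _ _ (by
    change assocInv M N P ≫ assocHom M N P = 𝟙 _
    rw [← cancel_epi (tq M (tMod N P)), ← cancel_epi (M.X ◁ tq N P), reassoc_of% tq_assocInv,
        tq_assocHom]; simp)

end Structure
section Structure2

variable (M N P : Mod C A)

lemma braid_key (X Y Z : C) : (β_ (X ⊗ Y) Z).hom = (α_ _ _ _).hom ≫ X ◁ (β_ Y Z).hom ≫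
    (β_ X (Z ⊗ Y)).hom ≫ (α_ _ _ _).hom ≫ Z ◁ (β_ Y X).hom := by
  have h6 : (β_ (X ⊗ Y) Z).hom = (α_ _ _ _).hom ≫ X ◁ (β_ Y Z).hom ≫
      (α_ _ _ _).inv ≫ (β_ X Z).hom ▷ Y ≫ (α_ _ _ _).hom := by
    rw [← cancel_epi (α_ X Y Z).inv, ← cancel_mono (α_ Z X Y).inv]
    have := BraidedCategory.hexagon_reverse X Y Z
    simp only [Category.assoc, this]
    simp
  have h7 : (β_ X (Z ⊗ Y)).hom ≫ (α_ _ _ _).hom =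
      (α_ _ _ _).inv ≫ (β_ X Z).hom ▷ Y ≫ (α_ _ _ _).hom ≫ Z ◁ (β_ X Y).hom := by
    rw [← cancel_epi (α_ X Z Y).hom]
    have := BraidedCategory.hexagon_forward X Z Y
    simp only [this]
    simp
  rw [h6, reassoc_of% h7, ← whiskerLeft_comp, SymmetricCategory.symmetry]
  simp

/-- The universal balanced morphism in the case of the module `A` itself. -/
noncomputable def tqA : A ⊗ M.X ⟶ (tMod (reg A) M).X := tq (reg A) M

instance : Epi (tqA M) := inferInstanceAs (Epi (tq (reg A) M))

lemma tqA_bal : μ[A] ▷ M.X ≫ tqA M = (α_ _ _ _).hom ≫ A ◁ act M ≫ tqA M := by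
  have h := tq_bal (reg A) M
  have hr : ract (reg A) = μ[A] := IsCommMonObj.mul_comm A
  rw [hr] at h
  exact h

noncomputable def lunit : (tMod (reg A) M).X ⟶ M.X :=
  tD (M := reg A) (act M) (by
    have hr : ract (reg A) = μ[A] := IsCommMonObj.mul_comm A
    unfold IsBal
    rw [hr]
    exact mul_act M)

@[simp]
lemma tqA_lunit : tqA M ≫ lunit M = act M := tq_tD _ _

noncomputable def lunitInv : M.X ⟶ (tMod (reg A) M).X :=
  (λ_ M.X).inv ≫ η[A] ▷ M.X ≫ tqA M

lemma lunitInv_lunit : lunitInv M ≫ lunit M = 𝟙 _ := by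
  simp only [lunitInv, Category.assoc, tqA_lunit, one_act]
  simp

lemma lunit_lunitInv : lunit M ≫ lunitInv M = 𝟙 _ := by
  rw [← cancel_epi (tqA M), reassoc_of% tqA_lunit, lunitInv, Category.comp_id]
  have h' : A ◁ act M ≫ tqA M =
    (α_ A A M.X).inv ≫ μ[A] ▷ M.X ≫ tqA M := by
      rw [Iso.eq_inv_comp]; exact (tqA_bal M).symm
  have e1 : act M ≫ (λ_ M.X).inv ≫ η[A] ▷ M.X =
    (λ_ _).inv ≫ η[A] ▷ (A ⊗ M.X) ≫ A ◁ act M := by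
    rw [← whisker_exchange]; monoidal
  have e2 : (λ_ (A ⊗ M.X)).inv ≫ η[A] ▷ (A ⊗ M.X) ≫ (α_ A A M.X).inv ≫ μ[A] ▷ M.X =
    (λ_ (A ⊗ M.X)).inv ≫ (α_ _ _ _).inv ≫ (η[A] ▷ A ≫ μ[A]) ▷ M.X := by monoidal
  rw [MonObj.one_mul] at e2
  rw [reassoc_of% e1, h', reassoc_of% e2]
  monoidal

/-- The inverse of a semilinear isomorphism is linear. -/
lemma isSemi_inv {M N : Mod C A} {f : M.X ⟶ N.X} {g : N.X ⟶ M.X} (h : IsSemi (𝟙 A) f)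
    (h1 : f ≫ g = 𝟙 _) (h2 : g ≫ f = 𝟙 _) : IsSemi (𝟙 A) g := by
  unfold IsSemi at h ⊢
  have : IsIso f := ⟨_, h1, h2⟩
  rw [← cancel_mono f, Category.assoc, h2, ← cancel_epi (A ◁ f)]
  simp only [id_whiskerRight, Category.id_comp, Category.assoc, Category.comp_id] at h ⊢
  rw [h, ← whiskerLeft_comp_assoc, ← h, h1]
  simp

/-- Constructor for isomorphisms of modules. -/
def mkIso {M N : Mod C A} (f : M.X ⟶ N.X) (g : N.X ⟶ M.X) (h : IsSemi (𝟙 A) f)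
    (h1 : f ≫ g = 𝟙 _) (h2 : g ≫ f = 𝟙 _) : M ≅ N where
  hom := mkHom f h
  inv := mkHom g (isSemi_inv h h1 h2)
  hom_inv_id := Mod.hom_ext _ _ h1
  inv_hom_id := Mod.hom_ext _ _ h2

lemma lunit_semi : IsSemi (𝟙 A) (lunit M) := by
  have key : act (reg A) ▷ M.X ≫ act M = (α_ _ _ _).hom ≫ A ◁ act M ≫ act M :=
    mul_act M
  apply isSemi_of_tq
  change _ ▷ _ ≫ tqA M ≫ lunit M = (α_ _ _ _).hom ≫ A ◁ (tqA M ≫ lunit M) ≫ _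
  rw [tqA_lunit]
  simp only [id_whiskerRight, Category.id_comp]
  exact key

/-- The left unit constraint of `⊗_A`. -/
noncomputable def lunitIso : tMod (reg A) M ≅ M :=
  mkIso (lunit M) (lunitInv M) (lunit_semi M) (lunit_lunitInv M) (lunitInv_lunit M)

noncomputable def tBraid : (tMod M N).X ⟶ (tMod N M).X :=
  tD ((β_ M.X N.X).hom ≫ tq N M) (by
    have e1 : M.X ◁ act N = M.X ◁ (β_ _ _).hom ≫ M.X ◁ ract N := by
      rw [← whiskerLeft_comp, braid_ract]
    have e2 : N.X ◁ ract M = N.X ◁ (β_ _ _).hom ≫ N.X ◁ act M := by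
      rw [← whiskerLeft_comp, braid_act]
    have e3 : N.X ◁ (β_ A M.X).hom ≫ N.X ◁ (β_ M.X A).hom = 𝟙 _ := by
      rw [← whiskerLeft_comp, SymmetricCategory.symmetry, MonoidalCategory.whiskerLeft_id]
    rw [IsBal, BraidedCategory.braiding_naturality_left_assoc, e1, Category.assoc,
      BraidedCategory.braiding_naturality_right_assoc, tq_bal, e2, Category.assoc, braid_key]
    simp only [Category.assoc, reassoc_of% e3])

@[simp]
lemma tq_tBraid : tq M N ≫ tBraid M N = (β_ M.X N.X).hom ≫ tq N M := tq_tD _ _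

lemma tBraid_semi : IsSemi (𝟙 A) (tBraid M N) := by
  apply isSemi_of_tq
  rw [tq_tBraid, BraidedCategory.braiding_naturality_left_assoc]
  have e1 : A ◁ tq N M ≫ act (tMod N M) =
      (β_ _ _).hom ≫ (α_ _ _ _).hom ≫ N.X ◁ ract M ≫ tq N M := by
    rw [← tq_ract, ← braid_ract, BraidedCategory.braiding_naturality_right_assoc]
  simp only [id_whiskerRight, Category.id_comp, whiskerLeft_comp, Category.assoc]
  rw [e1, braid_key]
  simp only [ract, whiskerLeft_comp, Category.assoc]

lemma tBraid_tBraid : tBraid M N ≫ tBraid N M = 𝟙 _ := by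
  rw [← cancel_epi (tq M N), reassoc_of% tq_tBraid, tq_tBraid, SymmetricCategory.symmetry_assoc,
    Category.comp_id]

/-- The symmetry of `⊗_A`. -/
noncomputable def braidIso : tMod M N ≅ tMod N M :=
  mkIso (tBraid M N) (tBraid N M) (tBraid_semi M N) (tBraid_tBraid M N) (tBraid_tBraid N M)

section Naturality

variable {B : C} [MonObj B] [IsCommMonObj B] {f : A ⟶ B} {M N P : Mod C A} {M' N' P' : Mod C B}
  {s : M.X ⟶ M'.X} {t : N.X ⟶ N'.X} {r : P.X ⟶ P'.X}

lemma tMap_tBraid (hs : IsSemi f s) (ht : IsSemi f t) :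
    tMap f s t hs ht ≫ tBraid M' N' = tBraid M N ≫ tMap f t s ht hs := by
  rw [← cancel_epi (tq M N), reassoc_of% tq_tMap, reassoc_of% tq_tBraid, tq_tBraid, tq_tMap]
  simp

lemma tMap_assoc (hs : IsSemi f s) (ht : IsSemi f t) (hr : IsSemi f r) :
    tMap f (tMap f s t hs ht) r (tMap_semi _ _ _ _) hr ≫ assocHom M' N' P' =
      assocHom M N P ≫ tMap f s (tMap f t r ht hr) hs (tMap_semi _ _ _ _) := by
  apply t3_ext
  rw [reassoc_of% tq_assocHom, tq_tMap, reassoc_of% tq_tMap]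
  have e1 : tq M N ▷ P.X ≫ (tMap f s t hs ht ⊗ₘ r) = ((s ⊗ₘ t) ⊗ₘ r) ≫ tq M' N' ▷ P'.X := by
    rw [MonoidalCategory.tensorHom_def (tMap f s t hs ht), ← comp_whiskerRight_assoc, tq_tMap,
      ← th1, MonoidalCategory.tensorHom_def ((s ⊗ₘ t) ≫ tq M' N')]
  have e2 : M.X ◁ tq N P ≫ (s ⊗ₘ tMap f t r ht hr) = (s ⊗ₘ (t ⊗ₘ r)) ≫ M'.X ◁ tq N' P' := by
    rw [MonoidalCategory.tensorHom_def' s, ← whiskerLeft_comp_assoc, tq_tMap,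
      ← th2, MonoidalCategory.tensorHom_def' s ((t ⊗ₘ r) ≫ tq N' P')]
  rw [reassoc_of% e1, reassoc_of% e2, tq_assocHom, associator_naturality_assoc]

lemma tMap_id_id (M N : Mod C A) (h h') : tMap (𝟙 A) (M := M) (N := N) (𝟙 M.X) (𝟙 N.X) h h' = 𝟙 _ := by
  rw [← cancel_epi (tq M N), tq_tMap]; simp

lemma tMap_comp {D : C} [MonObj D] [IsCommMonObj D] {g : B ⟶ D} {M'' N'' : Mod C D}
    {s' : M'.X ⟶ M''.X} {t' : N'.X ⟶ N''.X} (hs : IsSemi f s) (ht : IsSemi f t)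
    (hs' : IsSemi g s') (ht' : IsSemi g t') (h h') :
    tMap f s t hs ht ≫ tMap g s' t' hs' ht' = tMap (f ≫ g) (s ≫ s') (t ≫ t') h h' := by
  rw [← cancel_epi (tq M N), reassoc_of% tq_tMap, tq_tMap, tq_tMap]; simp

lemma tMap_lunit (hf : IsSemi (M := reg A) (N := reg B) f f)
    (hs : IsSemi f s) :
    tMap (M := reg A) (M' := reg B) f f s hf hs ≫ lunit M' = lunit M ≫ s := by
  rw [← cancel_epi (tqA M), reassoc_of% tqA_lunit, act_semi hs]
  have : tqA M ≫ tMap (M := reg A) (M' := reg B) f f s hf hs =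
    (f ⊗ₘ s) ≫ tqA M' := tq_tMap _ _ _ _
  rw [reassoc_of% this, tqA_lunit]

end Naturality

end Structure2
section Instances

/-- Tensor product of linear maps. -/
noncomputable def tHom {M N M' N' : Mod C A} (s : M ⟶ M') (t : N ⟶ N') :
    tMod M N ⟶ tMod M' N' :=
  mkHom (tMap (𝟙 A) s.hom t.hom (isSemi_hom s) (isSemi_hom t)) (tMap_semi _ _ _ _)

@[simp]
lemma tq_tHom {M N M' N' : Mod C A} (s : M ⟶ M') (t : N ⟶ N') :
    tq M N ≫ (tHom s t).hom = (s.hom ⊗ₘ t.hom) ≫ tq M' N' :=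
  tq_tMap _ _ (isSemi_hom s) (isSemi_hom t)

/-- The right unit constraint of `⊗_A`. -/
noncomputable def runitIso (M : Mod C A) : tMod M (reg A) ≅ M :=
  braidIso M (reg A) ≪≫ lunitIso M

/-- The universal balanced morphism in the case of the module `A` itself. -/
noncomputable def tqA' (M : Mod C A) : M.X ⊗ A ⟶ (tMod M (reg A)).X :=
  tq M (reg A)

lemma tqA'_runit (M : Mod C A) : tqA' M ≫ (runitIso M).hom.hom = ract M := by
  change tq M (reg A) ≫ tBraid _ _ ≫ lunit M = _
  rw [reassoc_of% tq_tBraid]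
  change (β_ M.X A).hom ≫ tqA M ≫ lunit M = _
  rw [tqA_lunit, ract]

/-- The tensor product `⊗_A` of modules over a commutative monoid object, with unit `A`. -/
noncomputable instance : MonoidalCategoryStruct (Mod C A) where
  tensorObj := tMod
  tensorUnit := reg A
  tensorHom := tHom
  whiskerLeft M _ _ g := tHom (𝟙 M) g
  whiskerRight f N := tHom f (𝟙 N)
  associator := assocIso
  leftUnitor := lunitIso
  rightUnitor := runitIso

lemma pentagon_aux (W X Y Z : Mod C A) :
    (tHom (assocIso W X Y).hom (𝟙 Z)).hom ≫ assocHom W (tMod X Y) Z ≫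
      (tHom (𝟙 W) (assocIso X Y Z).hom).hom =
    assocHom (tMod W X) Y Z ≫ assocHom W X (tMod Y Z) := by
  apply t3_ext
  rw [← cancel_epi ((tq W X ▷ Y.X) ▷ Z.X), reassoc_of% tq_assocHom, reassoc_of% tq_tHom]
  have e1 : (tq W X ▷ Y.X) ▷ Z.X ≫ tq (tMod W X) Y ▷ Z.X ≫
      ((assocIso W X Y).hom.hom ⊗ₘ (𝟙 Z : Z ⟶ Z).hom) =
      (tq W X ▷ Y.X ≫ tq (tMod W X) Y ≫ assocHom W X Y) ▷ Z.X := by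
    simp [assocIso]
  have e2 : (tq W X ▷ Y.X) ▷ Z.X ≫ (α_ (tMod W X).X Y.X Z.X).hom ≫ (tMod W X).X ◁ tq Y Z =
      (α_ _ _ _).hom ≫ (W.X ⊗ X.X) ◁ tq Y Z ≫ tq W X ▷ (tMod Y Z).X := by
    rw [whisker_exchange]; monoidal
  rw [reassoc_of% e1, reassoc_of% e2, tq_assocHom, tq_assocHom]
  simp only [comp_whiskerRight, Category.assoc, reassoc_of% tq_assocHom, tq_tHom]
  have e3 : W.X ◁ tq (tMod X Y) Z ≫ ((𝟙 W : W ⟶ W).hom ⊗ₘ (assocIso X Y Z).hom.hom) =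
      W.X ◁ (tq (tMod X Y) Z ≫ assocHom X Y Z) := by
    simp [assocIso]
  have e4 : (W.X ◁ tq X Y) ▷ Z.X ≫ (α_ _ _ _).hom ≫ W.X ◁ (tq (tMod X Y) Z ≫ assocHom X Y Z) =
      (α_ _ _ _).hom ≫ W.X ◁ (tq X Y ▷ Z.X ≫ tq (tMod X Y) Z ≫ assocHom X Y Z) := by monoidal
  rw [reassoc_of% e3, reassoc_of% e4, tq_assocHom]
  monoidal

lemma triangle_aux (X Y : Mod C A) :
    assocHom X (reg A) Y ≫ (tHom (𝟙 X) (lunitIso Y).hom).hom =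
      (tHom (runitIso X).hom (𝟙 Y)).hom := by
  apply t3_ext
  rw [reassoc_of% tq_assocHom, tq_tHom, tq_tHom]
  change (α_ X.X A Y.X).hom ≫ X.X ◁ tqA Y ≫ (𝟙 X.X ⊗ₘ lunit Y) ≫ tq X Y =
    tqA' X ▷ Y.X ≫ ((runitIso X).hom.hom ⊗ₘ 𝟙 Y.X) ≫ tq X Y
  rw [id_tensorHom, tensorHom_id, ← whiskerLeft_comp_assoc, tqA_lunit,
    ← comp_whiskerRight_assoc, tqA'_runit, tq_bal]

noncomputable instance : MonoidalCategory (Mod C A) := MonoidalCategory.ofTensorHom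
  (id_tensorHom_id := fun M N => Mod.hom_ext _ _ (tMap_id_id M N (isSemi_hom (𝟙 M)) (isSemi_hom (𝟙 N))))
  (id_tensorHom := fun _ _ _ _ => rfl)
  (tensorHom_id := fun _ _ => rfl)
  (tensorHom_comp_tensorHom := fun {M _ _ N _ _} f₁ f₂ g₁ g₂ => Mod.hom_ext _ _ (by
    change (tHom f₁ f₂).hom ≫ (tHom g₁ g₂).hom = (tHom _ _).hom
    rw [← cancel_epi (tq M N), reassoc_of% tq_tHom, tq_tHom, tq_tHom]; simp))
  (associator_naturality := fun f₁ f₂ f₃ => Mod.hom_ext _ _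
    (tMap_assoc (isSemi_hom f₁) (isSemi_hom f₂) (isSemi_hom f₃)))
  (leftUnitor_naturality := fun {M N} f => Mod.hom_ext _ _ (by
    change (tHom (𝟙 (reg A)) f).hom ≫ lunit N = lunit M ≫ f.hom
    exact tMap_lunit (f := 𝟙 A) (isSemi_hom (𝟙 (reg A))) (isSemi_hom f)))
  (rightUnitor_naturality := fun {M N} f => Mod.hom_ext _ _ (by
    change (tHom f (𝟙 (reg A))).hom ≫ tBraid _ _ ≫ lunit N =
      (tBraid _ _ ≫ lunit M) ≫ f.hom
    have h1 : (tHom f (𝟙 (reg A))).hom ≫ tBraid _ _ =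
        tBraid _ _ ≫ (tHom (𝟙 (reg A)) f).hom :=
      tMap_tBraid (isSemi_hom f) (isSemi_hom (𝟙 (reg A)))
    have h2 : (tHom (𝟙 (reg A)) f).hom ≫ lunit N = lunit M ≫ f.hom :=
      tMap_lunit (f := 𝟙 A) (isSemi_hom (𝟙 (reg A))) (isSemi_hom f)
    rw [Category.assoc, ← h2]
    rw [reassoc_of% h1]))
  (pentagon := fun W X Y Z => Mod.hom_ext _ _ (pentagon_aux W X Y Z))
  (triangle := fun X Y => Mod.hom_ext _ _ (triangle_aux X Y))


lemma hexagon_aux (X Y Z : Mod C A) :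
    assocHom X Y Z ≫ tBraid X (tMod Y Z) ≫ assocHom Y Z X =
      (tHom (braidIso X Y).hom (𝟙 Z)).hom ≫ assocHom Y X Z ≫
        (tHom (𝟙 Y) (braidIso X Z).hom).hom := by
  apply t3_ext
  rw [reassoc_of% tq_assocHom, reassoc_of% tq_tBraid, reassoc_of% tq_tHom]
  have e1 : tq X Y ▷ Z.X ≫ ((braidIso X Y).hom.hom ⊗ₘ (𝟙 Z : Z ⟶ Z).hom) =
      (β_ _ _).hom ▷ Z.X ≫ tq Y X ▷ Z.X := by
    have : tq X Y ≫ (braidIso X Y).hom.hom = (β_ _ _).hom ≫ tq Y X := tq_tBraid X Y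
    rw [Mod.id_hom', tensorHom_id, ← comp_whiskerRight, this, comp_whiskerRight]
  have e2 : Y.X ◁ tq X Z ≫ ((𝟙 Y : Y ⟶ Y).hom ⊗ₘ (braidIso X Z).hom.hom) =
      Y.X ◁ (β_ _ _).hom ≫ Y.X ◁ tq Z X := by
    have : tq X Z ≫ (braidIso X Z).hom.hom = (β_ _ _).hom ≫ tq Z X := tq_tBraid X Z
    rw [Mod.id_hom', id_tensorHom, ← whiskerLeft_comp, this, whiskerLeft_comp]
  rw [reassoc_of% e1, reassoc_of% tq_assocHom, tq_tHom, reassoc_of% e2,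
    BraidedCategory.braiding_naturality_right_assoc, tq_assocHom]
  have h := BraidedCategory.hexagon_forward X.X Y.X Z.X
  rw [reassoc_of% h]

lemma hexagon_aux' (X Y Z : Mod C A) :
    (α_ X Y Z).inv ≫ (braidIso (X ⊗ Y) Z).hom ≫ (α_ Z X Y).inv =
      X ◁ (braidIso Y Z).hom ≫ (α_ X Z Y).inv ≫ (braidIso X Z).hom ▷ Y := by
  have h : (α_ Z X Y).hom ≫ (braidIso Z (X ⊗ Y)).hom ≫ (α_ X Y Z).hom =
    (braidIso Z X).hom ▷ Y ≫ (α_ X Z Y).hom ≫ X ◁ (braidIso Z Y).hom :=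
    Mod.hom_ext _ _ (hexagon_aux Z X Y)
  have hs : ∀ P Q : Mod C A, (braidIso P Q).hom = (braidIso Q P).inv := fun _ _ => rfl
  rw [hs, hs X Z, hs Y Z]
  rw [← cancel_epi (α_ X Y Z).hom, ← cancel_epi (braidIso Z (X ⊗ Y)).hom,
    ← cancel_epi (α_ Z X Y).hom, Iso.hom_inv_id_assoc, Iso.hom_inv_id_assoc,
    reassoc_of% h]
  simp
  rfl

lemma braid_nat_right (X : Mod C A) {Y Z : Mod C A} (f : Y ⟶ Z) :
    X ◁ f ≫ (braidIso X Z).hom = (braidIso X Y).hom ≫ f ▷ X :=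
  Mod.hom_ext _ _ (tMap_tBraid (isSemi_hom (𝟙 X)) (isSemi_hom f))

lemma braid_nat_left {X Y : Mod C A} (f : X ⟶ Y) (Z : Mod C A) :
    f ▷ Z ≫ (braidIso Y Z).hom = (braidIso X Z).hom ≫ Z ◁ f :=
  Mod.hom_ext _ _ (tMap_tBraid (isSemi_hom f) (isSemi_hom (𝟙 Z)))

noncomputable instance : BraidedCategory (Mod C A) where
  braiding X Y := braidIso X Y
  braiding_naturality_right := fun X _ _ f => braid_nat_right X f
  braiding_naturality_left := fun f Z => braid_nat_left f Z
  hexagon_forward := fun X Y Z => Mod.hom_ext _ _ (hexagon_aux X Y Z)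
  hexagon_reverse := hexagon_aux'

noncomputable instance : SymmetricCategory (Mod C A) where
  symmetry := fun X Y => (braidIso X Y).hom_inv_id

end Instances
section BaseChange


variable {A B : C} [MonObj A] [MonObj B] [IsCommMonObj A] [IsCommMonObj B]

lemma ract_res (f : A ⟶ B) [IsMonHom f] (N : Mod C B) : ract (res f N) = N.X ◁ f ≫ ract N := by
  change (β_ N.X A).hom ≫ f ▷ N.X ≫ act N = _
  rw [ract, BraidedCategory.braiding_naturality_right_assoc]

lemma id_semi (f : A ⟶ B) [IsMonHom f] (N : Mod C B) :
    IsSemi (M := res f N) (N := N) f (𝟙 N.X) := by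
  change (f ▷ N.X ≫ act N) ≫ 𝟙 N.X = A ◁ 𝟙 N.X ≫ f ▷ N.X ≫ act N
  simp

lemma ract_one (M : Mod C A) : M.X ◁ η[A] ≫ ract M = (ρ_ M.X).hom := by
  rw [ract, BraidedCategory.braiding_naturality_right_assoc, one_act]; simp

lemma ract_mul (M : Mod C A) :
    M.X ◁ μ[A] ≫ ract M = (α_ M.X A A).inv ≫ ract M ▷ A ≫ ract M := by
  have h := act_ract M
  have hc : (β_ A A).hom ≫ μ[A] = μ[A] := IsCommMonObj.mul_comm A
  have h1 : act M ▷ A ≫ ract M = (β_ _ _).hom ≫ A ◁ act M ≫ act M := by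
    rw [ract, BraidedCategory.braiding_naturality_left_assoc]
  have e : ract M ▷ A = (β_ _ _).hom ▷ A ≫ act M ▷ A := by rw [ract, comp_whiskerRight]
  have h2 : A ◁ act M ≫ act M = (α_ A A M.X).inv ≫ μ[A] ▷ M.X ≫ act M := by
    rw [mul_act]; simp
  have h3 := BraidedCategory.hexagon_forward M.X A A
  have h4 : (α_ M.X A A).inv ≫ (β_ M.X A).hom ▷ A =
    (β_ M.X (A ⊗ A)).hom ≫ (α_ A A M.X).hom ≫ A ◁ (β_ A M.X).hom ≫ (α_ A M.X A).inv := by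
    rw [← cancel_mono (α_ A M.X A).hom, ← cancel_mono (A ◁ (β_ M.X A).hom),
      ← cancel_epi (α_ M.X A A).hom]
    simp [← whiskerLeft_comp]
  have h5 : A ◁ (β_ A M.X).hom ≫ (α_ A M.X A).inv ≫ (β_ (A ⊗ M.X) A).hom =
      (α_ A A M.X).inv ≫ (β_ A A).hom ▷ M.X ≫ (α_ A A M.X).hom := by
    have h6 := BraidedCategory.hexagon_reverse A M.X A
    rw [← cancel_mono (α_ A A M.X).inv]
    simp only [Category.assoc, h6]
    simp [← whiskerLeft_comp_assoc]
  rw [e, Category.assoc, h1, reassoc_of% h4, reassoc_of% h5, h2, Iso.hom_inv_id_assoc,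
    Iso.hom_inv_id_assoc, ← comp_whiskerRight_assoc, hc, ract,
    BraidedCategory.braiding_naturality_right_assoc]

/-- The canonical morphism `B ⊗_A M ⟶ N`, `b ⊗ m ↦ b • s(m)`, attached to an `f`-semilinear
morphism `s : M ⟶ N`, where `f : A ⟶ B`. -/
noncomputable def bcMap (f : A ⟶ B) [IsMonHom f] {M : Mod C A} {N : Mod C B} (s : M.X ⟶ N.X)
    (hs : IsSemi f s) : (tMod (res f (reg B)) M).X ⟶ N.X :=
  tD (M := res f (reg B)) (B ◁ s ≫ act N) (by
    have h : act M ≫ s = A ◁ s ≫ f ▷ N.X ≫ act N := hs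
    have h1 : μ[B] ▷ N.X ≫ act N = (α_ B B N.X).hom ≫ B ◁ act N ≫ act N := mul_act N
    have hc : (β_ B B).hom ≫ μ[B] = μ[B] := IsCommMonObj.mul_comm B
    have h2 : ract (res f (reg B)) = B ◁ f ≫ μ[B] := by
      rw [ract_res]
      change B ◁ f ≫ (β_ B B).hom ≫ μ[B] = _
      rw [hc]
    change ract (res f (reg B)) ▷ M.X ≫ B ◁ s ≫ act N =
      (α_ B A M.X).hom ≫ B ◁ act M ≫ B ◁ s ≫ act N
    rw [h2, comp_whiskerRight_assoc, ← whiskerLeft_comp_assoc, h, ← whisker_exchange_assoc, h1,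
      whisker_exchange_assoc]
    monoidal)

lemma tq_bcMap (f : A ⟶ B) [IsMonHom f] {M : Mod C A} {N : Mod C B} (s : M.X ⟶ N.X)
    (hs : IsSemi f s) :
    (tq (res f (reg B)) M : B ⊗ M.X ⟶ _) ≫ bcMap f s hs = B ◁ s ≫ act N :=
  tq_tD (M := res f (reg B)) _ _

/-- A semilinear morphism `s : M ⟶ N` over `f : A ⟶ B` exhibits `N` as the base change of `M`
if the canonical morphism `B ⊗_A M ⟶ N` is an isomorphism. -/
def IsBaseChange (f : A ⟶ B) [IsMonHom f] {M : Mod C A} {N : Mod C B} (s : M.X ⟶ N.X)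
    (hs : IsSemi f s) : Prop := IsIso (bcMap f s hs)

lemma isIso_hom {M N : Mod C A} (e : M ≅ N) : IsIso e.hom.hom :=
  inferInstanceAs (IsIso ((Mod.forget A).map e.hom))

lemma isIso_of_hom {M N : Mod C A} (f : M ⟶ N) [IsIso f.hom] : IsIso f :=
  ⟨mkHom (inv f.hom) (isSemi_inv (isSemi_hom f) (by simp) (by simp)), Mod.hom_ext _ _ (by simp),
    Mod.hom_ext _ _ (by simp)⟩

lemma regular_semi (f : A ⟶ B) [IsMonHom f] :
    IsSemi (M := reg A) (N := reg B) f f := by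
  change μ[A] ≫ f = A ◁ f ≫ f ▷ B ≫ μ[B]
  rw [IsMonHom.mul_hom, MonoidalCategory.tensorHom_def', Category.assoc]

lemma isBaseChange_regular (f : A ⟶ B) [IsMonHom f] :
    IsBaseChange (M := reg A) (N := reg B) f f (regular_semi f) := by
  have h : bcMap (M := reg A) (N := reg B) f f (regular_semi f) =
      (runitIso (res f (reg B))).hom.hom := by
    apply (cancel_epi (tq (res f (reg B)) (reg A))).1
    have hc : (β_ B B).hom ≫ μ[B] = μ[B] := IsCommMonObj.mul_comm B
    refine (tq_bcMap (M := reg A) (N := reg B) f f (regular_semi f)).trans ?_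
    refine Eq.trans ?_ (tqA'_runit (res f (reg B))).symm
    rw [ract_res]
    change B ◁ f ≫ μ[B] = B ◁ f ≫ (β_ B B).hom ≫ μ[B]
    rw [hc]
  rw [IsBaseChange, h]
  exact isIso_hom (runitIso (res f (reg B)))

section

variable (f : A ⟶ B) [IsMonHom f] {N : Mod C A} {N' : Mod C B} {t : N.X ⟶ N'.X}
  (ht : IsSemi f t) (M' : Mod C B)

/-- The morphism `M' ⊗ (B ⊗_A N) ⟶ M' ⊗_A N`, `m ⊗ (b ⊗ n) ↦ m b ⊗ n`. -/
noncomputable def bcAux (N : Mod C A) :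
    M'.X ⊗ (tMod (res f (reg B)) N).X ⟶ (tMod (res f M') N).X :=
  tDescL (M := res f (reg B)) (N := N) M'.X
    ((α_ M'.X B N.X).inv ≫ ract M' ▷ N.X ≫ tq (res f M') N) (by
    have hc : (β_ B B).hom ≫ μ[B] = μ[B] := IsCommMonObj.mul_comm B
    have h2 : ract (res f (reg B)) = B ◁ f ≫ μ[B] := by
      rw [ract_res]
      change B ◁ f ≫ (β_ B B).hom ≫ μ[B] = _
      rw [hc]
    have h3 : (M'.X ◁ f ≫ ract M') ▷ N.X ≫ tq (res f M') N =
        (α_ M'.X A N.X).hom ≫ M'.X ◁ act N ≫ tq (res f M') N := by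
      rw [← ract_res]; exact tq_bal (res f M') N
    rw [h2]
    change M'.X ◁ ((B ◁ f ≫ μ[B]) ▷ N.X) ≫ (α_ M'.X B N.X).inv ≫ ract M' ▷ N.X ≫
        tq (res f M') N = M'.X ◁ ((α_ B A N.X).hom ≫ B ◁ act N) ≫
          (α_ M'.X B N.X).inv ≫ ract M' ▷ N.X ≫ tq (res f M') N
    have e1 : M'.X ◁ ((B ◁ f ≫ μ[B]) ▷ N.X) ≫ (α_ M'.X B N.X).inv ≫ ract M' ▷ N.X =
        (α_ _ _ _).inv ≫ (M'.X ◁ (B ◁ f) ≫ M'.X ◁ μ[B] ≫ ract M') ▷ N.X := by monoidal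
    have e2 : M'.X ◁ ((α_ B A N.X).hom ≫ B ◁ act N) ≫ (α_ M'.X B N.X).inv ≫ ract M' ▷ N.X =
        M'.X ◁ (α_ B A N.X).hom ≫ (α_ M'.X B _).inv ≫ ract M' ▷ (A ⊗ N.X) ≫ M'.X ◁ act N := by
      rw [← whisker_exchange]; monoidal
    have e3 : M'.X ◁ (B ◁ f) ≫ (α_ M'.X B B).inv ≫ ract M' ▷ B =
        (α_ M'.X B A).inv ≫ ract M' ▷ A ≫ M'.X ◁ f := by
      rw [← whisker_exchange]; monoidal
    rw [reassoc_of% e1, reassoc_of% e2, ract_mul, reassoc_of% e3]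
    have e4 : ((α_ M'.X B A).inv ≫ ract M' ▷ A ≫ M'.X ◁ f ≫ ract M') ▷ N.X ≫ tq (res f M') N =
      ((α_ M'.X B A).inv ≫ ract M' ▷ A) ▷ N.X ≫ (M'.X ◁ f ≫ ract M') ▷ N.X ≫
        tq (res f M') N := by simp
    rw [e4, h3]
    monoidal)

lemma tq_bcAux (N : Mod C A) :
    M'.X ◁ (tq (res f (reg B)) N : B ⊗ N.X ⟶ _) ≫ bcAux f M' N =
      (α_ M'.X B N.X).inv ≫ ract M' ▷ N.X ≫ tq (res f M') N :=
  tπ_tDescL (M := res f (reg B)) (N := N) _ _ _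

lemma tMap_res_isIso (h : IsBaseChange f t ht) :
    IsIso (tMap (M := res f M') (M' := M') f (𝟙 M'.X) t (id_semi f M') ht) := by
  have : IsIso (bcMap f t ht) := h
  let q : B ⊗ N.X ⟶ (tMod (res f (reg B)) N).X := tq (res f (reg B)) N
  have hq : Epi q := inferInstanceAs (Epi (tq _ _))
  have hqb : q ≫ bcMap f t ht = B ◁ t ≫ act N' := tq_bcMap f t ht
  have hqa : M'.X ◁ q ≫ bcAux f M' N = (α_ M'.X B N.X).inv ≫ ract M' ▷ N.X ≫ tq (res f M') N :=
    tq_bcAux f M' N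
  have hl : B ◁ q ≫ B ◁ bcMap f t ht ≫ act N' ≫ inv (bcMap f t ht) =
      (α_ B B N.X).inv ≫ μ[B] ▷ N.X ≫ q := by
    have h1 : B ◁ act N' ≫ act N' = (α_ B B N'.X).inv ≫ μ[B] ▷ N'.X ≫ act N' := by
      rw [mul_act]; simp
    rw [← cancel_mono (bcMap f t ht)]
    simp only [Category.assoc, IsIso.inv_hom_id, Category.comp_id, hqb]
    rw [← whiskerLeft_comp_assoc, hqb, whiskerLeft_comp_assoc, h1, ← whisker_exchange_assoc]
    monoidal
  let ψ : M'.X ⊗ N'.X ⟶ (tMod (res f M') N).X := M'.X ◁ inv (bcMap f t ht) ≫ bcAux f M' N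
  have hψ : IsBal M' N' ψ := by
    rw [IsBal, ← cancel_epi ((M'.X ⊗ B) ◁ q ≫ (M'.X ⊗ B) ◁ bcMap f t ht)]
    have l1 : ((M'.X ⊗ B) ◁ q ≫ (M'.X ⊗ B) ◁ bcMap f t ht) ≫ ract M' ▷ N'.X ≫ ψ =
        ract M' ▷ _ ≫ M'.X ◁ q ≫ bcAux f M' N := by
      simp only [ψ, Category.assoc, whisker_exchange_assoc]
      rw [← whiskerLeft_comp_assoc M'.X (bcMap f t ht), IsIso.hom_inv_id]
      simp
    have l2 : ((M'.X ⊗ B) ◁ q ≫ (M'.X ⊗ B) ◁ bcMap f t ht) ≫ (α_ M'.X B N'.X).hom ≫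
        M'.X ◁ act N' ≫ ψ = (α_ _ _ _).hom ≫ M'.X ◁ (B ◁ q ≫ B ◁ bcMap f t ht ≫ act N' ≫
          inv (bcMap f t ht)) ≫ bcAux f M' N := by
      simp only [ψ]; monoidal
    have e : ract M' ▷ (B ⊗ N.X) ≫ (α_ M'.X B N.X).inv =
      (α_ (M'.X ⊗ B) B N.X).inv ≫ (ract M' ▷ B) ▷ N.X := by monoidal
    have e' : M'.X ◁ ((α_ B B N.X).inv ≫ μ[B] ▷ N.X ≫ q) =
      M'.X ◁ ((α_ B B N.X).inv ≫ μ[B] ▷ N.X) ≫ M'.X ◁ q := by simp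
    have e2 : M'.X ◁ ((α_ B B N.X).inv ≫ μ[B] ▷ N.X) ≫ (α_ M'.X B N.X).inv ≫ ract M' ▷ N.X =
      M'.X ◁ (α_ B B N.X).inv ≫ (α_ _ _ _).inv ≫ (M'.X ◁ μ[B] ≫ ract M') ▷ N.X := by monoidal
    rw [l1, l2, hl, e', Category.assoc, hqa, reassoc_of% e, reassoc_of% e2, ract_mul]
    monoidal
  refine ⟨tD ψ hψ, ?_, ?_⟩
  · rw [← cancel_epi (tq (res f M') N), reassoc_of% tq_tMap, tq_tD, Category.comp_id]
    have ht' : t = (λ_ _).inv ≫ η[B] ▷ N.X ≫ q ≫ bcMap f t ht := by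
      rw [hqb, ← whisker_exchange_assoc, one_act]
      simp
    have e0 : t ≫ inv (bcMap f t ht) = (λ_ _).inv ≫ η[B] ▷ N.X ≫ q := by
      rw [IsIso.comp_inv_eq]; simpa using ht'
    have e1 : ((𝟙 M'.X : (res f M').X ⟶ M'.X) ⊗ₘ t) ≫ ψ =
        M'.X ◁ (t ≫ inv (bcMap f t ht)) ≫ bcAux f M' N := by
      simp [ψ]
    have e2 : M'.X ◁ ((λ_ N.X).inv ≫ η[B] ▷ N.X ≫ q) =
        M'.X ◁ ((λ_ N.X).inv ≫ η[B] ▷ N.X) ≫ M'.X ◁ q := by simp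
    have e3 : M'.X ◁ ((λ_ N.X).inv ≫ η[B] ▷ N.X) ≫ (α_ M'.X B N.X).inv ≫ ract M' ▷ N.X =
      (ρ_ _).inv ▷ N.X ≫ (M'.X ◁ η[B] ≫ ract M') ▷ N.X := by monoidal
    rw [e1, e0, e2, Category.assoc, hqa, reassoc_of% e3, ract_one, ← comp_whiskerRight_assoc,
      Iso.inv_hom_id]
    change 𝟙 M'.X ▷ N.X ≫ tq (res f M') N = tq (res f M') N
    simp
  · rw [← cancel_epi (tq M' N'), reassoc_of% tq_tD, Category.comp_id,
      ← cancel_epi (M'.X ◁ q ≫ M'.X ◁ bcMap f t ht)]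
    have l1 : (M'.X ◁ q ≫ M'.X ◁ bcMap f t ht) ≫ ψ = M'.X ◁ q ≫ bcAux f M' N := by
      simp only [ψ, Category.assoc]
      rw [← whiskerLeft_comp_assoc M'.X (bcMap f t ht), IsIso.hom_inv_id]
      simp
    rw [← Category.assoc (M'.X ◁ q ≫ _) ψ, l1, Category.assoc, reassoc_of% hqa, tq_tMap, ← whiskerLeft_comp, hqb]
    change (α_ M'.X B N.X).inv ≫ ract M' ▷ N.X ≫ (𝟙 M'.X ⊗ₘ t) ≫ tq M' N' = _
    rw [id_tensorHom, ← whisker_exchange_assoc, tq_bal]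
    monoidal

end

lemma isBaseChange_tMap (f : A ⟶ B) [IsMonHom f] {M N : Mod C A} {M' N' : Mod C B}
    {s : M.X ⟶ M'.X} {t : N.X ⟶ N'.X} (hs : IsSemi f s) (ht : IsSemi f t)
    (bs : IsBaseChange f s hs) (bt : IsBaseChange f t ht) :
    IsBaseChange f (tMap f s t hs ht) (tMap_semi s t hs ht) := by
  have hsemi : IsSemi (M := tMod (res f (reg B)) M) (N := res f M') (𝟙 A)
      (bcMap f s hs) := by
    apply isSemi_of_tq (P := res f M')
    have hq : (tq (res f (reg B)) M : B ⊗ M.X ⟶ _) ≫ bcMap f s hs = B ◁ s ≫ act M' :=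
      tq_bcMap f s hs
    change (f ▷ B ≫ μ[B]) ▷ M.X ≫ (tq (res f (reg B)) M : B ⊗ M.X ⟶ _) ≫ bcMap f s hs =
      (α_ A B M.X).hom ≫ A ◁ ((tq (res f (reg B)) M : B ⊗ M.X ⟶ _) ≫ bcMap f s hs) ≫
        (𝟙 A) ▷ M'.X ≫ f ▷ M'.X ≫ act M'
    have e : A ◁ (B ◁ s ≫ act M') ≫ f ▷ M'.X = f ▷ (B ⊗ M.X) ≫ B ◁ (B ◁ s ≫ act M') :=
      whisker_exchange _ _
    rw [hq, comp_whiskerRight_assoc, ← whisker_exchange_assoc, mul_act, id_whiskerRight,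
      Category.id_comp, reassoc_of% e]
    monoidal
  have : IsIso (bcMap f s hs) := bs
  have := tMap_res_isIso f ht M' bt
  have hid : IsSemi (𝟙 A) (𝟙 N.X) := isSemi_hom (𝟙 N)
  let T := tMap (M' := res f M') (𝟙 A) (bcMap f s hs) (𝟙 N.X) hsemi hid
  have hT : IsIso T := by
    have : IsIso (mkHom (N := res f M') (bcMap f s hs) hsemi).hom := bs
    have : IsIso (mkHom (N := res f M') (bcMap f s hs) hsemi) := isIso_of_hom _
    exact inferInstanceAs (IsIso ((Mod.forget A).map
      (mkHom (N := res f M') (bcMap f s hs) hsemi ▷ N)))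
  let E := tMap (M := res f M') (M' := M') f (𝟙 M'.X) t (id_semi f M') ht
  have key : assocHom (res f (reg B)) M N ≫ bcMap f (tMap f s t hs ht) (tMap_semi s t hs ht) = T ≫ E := by
    apply t3_ext
    have h1 : (tq (res f (reg B)) (tMod M N) : B ⊗ _ ⟶ _) ≫
      bcMap f (tMap f s t hs ht) (tMap_semi s t hs ht) = B ◁ tMap f s t hs ht ≫ act (tMod M' N') :=
      tq_bcMap _ _ _
    have h2 : (tq (res f (reg B)) M : B ⊗ M.X ⟶ _) ≫ bcMap f s hs = B ◁ s ≫ act M' :=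
      tq_bcMap f s hs
    have h3 : tq (tMod (res f (reg B)) M) N ≫ T = bcMap f s hs ▷ N.X ≫ tq (res f M') N := by
      simp only [T, tq_tMap, tensorHom_id]
    have h4 : tq (res f M') N ≫ E = M'.X ◁ t ≫ tq M' N' := by
      simp only [E, tq_tMap]
      exact congrArg (· ≫ tq M' N') (id_tensorHom _ _)
    rw [reassoc_of% tq_assocHom, reassoc_of% h3, h4]
    change (α_ B M.X N.X).hom ≫ B ◁ tq M N ≫ (tq (res f (reg B)) (tMod M N) : B ⊗ _ ⟶ _) ≫ _ =
      (tq (res f (reg B)) M : B ⊗ M.X ⟶ _) ▷ N.X ≫ bcMap f s hs ▷ N.X ≫ M'.X ◁ t ≫ tq M' N'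
    rw [h1, ← whiskerLeft_comp_assoc, tq_tMap, ← comp_whiskerRight_assoc, h2, whiskerLeft_comp,
      Category.assoc, tq_act, MonoidalCategory.tensorHom_def, comp_whiskerRight, Category.assoc,
      ← whisker_exchange_assoc]
    monoidal
  have hA : IsIso (assocHom (res f (reg B)) M N) := isIso_hom (assocIso (res f (reg B)) M N)
  have hE : IsIso (T ≫ E) := inferInstance
  rw [← key] at hE
  exact IsIso.of_isIso_comp_left (assocHom (res f (reg B)) M N) _

end BaseChange
end
end Tensor
section Geometry

variable {C : Type u} [Category.{v} C] [MonoidalCategory C] [SymmetricCategory C]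
  [MonoidalClosed C] [HasCoequalizers C]

/-- The morphism of `C` underlying a morphism of commutative monoids. -/
def ringHom {A B : CommMon C} (f : A ⟶ B) : A.X ⟶ B.X := f.hom.hom

instance {A B : CommMon C} (f : A ⟶ B) : IsMonHom (ringHom f) :=
  inferInstanceAs (IsMonHom f.hom.hom)

lemma ringHom_id (A : CommMon C) : ringHom (𝟙 A) = 𝟙 A.X := rfl

lemma ringHom_comp {A B D : CommMon C} (f : A ⟶ B) (g : B ⟶ D) :
    ringHom (f ≫ g) = ringHom f ≫ ringHom g := rfl

/-- `B` as an `A`-module, for `f : A ⟶ B`. -/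
abbrev algMod {A B : CommMon C} (f : A ⟶ B) : Mod C A.X := res (ringHom f) (reg B.X)

/-- `Spec B ⟶ Spec A` is a Zariski open immersion of affines: `A ⟶ B` is a flat epimorphism of
finite presentation. -/
structure IsZariskiOpen {A B : CommMon C} (f : A ⟶ B) : Prop where
  flat : PreservesFiniteLimits (tensorLeft (algMod f))
  epi : Epi f
  finitePresentation : IsFinitelyPresentable.{v} (Under.mk f)

/-- The functors `B ⊗_A -`, for `A ⟶ B` in the given family, are jointly conservative. -/
def JointlyConservative {X : (CommMon C)ᵒᵖ} (s : Set (Over X)) : Prop :=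
  ∀ ⦃M N : Mod C X.unop.X⦄ (h : M ⟶ N),
    (∀ g ∈ s, IsIso (algMod g.hom.unop ◁ h)) → IsIso h

variable (C) in
/-- Zariski coverings of affine schemes: families of Zariski open immersions such that some finite
subfamily is jointly conservative on modules. -/
def zariskiPrecoverage : Precoverage (CommMon C)ᵒᵖ where
  coverings X := {R | (∀ ⦃Y : (CommMon C)ᵒᵖ⦄ (g : Y ⟶ X), R g → IsZariskiOpen g.unop) ∧
    ∃ s : Set (Over X), s.Finite ∧ (∀ g ∈ s, R g.hom) ∧ JointlyConservative s}

variable (C) in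
/-- The Zariski topology on the category of affine schemes. -/
def zariskiTopology : GrothendieckTopology (CommMon C)ᵒᵖ := (zariskiPrecoverage C).toGrothendieck

variable (C) in
/-- Presheaves on the category of affine schemes. -/
abbrev Psh := (CommMon C)ᵒᵖᵒᵖ ⥤ Type (max u v)

/-- The functor of points of an affine scheme. -/
abbrev Spec (A : CommMon C) : Psh C := uliftYoneda.{u}.obj (op A)

/-- The morphism `Spec B ⟶ Spec A` attached to `A ⟶ B`. -/
abbrev SpecMap {A B : CommMon C} (f : A ⟶ B) : Spec B ⟶ Spec A := uliftYoneda.{u}.map f.op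

/-- `φ : F ⟶ G` is an open immersion: it is a monomorphism and for every `Spec A ⟶ G` the subsheaf
`F ×_G Spec A` of `Spec A` is a Zariski open, i.e. the image of a family of Zariski open immersions
`Spec A_i ⟶ Spec A`.  A point `Spec B ⟶ Spec A` lies in the image sheaf if and only if it factors
through the family locally on `Spec B`. -/
structure IsOpenImmersion {F G : Psh C} (φ : F ⟶ G) : Prop where
  mono : Mono φ
  isOpen : ∀ ⦃A : CommMon C⦄ (y : Spec A ⟶ G), ∃ R : Presieve (op A),
    (∀ ⦃Y : (CommMon C)ᵒᵖ⦄ (g : Y ⟶ op A), R g → IsZariskiOpen g.unop) ∧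
    ∀ ⦃B : CommMon C⦄ (b : A ⟶ B), (∃ x : Spec B ⟶ F, x ≫ φ = SpecMap b ≫ y) ↔
      (Sieve.generate R).pullback b.op ∈ zariskiTopology C (op B)

/-- The affine opens of `X`. -/
structure ZarAff (X : Psh C) where
  /-- The monoid of functions `O(U)`. -/
  ring : CommMon C
  /-- The inclusion `U ⟶ X`. -/
  incl : Spec ring ⟶ X
  isOpen : IsOpenImmersion incl

/-- Morphisms `V ⟶ U` of affine opens over `X`, given by the restriction `O(U) ⟶ O(V)`. -/
structure Restr {X : Psh C} (U V : ZarAff X) where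
  /-- The restriction `O(U) ⟶ O(V)`. -/
  hom : U.ring ⟶ V.ring
  w : SpecMap hom ≫ U.incl = V.incl

/-- The identity restriction. -/
def Restr.id {X : Psh C} (U : ZarAff X) : Restr U U := ⟨𝟙 _, by simp [SpecMap]⟩

/-- Composition of restrictions. -/
def Restr.comp {X : Psh C} {U V W : ZarAff X} (φ : Restr U V) (ψ : Restr V W) : Restr U W :=
  ⟨φ.hom ≫ ψ.hom, by
    rw [← ψ.w, ← φ.w]; simp [SpecMap]⟩

/-- A set of affine opens covers `X` if it is jointly epimorphic in the category of sheaves. -/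
def IsCover {X : Psh C} (S : Set (ZarAff X)) : Prop :=
  ∀ ⦃Z : Psh C⦄, Presheaf.IsSheaf (zariskiTopology C) Z → ∀ g h : X ⟶ Z,
    (∀ U ∈ S, U.incl ≫ g = U.incl ≫ h) → g = h

variable (C) in
/-- Schemes over `C`: Zariski sheaves which have a cover by affine opens. -/
structure Scheme where
  /-- The functor of points. -/
  presheaf : Psh C
  isSheaf : Presheaf.IsSheaf (zariskiTopology C) presheaf
  exists_cover : ∃ S : Set (ZarAff presheaf), IsCover S

/-- Every cover by affine opens has a finite subcover. -/
def Scheme.IsQuasiCompact (X : Scheme C) : Prop :=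
  ∀ S : Set (ZarAff X.presheaf), IsCover S → ∃ T ⊆ S, T.Finite ∧ IsCover T

/-- `U ×_X V` is an affine open of `X` for all affine opens `U` and `V`. -/
def Scheme.IsSemiSeparated (X : Scheme C) : Prop :=
  ∀ U V : ZarAff X.presheaf, ∃ (P : ZarAff X.presheaf) (p : Restr U P) (q : Restr V P),
    IsPullback (SpecMap p.hom) (SpecMap q.hom) U.incl V.incl

lemma isZariskiOpen_id (A : CommMon C) : IsZariskiOpen (𝟙 A) where
  flat := by
    have h1 : (algMod (𝟙 A)) ≅ 𝟙_ (Mod C A.X) :=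
      mkIso (M := algMod (𝟙 A)) (N := reg A.X) (𝟙 A.X) (𝟙 A.X)
        (by
          change ((𝟙 A.X) ▷ A.X ≫ μ[A.X]) ≫ 𝟙 A.X = A.X ◁ 𝟙 A.X ≫ 𝟙 A.X ▷ A.X ≫ μ[A.X]
          simp)
        (Category.comp_id _) (Category.comp_id _)
    have e : 𝟭 (Mod C A.X) ≅ tensorLeft (algMod (𝟙 A)) :=
      (leftUnitorNatIso _).symm ≪≫ (curriedTensor _).mapIso h1.symm
    exact preservesFiniteLimits_of_natIso e
  epi := inferInstance
  finitePresentation := by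
    have := Cardinal.fact_isRegular_aleph0.{v}
    have hK : HasCardinalLT (Arrow (Discrete PEmpty.{1})) Cardinal.aleph0.{v} := by
      rw [hasCardinalLT_aleph0_iff]
      have : IsEmpty (Arrow (Discrete PEmpty.{1})) := ⟨fun f => f.left.as.elim⟩
      infer_instance
    have (k : Discrete PEmpty.{1}) :
        IsCardinalPresentable ((Functor.empty (Under A)).obj k) Cardinal.aleph0.{v} := k.as.elim
    exact isCardinalPresentable_of_isColimit' (asEmptyCocone (Under.mk (𝟙 A)))
      Under.mkIdInitial _ hK

lemma isOpenImmersion_id (F : Psh C) : IsOpenImmersion (𝟙 F) where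
  mono := inferInstance
  isOpen A y := by
    refine ⟨Presieve.singleton (𝟙 (op A)), ?_, fun B b => ?_⟩
    · rintro _ _ ⟨⟩
      exact isZariskiOpen_id A
    · have h : (Sieve.generate (Presieve.singleton (𝟙 (op A)))).pullback b.op = ⊤ := by
        rw [← Sieve.id_mem_iff_eq_top]
        exact ⟨_, b.op, 𝟙 _, ⟨⟩, by simp⟩
      rw [h]
      exact ⟨fun _ => (zariskiTopology C).top_mem _, fun _ => ⟨SpecMap b ≫ y, by simp⟩⟩

/-- An affine scheme as an affine open of itself. -/
def ZarAff.self (A : CommMon C) : ZarAff (Spec A) := ⟨A, 𝟙 _, isOpenImmersion_id _⟩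

end Geometry
section QuasiCoherent

variable {C : Type u} [Category.{v} C] [MonoidalCategory C] [SymmetricCategory C]
  [MonoidalClosed C] [HasCoequalizers C]

/-- Quasi-coherent modules on `X`: modules `M(U)` over `O(U)` for the affine opens `U` of `X`, with
functorial semilinear restrictions inducing isomorphisms `O(V) ⊗_{O(U)} M(U) ⟶ M(V)`. -/
structure QCoh (X : Psh C) where
  /-- The module of sections over an affine open. -/
  obj : ∀ U : ZarAff X, Mod C U.ring.X
  /-- The restriction morphisms. -/
  map : ∀ {U V : ZarAff X} (_ : Restr U V), (obj U).X ⟶ (obj V).X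
  semi : ∀ {U V : ZarAff X} (φ : Restr U V), IsSemi (ringHom φ.hom) (map φ)
  map_id : ∀ U : ZarAff X, map (Restr.id U) = 𝟙 _
  map_comp : ∀ {U V W : ZarAff X} (φ : Restr U V) (ψ : Restr V W),
    map (φ.comp ψ) = map φ ≫ map ψ
  isBaseChange : ∀ {U V : ZarAff X} (φ : Restr U V),
    IsBaseChange (ringHom φ.hom) (map φ) (semi φ)

namespace QCoh

variable {X : Psh C}

/-- Morphisms of quasi-coherent modules: linear morphisms commuting with restrictions. -/
@[ext]
structure Hom (M N : QCoh X) where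
  /-- The linear morphism over an affine open. -/
  app : ∀ U : ZarAff X, M.obj U ⟶ N.obj U
  naturality : ∀ {U V : ZarAff X} (φ : Restr U V),
    M.map φ ≫ (app V).hom = (app U).hom ≫ N.map φ

instance : Category (QCoh X) where
  Hom := Hom
  id M := ⟨fun U => 𝟙 _, fun φ => by simp⟩
  comp f g := ⟨fun U => f.app U ≫ g.app U, fun φ => by
    simp only [Mod.comp_hom', Category.assoc]
    rw [reassoc_of% f.naturality φ, g.naturality φ]⟩

@[ext]
lemma hom_ext {M N : QCoh X} (f g : M ⟶ N) (h : ∀ U, f.app U = g.app U) : f = g :=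
  Hom.ext (funext h)

@[simp] lemma id_app (M : QCoh X) (U : ZarAff X) : Hom.app (𝟙 M) U = 𝟙 (M.obj U) := rfl

@[simp] lemma comp_app {M N P : QCoh X} (f : M ⟶ N) (g : N ⟶ P) (U : ZarAff X) :
    (f ≫ g).app U = f.app U ≫ g.app U := rfl

/-- Sections over an affine open `U`.  As `QCoh(U)` is the category of `O(U)`-modules, this is
the pullback functor along the inclusion of `U`. -/
def eval (U : ZarAff X) : QCoh X ⥤ Mod C U.ring.X where
  obj M := M.obj U
  map f := f.app U

/-- Isomorphisms of quasi-coherent modules, from isomorphisms over all affine opens. -/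
def isoMk {M N : QCoh X} (e : ∀ U, M.obj U ≅ N.obj U)
    (h : ∀ {U V : ZarAff X} (φ : Restr U V),
      M.map φ ≫ (e V).hom.hom = (e U).hom.hom ≫ N.map φ) : M ≅ N where
  hom := ⟨fun U => (e U).hom, h⟩
  inv := ⟨fun U => (e U).inv, fun {U V} φ => by
    have h1 : (e U).inv.hom ≫ (e U).hom.hom = 𝟙 _ := by rw [← Mod.comp_hom']; simp
    have h2 : (e V).hom.hom ≫ (e V).inv.hom = 𝟙 _ := by rw [← Mod.comp_hom']; simp
    calc N.map φ ≫ (e V).inv.hom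
        = (e U).inv.hom ≫ ((e U).hom.hom ≫ N.map φ) ≫ (e V).inv.hom := by
          rw [Category.assoc, reassoc_of% h1]
      _ = _ := by rw [← h φ, Category.assoc, h2, Category.comp_id]⟩
  hom_inv_id := by ext U; simp
  inv_hom_id := by ext U; simp

lemma tMap_congr {A B : C} [MonObj A] [MonObj B] [IsCommMonObj A] [IsCommMonObj B] {f : A ⟶ B}
    {M N : Mod C A} {M' N' : Mod C B} {s s' : M.X ⟶ M'.X} {t t' : N.X ⟶ N'.X} {hs ht hs' ht'}
    (h1 : s = s') (h2 : t = t') : tMap f s t hs ht = tMap f s' t' hs' ht' := by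
  subst h1 h2; rfl

/-- The tensor product of quasi-coherent modules, `(M ⊗ N)(U) = M(U) ⊗_{O(U)} N(U)`. -/
noncomputable def tensor (M N : QCoh X) : QCoh X where
  obj U := tMod (M.obj U) (N.obj U)
  map φ := tMap (ringHom φ.hom) (M.map φ) (N.map φ) (M.semi φ) (N.semi φ)
  semi φ := tMap_semi _ _ _ _
  map_id U := (tMap_congr (M.map_id U) (N.map_id U)).trans
    (tMap_id_id (M.obj U) (N.obj U) (isSemi_hom (𝟙 _)) (isSemi_hom (𝟙 _)))
  map_comp {U V W} φ ψ := by
    have h1 := (M.semi (φ.comp ψ))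
    have h2 := (N.semi (φ.comp ψ))
    refine Eq.trans ?_ (tMap_comp (M.semi φ) (N.semi φ) (M.semi ψ) (N.semi ψ)
      (by rw [← M.map_comp]; exact h1) (by rw [← N.map_comp]; exact h2)).symm
    exact tMap_congr (M.map_comp φ ψ) (N.map_comp φ ψ)
  isBaseChange φ := isBaseChange_tMap _ _ _ (M.isBaseChange φ) (N.isBaseChange φ)

variable (X) in
/-- The structure sheaf as a quasi-coherent module. -/
def unit : QCoh X where
  obj U := reg U.ring.X
  map φ := ringHom φ.hom
  semi φ := regular_semi _
  map_id U := rfl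
  map_comp φ ψ := rfl
  isBaseChange φ := isBaseChange_regular _

/-- The tensor product of morphisms. -/
noncomputable def tensorMap {M M' N N' : QCoh X} (f : M ⟶ M') (g : N ⟶ N') :
    tensor M N ⟶ tensor M' N' :=
  ⟨fun U => tHom (f.app U) (g.app U), fun {U V} φ => by
    apply (cancel_epi (tq (M.obj U) (N.obj U))).1
    change tq _ _ ≫ tMap (ringHom φ.hom) (M.map φ) (N.map φ) (M.semi φ) (N.semi φ) ≫
      (tHom (f.app V) (g.app V)).hom = tq _ _ ≫ (tHom (f.app U) (g.app U)).hom ≫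
        tMap (ringHom φ.hom) (M'.map φ) (N'.map φ) (M'.semi φ) (N'.semi φ)
    rw [reassoc_of% tq_tMap, tq_tHom, reassoc_of% tq_tHom, tq_tMap,
      tensorHom_comp_tensorHom_assoc, tensorHom_comp_tensorHom_assoc, f.naturality φ,
      g.naturality φ]⟩

/-- The tensor product of quasi-coherent modules, with unit the structure sheaf. -/
noncomputable instance : MonoidalCategoryStruct (QCoh X) where
  tensorObj := tensor
  tensorUnit := unit X
  tensorHom := tensorMap
  whiskerLeft M _ _ g := tensorMap (𝟙 M) g
  whiskerRight f N := tensorMap f (𝟙 N)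
  associator M N P := isoMk (fun U => assocIso (M.obj U) (N.obj U) (P.obj U))
    (fun φ => tMap_assoc (M.semi φ) (N.semi φ) (P.semi φ))
  leftUnitor M := isoMk (fun U => lunitIso (M.obj U))
    (fun φ => tMap_lunit (regular_semi _) (M.semi φ))
  rightUnitor M := isoMk (fun U => runitIso (M.obj U))
    (fun {U V} φ => by
      change tMap (N := reg U.ring.X) (N' := reg V.ring.X) (ringHom φ.hom) (M.map φ)
        (ringHom φ.hom) (M.semi φ) (regular_semi _) ≫ tBraid _ _ ≫ lunit _ = (tBraid _ _ ≫ lunit _) ≫ M.map φ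
      have h1 := tMap_tBraid (M.semi φ) (regular_semi (ringHom φ.hom))
      have h2 := tMap_lunit (regular_semi (ringHom φ.hom)) (M.semi φ)
      rw [Category.assoc, ← h2, ← Category.assoc, ← Category.assoc]
      exact congrArg (· ≫ lunit (M.obj V)) h1)

noncomputable instance : MonoidalCategory (QCoh X) := MonoidalCategory.ofTensorHom
  (id_tensorHom_id := fun M N => hom_ext _ _ fun U => id_tensorHom_id (M.obj U) (N.obj U))
  (id_tensorHom := fun _ _ _ _ => rfl)
  (tensorHom_id := fun _ _ => rfl)
  (tensorHom_comp_tensorHom := fun f₁ f₂ g₁ g₂ => hom_ext _ _ fun U =>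
    tensorHom_comp_tensorHom (f₁.app U) (f₂.app U) (g₁.app U) (g₂.app U))
  (associator_naturality := fun f₁ f₂ f₃ => hom_ext _ _ fun U =>
    associator_naturality (f₁.app U) (f₂.app U) (f₃.app U))
  (leftUnitor_naturality := fun f => hom_ext _ _ fun U => leftUnitor_naturality (f.app U))
  (rightUnitor_naturality := fun f => hom_ext _ _ fun U => rightUnitor_naturality (f.app U))
  (pentagon := fun M N P Q => hom_ext _ _ fun U =>
    MonoidalCategory.pentagon (M.obj U) (N.obj U) (P.obj U) (Q.obj U))
  (triangle := fun M N => hom_ext _ _ fun U =>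
    MonoidalCategory.triangle (M.obj U) (N.obj U))

/-- The symmetry of the tensor product of quasi-coherent modules. -/
noncomputable def braid (M N : QCoh X) : M ⊗ N ≅ N ⊗ M :=
  isoMk (fun U => braidIso (M.obj U) (N.obj U)) (fun φ => tMap_tBraid (M.semi φ) (N.semi φ))

noncomputable instance : BraidedCategory (QCoh X) where
  braiding M N := braid M N
  braiding_naturality_right := fun M _ _ f => hom_ext _ _ fun U =>
    BraidedCategory.braiding_naturality_right (M.obj U) (f.app U)
  braiding_naturality_left := fun f N => hom_ext _ _ fun U =>
    BraidedCategory.braiding_naturality_left (f.app U) (N.obj U)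
  hexagon_forward := fun M N P => hom_ext _ _ fun U =>
    BraidedCategory.hexagon_forward (M.obj U) (N.obj U) (P.obj U)
  hexagon_reverse := fun M N P => hom_ext _ _ fun U =>
    BraidedCategory.hexagon_reverse (M.obj U) (N.obj U) (P.obj U)

noncomputable instance : SymmetricCategory (QCoh X) where
  symmetry := fun M N => (braid M N).hom_inv_id

end QCoh

end QuasiCoherent

section Additive

variable {C : Type u} [Category.{v} C] [MonoidalCategory C] [SymmetricCategory C]
  [MonoidalClosed C] [Preadditive C] [HasFiniteCoproducts C]

lemma whiskerLeft_add (Z : C) {M N : C} (f g : M ⟶ N) : Z ◁ (f + g) = Z ◁ f + Z ◁ g := by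
  have : HasFiniteBiproducts C := HasFiniteBiproducts.of_hasFiniteCoproducts
  have : HasBinaryBiproducts C := hasBinaryBiproducts_of_finite_biproducts C
  have : PreservesBinaryBiproducts (tensorLeft Z) :=
    preservesBinaryBiproducts_of_preservesBinaryCoproducts _
  have : (tensorLeft Z).Additive := Functor.additive_of_preservesBinaryBiproducts _
  exact (tensorLeft Z).map_add

/-- The subgroup of linear morphisms. -/
def linHom {A : C} [MonObj A] (M N : Mod C A) : AddSubgroup (M.X ⟶ N.X) where
  carrier := {f | IsSemi (𝟙 A) f}
  zero_mem' := by
    have h : A ◁ (0 : M.X ⟶ N.X) = 0 := by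
      have := whiskerLeft_add A (0 : M.X ⟶ N.X) 0
      simpa using this
    simp [IsSemi, h]
  add_mem' {f g} hf hg := by
    simp only [Set.mem_ofPred_eq, IsSemi] at hf hg ⊢
    simp only [whiskerLeft_add, Preadditive.comp_add, Preadditive.add_comp, hf, hg]
  neg_mem' {f} hf := by
    have h : A ◁ (-f) = - (A ◁ f) := by
      have h0 : A ◁ (0 : M.X ⟶ N.X) = 0 := by
        have := whiskerLeft_add A (0 : M.X ⟶ N.X) 0
        simpa using this
      have := whiskerLeft_add A (-f) f
      rw [neg_add_cancel, h0] at this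
      exact eq_neg_of_add_eq_zero_left this.symm
    simp only [Set.mem_ofPred_eq, IsSemi] at hf ⊢
    simp [h, hf]

/-- Morphisms of modules as a subgroup of the morphisms of `C`. -/
def linHomEquiv {A : C} [MonObj A] (M N : Mod C A) : (M ⟶ N) ≃ linHom M N where
  toFun f := ⟨f.hom, isSemi_hom f⟩
  invFun f := mkHom f.1 f.2
  left_inv _ := rfl
  right_inv _ := rfl

instance modPreadditive {A : C} [MonObj A] : Preadditive (Mod C A) where
  homGroup M N := (linHomEquiv M N).addCommGroup
  add_comp _ _ _ f g h := Mod.hom_ext _ _ (Preadditive.add_comp _ _ _ f.hom g.hom h.hom)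
  comp_add _ _ _ f g h := Mod.hom_ext _ _ (Preadditive.comp_add _ _ _ f.hom g.hom h.hom)

lemma add_hom {A : C} [MonObj A] {M N : Mod C A} (f g : M ⟶ N) :
    (f + g).hom = f.hom + g.hom := rfl

variable [HasCoequalizers C]

namespace QCoh

variable {X : Psh C}

/-- The subgroup of families of linear morphisms commuting with restrictions. -/
def natHom (M N : QCoh X) : AddSubgroup (∀ U, M.obj U ⟶ N.obj U) where
  carrier := {f | ∀ {U V : ZarAff X} (φ : Restr U V), M.map φ ≫ (f V).hom = (f U).hom ≫ N.map φ}
  zero_mem' {U V} φ := by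
    change M.map φ ≫ 0 = 0 ≫ N.map φ
    simp
  add_mem' {f g} hf hg {U V} φ := by
    change M.map φ ≫ ((f V).hom + (g V).hom) = ((f U).hom + (g U).hom) ≫ N.map φ
    rw [Preadditive.comp_add, Preadditive.add_comp, hf, hg]
  neg_mem' {f} hf {U V} φ := by
    change M.map φ ≫ (-(f V).hom) = (-(f U).hom) ≫ N.map φ
    rw [Preadditive.comp_neg, Preadditive.neg_comp, hf]

/-- Morphisms of quasi-coherent modules as a subgroup of families of linear morphisms. -/
def natHomEquiv (M N : QCoh X) : (M ⟶ N) ≃ natHom M N where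
  toFun f := ⟨f.app, f.naturality⟩
  invFun f := ⟨f.1, f.2⟩
  left_inv _ := rfl
  right_inv _ := rfl

instance preadditive : Preadditive (QCoh X) where
  homGroup M N := (natHomEquiv M N).addCommGroup
  add_comp _ _ _ f g h := hom_ext _ _ fun U =>
    Preadditive.add_comp _ _ _ (f.app U) (g.app U) (h.app U)
  comp_add _ _ _ f g h := hom_ext _ _ fun U =>
    Preadditive.comp_add _ _ _ (f.app U) (g.app U) (h.app U)

end QCoh

end Additive
section Normal

variable {C : Type u} [Category.{v} C] [MonoidalCategory C] [MonoidalClosed C] [HasEqualizers C]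

variable {A : C} [MonObj A]

/-- The internal hom `Hom_A(M, N)` of modules, as an object of `C`: the equalizer of the two
morphisms `[M, N] ⇉ [A ⊗ M, N]` given by the actions on `M` and on `N`. -/
noncomputable def IHom (M N : Mod C A) : C :=
  equalizer ((MonoidalClosed.pre (act M)).app N.X)
    (MonoidalClosed.curry ((α_ A M.X ((ihom M.X).obj N.X)).hom ≫
      A ◁ (ihom.ev M.X).app N.X ≫ act N))

/-- The inclusion of `Hom_A(M, N)` in the internal hom `[M, N]` of `C`. -/
noncomputable def iIncl (M N : Mod C A) : IHom M N ⟶ (ihom M.X).obj N.X := equalizer.ι _ _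

/-- The evaluation `M ⊗ Hom_A(M, N) ⟶ N`. -/
noncomputable def iEv (M N : Mod C A) : M.X ⊗ IHom M N ⟶ N.X :=
  M.X ◁ iIncl M N ≫ (ihom.ev M.X).app N.X

lemma iEv_linear (M N : Mod C A) :
    act M ▷ IHom M N ≫ iEv M N = (α_ _ _ _).hom ≫ A ◁ iEv M N ≫ act N := by
  have h : iIncl M N ≫ _ = iIncl M N ≫ _ := equalizer.condition ((MonoidalClosed.pre (act M)).app N.X)
    (MonoidalClosed.curry ((α_ A M.X ((ihom M.X).obj N.X)).hom ≫
      A ◁ (ihom.ev M.X).app N.X ≫ act N))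
  have h' := congrArg MonoidalClosed.uncurry h
  rw [MonoidalClosed.uncurry_natural_left, MonoidalClosed.uncurry_natural_left,
    MonoidalClosed.uncurry_curry, MonoidalClosed.uncurry_pre, whisker_exchange_assoc] at h'
  rw [iEv]
  refine h'.trans ?_
  monoidal

/-- The morphism `T ⟶ Hom_A(M, N)` attached to an `A`-linear morphism `M ⊗ T ⟶ N`. -/
noncomputable def iLift {M N : Mod C A} {T : C} (h : M.X ⊗ T ⟶ N.X)
    (hh : act M ▷ T ≫ h = (α_ A M.X T).hom ≫ A ◁ h ≫ act N) : T ⟶ IHom M N :=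
  equalizer.lift (MonoidalClosed.curry h) (by
    apply MonoidalClosed.uncurry_injective
    rw [MonoidalClosed.uncurry_natural_left, MonoidalClosed.uncurry_natural_left,
      MonoidalClosed.uncurry_curry, MonoidalClosed.uncurry_pre, whisker_exchange_assoc]
    have e : M.X ◁ MonoidalClosed.curry h ≫ (ihom.ev M.X).app N.X = h := by
      rw [← MonoidalClosed.uncurry_eq, MonoidalClosed.uncurry_curry]
    rw [e, hh]
    conv_lhs => rw [← e]
    monoidal)

lemma iLift_iIncl {M N : Mod C A} {T : C} (h : M.X ⊗ T ⟶ N.X) (hh) :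
    iLift h hh ≫ iIncl M N = MonoidalClosed.curry h := equalizer.lift_ι _ _

lemma iLift_iEv {M N : Mod C A} {T : C} (h : M.X ⊗ T ⟶ N.X) (hh) :
    M.X ◁ iLift h hh ≫ iEv M N = h := by
  rw [iEv, ← whiskerLeft_comp_assoc, iLift_iIncl, ← MonoidalClosed.uncurry_eq,
    MonoidalClosed.uncurry_curry]

/-- Internal composition `Hom_A(M, N) ⊗ Hom_A(N, P) ⟶ Hom_A(M, P)`. -/
noncomputable def iComp (M N P : Mod C A) : IHom M N ⊗ IHom N P ⟶ IHom M P :=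
  iLift ((α_ M.X (IHom M N) (IHom N P)).inv ≫ iEv M N ▷ IHom N P ≫ iEv N P) (by
    have e1 : act M ▷ (IHom M N ⊗ IHom N P) ≫ (α_ M.X (IHom M N) (IHom N P)).inv ≫
        iEv M N ▷ IHom N P = (α_ _ _ _).inv ≫ (act M ▷ IHom M N ≫ iEv M N) ▷ IHom N P := by
      monoidal
    have e2 : (A ◁ iEv M N ≫ act N) ▷ IHom N P ≫ iEv N P = (A ◁ iEv M N) ▷ IHom N P ≫
        (α_ _ _ _).hom ≫ A ◁ iEv N P ≫ act P := by
      rw [comp_whiskerRight_assoc, iEv_linear]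
    rw [reassoc_of% e1, iEv_linear, comp_whiskerRight_assoc, e2]
    monoidal)

/-- The morphism `1 ⟶ Hom_A(M, N)` attached to a morphism `M ⟶ N`. -/
noncomputable def iOf {M N : Mod C A} (f : M ⟶ N) : 𝟙_ C ⟶ IHom M N :=
  iLift ((ρ_ M.X).hom ≫ f.hom) (by
    rw [rightUnitor_naturality_assoc, act_hom]; monoidal)

/-- Functoriality of `Hom_A(M, N)` in `M`. -/
noncomputable def iPre {M' M : Mod C A} (f : M' ⟶ M) (N : Mod C A) : IHom M N ⟶ IHom M' N :=
  iLift (f.hom ▷ IHom M N ≫ iEv M N) (by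
    rw [← comp_whiskerRight_assoc, act_hom, comp_whiskerRight_assoc, iEv_linear]
    monoidal)

/-- Functoriality of `Hom_A(M, N)` in `N`. -/
noncomputable def iPost (M : Mod C A) {N N' : Mod C A} (g : N ⟶ N') : IHom M N ⟶ IHom M N' :=
  iLift (iEv M N ≫ g.hom) (by
    have h := iEv_linear M N
    rw [reassoc_of% h, act_hom]; monoidal)

/-- A normal structure on a functor `G` between categories of modules: morphisms
`τ : Hom_A(M, N) ⟶ Hom_B(G M, G N)` in `C`, natural in `M` and `N` and compatible with internal
composition, with identities and with the elements attached to morphisms of modules. -/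
structure NormalStructure {B : C} [MonObj B] (G : Mod C A ⥤ Mod C B) where
  /-- The action of `G` on internal homs. -/
  τ : ∀ M N : Mod C A, IHom M N ⟶ IHom (G.obj M) (G.obj N)
  naturality_left : ∀ {M' M : Mod C A} (f : M' ⟶ M) (N : Mod C A),
    iPre f N ≫ τ M' N = τ M N ≫ iPre (G.map f) (G.obj N)
  naturality_right : ∀ (M : Mod C A) {N N' : Mod C A} (g : N ⟶ N'),
    iPost M g ≫ τ M N' = τ M N ≫ iPost (G.obj M) (G.map g)
  comp : ∀ M N P : Mod C A, iComp M N P ≫ τ M P =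
    (τ M N ⊗ₘ τ N P) ≫ iComp (G.obj M) (G.obj N) (G.obj P)
  id : ∀ M : Mod C A, iOf (𝟙 M) ≫ τ M M = iOf (𝟙 (G.obj M))
  ofHom : ∀ {M N : Mod C A} (f : M ⟶ N), iOf f ≫ τ M N = iOf (G.map f)

end Normal

section NormalQCoh

variable {C : Type u} [Category.{v} C] [MonoidalCategory C] [SymmetricCategory C]
  [MonoidalClosed C] [HasCoequalizers C]

/-- `F` is local with respect to the affine open `i : U ⟶ X`: for the right adjoint `i_*` of
`i^*`, the morphism `F ⟶ F i_* i^*` induced by the unit is an isomorphism. -/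
def IsLocal {X : Psh C} {D : Type*} [Category* D] (U : ZarAff X) (F : QCoh X ⥤ D) : Prop :=
  ∃ (R : Mod C U.ring.X ⥤ QCoh X) (adj : QCoh.eval U ⊣ R), ∀ M, IsIso (F.map (adj.unit.app M))

/-- `F : QCoh(X) ⥤ A-Mod` is normal: for every affine open `i : U ⟶ X` such that `F` is local with
respect to `U`, there is a normal functor `G : O(U)-Mod ⥤ A-Mod` with `F ≅ G ∘ i^*`. -/
def IsNormal [HasEqualizers C] {X : Psh C} {A : C} [MonObj A] (F : QCoh X ⥤ Mod C A) : Prop :=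
  ∀ U : ZarAff X, IsLocal U F → ∃ G : Mod C U.ring.X ⥤ Mod C A,
    Nonempty (NormalStructure G) ∧ Nonempty (F ≅ QCoh.eval U ⋙ G)

/-- Global sections on an affine scheme: the equivalence of `QCoh(Spec A)` and `A-Mod`. -/
abbrev globalSections (A : CommMon C) : QCoh (Spec A) ⥤ Mod C A.X := QCoh.eval (ZarAff.self A)

/-- A functor `F : QCoh(X) ⥤ QCoh(Y)` is a pullback functor along `f : Y ⟶ X`: there are semilinear
morphisms `M(W) ⟶ (F M)(T)`, one for every morphism `T ⟶ W` over `f` between affine opens of `Y` and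
`X`, which are natural in `M`, compatible with restrictions and which exhibit `(F M)(T)` as the base
change `O(T) ⊗_{O(W)} M(W)`. -/
structure PullbackData {X Y : Psh C} (f : Y ⟶ X) (F : QCoh X ⥤ QCoh Y) where
  /-- Pullback of sections. -/
  σ : ∀ (M : QCoh X) {W : ZarAff X} {T : ZarAff Y} (g : W.ring ⟶ T.ring)
    (_ : SpecMap g ≫ W.incl = T.incl ≫ f), (M.obj W).X ⟶ ((F.obj M).obj T).X
  semi : ∀ (M : QCoh X) {W : ZarAff X} {T : ZarAff Y} (g : W.ring ⟶ T.ring)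
    (h : SpecMap g ≫ W.incl = T.incl ≫ f), IsSemi (ringHom g) (σ M g h)
  isBaseChange : ∀ (M : QCoh X) {W : ZarAff X} {T : ZarAff Y} (g : W.ring ⟶ T.ring)
    (h : SpecMap g ≫ W.incl = T.incl ≫ f), IsBaseChange (ringHom g) (σ M g h) (semi M g h)
  naturality : ∀ {M N : QCoh X} (k : M ⟶ N) {W : ZarAff X} {T : ZarAff Y} (g : W.ring ⟶ T.ring)
    (h : SpecMap g ≫ W.incl = T.incl ≫ f),
    σ M g h ≫ ((F.map k).app T).hom = (k.app W).hom ≫ σ N g h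
  comp_map : ∀ (M : QCoh X) {W : ZarAff X} {T T' : ZarAff Y} (g : W.ring ⟶ T.ring)
    (h : SpecMap g ≫ W.incl = T.incl ≫ f) (t : Restr T T'),
    σ M g h ≫ (F.obj M).map t = σ M (g ≫ t.hom) (by rw [← t.w, Category.assoc, ← h]; simp [SpecMap])
  map_comp : ∀ (M : QCoh X) {W W' : ZarAff X} {T : ZarAff Y} (w : Restr W W')
    (g : W'.ring ⟶ T.ring) (h : SpecMap g ≫ W'.incl = T.incl ≫ f),
    M.map w ≫ σ M g h = σ M (w.hom ≫ g) (by rw [← h, ← w.w]; simp [SpecMap])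

/-- A monoidal structure on the pullback functor to an affine scheme is the canonical one if
its structure morphisms are compatible with the pullback of sections: `σ(m) ⊗ σ(n)` corresponds
to `σ(m ⊗ n)`, and the unit section to the unit. -/
structure PullbackData.IsCanonical {X : Psh C} {A : CommMon C} {f : Spec A ⟶ X}
    {F : QCoh X ⥤ QCoh (Spec A)} (d : PullbackData f F)
    (m : (F ⋙ globalSections A).Monoidal) : Prop where
  tensor : ∀ (M N : QCoh X) {W : ZarAff X} (g : W.ring ⟶ (ZarAff.self A).ring)
    (h : SpecMap g ≫ W.incl = (ZarAff.self A).incl ≫ f),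
    tMap (ringHom g) (d.σ M g h) (d.σ N g h) (d.semi M g h) (d.semi N g h) ≫
      (Functor.LaxMonoidal.μ (F ⋙ globalSections A) M N).hom = d.σ (M ⊗ N) g h
  unit : ∀ {W : ZarAff X} (g : W.ring ⟶ (ZarAff.self A).ring)
    (h : SpecMap g ≫ W.incl = (ZarAff.self A).incl ≫ f),
    ringHom g ≫ (Functor.LaxMonoidal.ε (F ⋙ globalSections A)).hom = d.σ (𝟙_ (QCoh X)) g h

end NormalQCoh

section Finiteness

/-- `M` is finitely generated: `Hom(M, -)` commutes with colimits of filtered systems of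
monomorphisms. -/
def IsFG {D : Type u} [Category.{v} D] (M : D) : Prop :=
  ∀ (J : Type v) [SmallCategory J] [IsFiltered J] (F : J ⥤ D),
    (∀ {i j : J} (a : i ⟶ j), Mono (F.map a)) → PreservesColimit F (coyoneda.obj (op M))

/-- Every object is a filtered colimit of finitely generated subobjects. -/
def HasFGSubobjects (D : Type u) [Category.{v} D] : Prop :=
  ∀ M : D, ∃ (J : Type v) (_ : SmallCategory J) (_ : IsFiltered J) (F : J ⥤ D)
    (c : F ⟶ (Functor.const J).obj M),
    Nonempty (IsColimit (Cocone.mk M c)) ∧ (∀ j, Mono (c.app j)) ∧ ∀ j, IsFG (F.obj j)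

variable {C : Type u} [Category.{v} C] [MonoidalCategory C] [SymmetricCategory C]
  [MonoidalClosed C] [Preadditive C] [HasFiniteCoproducts C]

/-- `A` is Noetherian: every finitely generated `A`-module is the cokernel of a morphism
`A^m ⟶ A^n` with `m, n ≥ 1`. -/
def IsNoetherian (A : CommMon C) : Prop :=
  ∀ M : Mod C A.X, IsFG M → ∃ (m n : ℕ) (_ : 1 ≤ m) (_ : 1 ≤ n)
    (P : Cofan fun _ : Fin m => reg A.X) (Q : Cofan fun _ : Fin n => reg A.X)
    (_ : IsColimit P) (_ : IsColimit Q) (q : P.pt ⟶ Q.pt) (π : Q.pt ⟶ M) (w : q ≫ π = 0),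
    Nonempty (IsColimit (CokernelCofork.ofπ π w))

/-- `X` is Noetherian: `O(U)` is Noetherian for every affine open `U`. -/
def Scheme.IsNoetherian [HasCoequalizers C] (X : Scheme C) : Prop :=
  ∀ U : ZarAff X.presheaf, SymMonGeom.IsNoetherian U.ring

/-- `K` is a field object: it is nonzero, Noetherian, and every monomorphism `I ⟶ K` of
`K`-modules is an isomorphism or zero. -/
structure IsFieldObject (K : CommMon C) : Prop where
  ne_zero : ¬ IsZero K.X
  isNoetherian : IsNoetherian K
  isIso_or_zero : ∀ (I : Mod C K.X) (i : I ⟶ reg K.X), Mono i → IsIso i ∨ i = 0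

end Finiteness

end SymMonGeom

open SymMonGeom

/-!
**A point with values in a field factors through an affine open.** Covering sieves for the Zariski
topology detect nonzero algebras: a covering sieve of `Spec A` contains a nonzero algebra over
every nonzero `A`-algebra (`exists_nonzero_of_covering`), because otherwise zero endomorphisms
would be invertible by conservativity. Moreover a nonzero Zariski open `Spec L` of the spectrum of
a field object `K` is the whole of it (`IsFieldObject.isIso_of_isZariskiOpen`): by the finiteness
conditions on `C` and `K`, the module `K` is a generator, so that `L ⊗_K -` is faithful by
flatness; the unit `K ⟶ L` becomes invertible after tensoring with `L` as it is an epimorphism of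
rings, so it is an epimorphism of modules, and it is a monomorphism as `K` is a field. Applied to
a cover of `X` (which is locally surjective on points, `factorSieve_mem`, by comparing two
morphisms to the sheaf of closed sieves) and to the inverse image in `Spec K` of one of its
members, this shows that `f : Spec K ⟶ X` factors as `Spec K ⟶ U ⟶ X` with `U` affine
(`IsFieldObject.exists_factor`).

**Existence.** The sections of the pullback of `M` over `T` are `O(T) ⊗_{O(U)} M(U)`. For any
other affine open `W` through which `T ⟶ X` factors, the intersection of `U` and `W` is affine,
and the semilinear morphism `M(W) ⟶ M(U ∩ W) ⟶ O(T) ⊗_{O(U)} M(U)` is obtained from the universal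
property of base change. It is independent of the chosen refinement, since the intersection
refines all others, and this gives all compatibilities (`AffinePullback.pullbackData`).

**Properties of an arbitrary pullback functor.** Such a functor is isomorphic to `K ⊗_{O(U)} M(U)`
on sections. Colimits of quasi-coherent modules are computed on sections and the tensor product
preserves them, whence cocontinuity. The monoidal structure is the one of extension of scalars,
and its compatibility with the pullback of sections from other affine opens follows from
semi-separatedness (`PullbackData.isCanonical_braided`).

For normality, recall that a functor `G` between module categories with a strength, that is with
natural coherent morphisms `G(M) ⊗ Z ⟶ G(M ⊗ Z)` for `Z` in `C`, acts on internal homs through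
`G(M) ⊗ Hom(M, N) ⟶ G(M ⊗ Hom(M, N)) ⟶ G(N)` (`Strength.normalStructure`). A pullback functor `F`
has a strength because base change commutes with `- ⊗ Z`, and a right adjoint `R` of `i^*` has one
because `i^*` commutes with `- ⊗ Z`. If `F` is local with respect to `i`, then `F ≅ (F ∘ R) ∘
i^*`, and `F ∘ R` is strong, hence normal (`PullbackData.isNormal`).
-/

namespace SymMonGeom

open MonObj

/-! ### The universal property of base change -/

section BaseChangeUniversal

variable {C : Type u} [Category.{v} C] [MonoidalCategory C] [SymmetricCategory C]
  [MonoidalClosed C] [HasCoequalizers C]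
variable {A B : C} [MonObj A] [MonObj B] [IsCommMonObj A] [IsCommMonObj B] {f : A ⟶ B}
  [IsMonHom f] {M : Mod C A} {N : Mod C B} {s : M.X ⟶ N.X} {hs : IsSemi f s}

lemma IsBaseChange.isIso (h : IsBaseChange f s hs) : IsIso (bcMap f s hs) := h

lemma IsBaseChange.epi (h : IsBaseChange f s hs) : Epi (B ◁ s ≫ act N) := by
  rw [← tq_bcMap f s hs]
  have := h.isIso
  exact epi_comp' (inferInstanceAs (Epi (tq (res f (reg B)) M))) inferInstance

/-- The linear extension `B ⊗ M ⟶ N` of `s`, followed by a semilinear morphism. -/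
lemma whiskerLeft_act_semi {D : C} [MonObj D] {g : B ⟶ D} {P : Mod C D} {k : N.X ⟶ P.X}
    (hk : IsSemi g k) (s : M.X ⟶ N.X) :
    (B ◁ s ≫ act N) ≫ k = B ◁ (s ≫ k) ≫ g ▷ P.X ≫ act P := by
  have hk' : act N ≫ k = B ◁ k ≫ g ▷ P.X ≫ act P := hk
  rw [Category.assoc, hk', whiskerLeft_comp_assoc]

/-- Semilinear morphisms out of a base change are determined by their restriction. -/
lemma IsBaseChange.hom_ext (h : IsBaseChange f s hs) {D : C} [MonObj D] {g : B ⟶ D}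
    {P : Mod C D} {k k' : N.X ⟶ P.X} (hk : IsSemi g k) (hk' : IsSemi g k')
    (e : s ≫ k = s ≫ k') : k = k' := by
  have := h.epi
  rw [← cancel_epi (B ◁ s ≫ act N), whiskerLeft_act_semi hk, whiskerLeft_act_semi hk', e]

lemma isSemi_res {D : C} [MonObj D] {g : B ⟶ D} [IsMonHom g] {P : Mod C D}
    {s' : M.X ⟶ P.X} (hs' : IsSemi (f ≫ g) s') : IsSemi (N := res g P) f s' := by
  have h : act M ≫ s' = A ◁ s' ≫ (f ≫ g) ▷ P.X ≫ act P := hs'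
  change act M ≫ s' = A ◁ s' ≫ f ▷ P.X ≫ g ▷ P.X ≫ act P
  rw [h, comp_whiskerRight_assoc]

/-- The semilinear extension of a morphism `M ⟶ P` along a base change `M ⟶ N`. -/
noncomputable def IsBaseChange.lift (h : IsBaseChange f s hs) {D : C} [MonObj D] {g : B ⟶ D}
    [IsMonHom g] {P : Mod C D} (s' : M.X ⟶ P.X) (hs' : IsSemi (f ≫ g) s') : N.X ⟶ P.X :=
  have := h.isIso
  inv (bcMap f s hs) ≫ bcMap f (N := res g P) s' (isSemi_res hs')

section

variable (h : IsBaseChange f s hs) {D : C} [MonObj D] {g : B ⟶ D}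
    [IsMonHom g] {P : Mod C D} (s' : M.X ⟶ P.X) (hs' : IsSemi (f ≫ g) s')

lemma IsBaseChange.act_lift : (B ◁ s ≫ act N) ≫ h.lift s' hs' = B ◁ s' ≫ g ▷ P.X ≫ act P := by
  have := h.isIso
  rw [← tq_bcMap f s hs, lift, Category.assoc, IsIso.hom_inv_id_assoc]
  exact tq_bcMap f (N := res g P) s' (isSemi_res hs')

@[simp]
lemma IsBaseChange.fac : s ≫ h.lift s' hs' = s' := by
  have e : s = (λ_ _).inv ≫ η[B] ▷ M.X ≫ B ◁ s ≫ act N := by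
    rw [← whisker_exchange_assoc, one_act]; simp
  have e' : s' = (λ_ _).inv ≫ η[B] ▷ M.X ≫ B ◁ s' ≫ g ▷ P.X ≫ act P := by
    rw [← whisker_exchange_assoc, ← comp_whiskerRight_assoc, IsMonHom.one_hom, one_act]; simp
  have h1 := h.act_lift s' hs'
  rw [Category.assoc] at h1
  refine (congrArg (· ≫ h.lift s' hs') e).trans (Eq.trans ?_ e'.symm)
  simp only [Category.assoc, h1]

lemma IsBaseChange.lift_semi : IsSemi g (h.lift s' hs') := by
  have hE := h.epi
  have hl := h.act_lift s' hs'
  have e : B ◁ (B ◁ s ≫ act N) ≫ act N = (α_ _ _ _).inv ≫ μ[B] ▷ M.X ≫ B ◁ s ≫ act N := by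
    rw [← whisker_exchange_assoc, mul_act]; simp
  have e' : B ◁ (B ◁ s' ≫ g ▷ P.X ≫ act P) ≫ g ▷ P.X ≫ act P =
      (α_ _ _ _).inv ≫ μ[B] ▷ M.X ≫ B ◁ s' ≫ g ▷ P.X ≫ act P := by
    have e1 : μ[B] ▷ M.X ≫ B ◁ s' ≫ g ▷ P.X ≫ act P =
        (B ⊗ B) ◁ s' ≫ (g ⊗ₘ g) ▷ P.X ≫ μ[D] ▷ P.X ≫ act P := by
      rw [← whisker_exchange_assoc, ← comp_whiskerRight_assoc, IsMonHom.mul_hom,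
        comp_whiskerRight_assoc]
    have e2 : B ◁ act P ≫ g ▷ P.X = g ▷ (D ⊗ P.X) ≫ D ◁ act P := whisker_exchange _ _
    rw [e1, mul_act, MonoidalCategory.tensorHom_def']
    simp only [whiskerLeft_comp, Category.assoc, reassoc_of% e2]
    monoidal
  rw [IsSemi, ← cancel_epi (B ◁ (B ◁ s ≫ act N)), reassoc_of% e, ← Category.assoc (B ◁ s), hl,
    ← whiskerLeft_comp_assoc, hl, e']

end

end BaseChangeUniversal

/-! ### Tensor products of modules with objects of `C` -/

section TensorObject

variable {C : Type u} [Category.{v} C] [MonoidalCategory C]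

/-- The module `M ⊗ T`, for an object `T` of `C`, with action through `M`. -/
abbrev modTensor {A : C} [MonObj A] (M : Mod C A) (T : C) : Mod C A :=
  letI : ModObj A (M.X ⊗ T) :=
    { smul := (α_ A M.X T).inv ≫ act M ▷ T
      one_smul := by
        have e : η[A] ▷ (M.X ⊗ T) ≫ (α_ _ _ _).inv ≫ act M ▷ T =
          (α_ _ _ _).inv ≫ (η[A] ▷ M.X ≫ act M) ▷ T := by monoidal
        change η[A] ▷ (M.X ⊗ T) ≫ (α_ A M.X T).inv ≫ act M ▷ T = (λ_ (M.X ⊗ T)).hom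
        rw [e, one_act]; monoidal
      mul_smul := by
        have e : μ[A] ▷ (M.X ⊗ T) ≫ (α_ _ _ _).inv ≫ act M ▷ T =
          (α_ _ _ _).inv ≫ (μ[A] ▷ M.X ≫ act M) ▷ T := by monoidal
        change μ[A] ▷ (M.X ⊗ T) ≫ (α_ A M.X T).inv ≫ act M ▷ T = (α_ A A (M.X ⊗ T)).hom ≫
          A ◁ ((α_ A M.X T).inv ≫ act M ▷ T) ≫ (α_ A M.X T).inv ≫ act M ▷ T
        rw [e, mul_act]; monoidal }
  ⟨M.X ⊗ T⟩

lemma isSemi_modTensor {A B : C} [MonObj A] [MonObj B] {f : A ⟶ B} {M : Mod C A} {N : Mod C B}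
    {s : M.X ⟶ N.X} (hs : IsSemi f s) (T : C) :
    IsSemi (M := modTensor M T) (N := modTensor N T) f (s ▷ T) := by
  have h : act M ≫ s = A ◁ s ≫ f ▷ N.X ≫ act N := hs
  change ((α_ A M.X T).inv ≫ act M ▷ T) ≫ s ▷ T =
    A ◁ (s ▷ T) ≫ f ▷ (N.X ⊗ T) ≫ (α_ B N.X T).inv ≫ act N ▷ T
  rw [Category.assoc, ← comp_whiskerRight, h]
  monoidal

variable [SymmetricCategory C] [MonoidalClosed C] [HasCoequalizers C]
variable {A B : C} [MonObj A] [MonObj B] [IsCommMonObj A] [IsCommMonObj B]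

/-- The morphism `M' ⊗ M ⊗ T ⟶ M' ⊗_A (M ⊗ T)` is balanced in the first two factors. -/
lemma tensorAssoc_aux (M' M : Mod C A) (T : C) :
    (ract M' ▷ M.X) ▷ T ≫ (α_ M'.X M.X T).hom ≫ tq M' (modTensor M T) =
      ((α_ M'.X A M.X).hom ≫ M'.X ◁ act M) ▷ T ≫ (α_ M'.X M.X T).hom ≫
        tq M' (modTensor M T) := by
  have e : ract M' ▷ (M.X ⊗ T) ≫ tq M' (modTensor M T) = (α_ M'.X A (M.X ⊗ T)).hom ≫
      M'.X ◁ ((α_ A M.X T).inv ≫ act M ▷ T) ≫ tq M' (modTensor M T) :=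
    tq_bal M' (modTensor M T)
  have e1 : (ract M' ▷ M.X) ▷ T ≫ (α_ M'.X M.X T).hom = (α_ _ _ _).hom ≫ ract M' ▷ (M.X ⊗ T) := by
    monoidal
  rw [reassoc_of% e1, e]
  monoidal

lemma tensorAssoc_aux' (M' M : Mod C A) (T : C) :
    IsBal M' (modTensor M T) ((α_ M'.X M.X T).inv ≫ tq M' M ▷ T) := by
  have e : ract M' ▷ (M.X ⊗ T) ≫ (α_ M'.X M.X T).inv ≫ tq M' M ▷ T =
    (α_ _ _ _).inv ≫ (ract M' ▷ M.X ≫ tq M' M) ▷ T := by monoidal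
  change ract M' ▷ (M.X ⊗ T) ≫ (α_ M'.X M.X T).inv ≫ tq M' M ▷ T = (α_ M'.X A (M.X ⊗ T)).hom ≫
    M'.X ◁ ((α_ A M.X T).inv ≫ act M ▷ T) ≫ (α_ M'.X M.X T).inv ≫ tq M' M ▷ T
  rw [e, tq_bal]
  monoidal

/-- The morphism `(M' ⊗_A M) ⊗ T ⟶ M' ⊗_A (M ⊗ T)`. -/
noncomputable def tensorAssocHom (M' M : Mod C A) (T : C) :
    (tMod M' M).X ⊗ T ⟶ (tMod M' (modTensor M T)).X :=
  tDescR T ((α_ M'.X M.X T).hom ≫ tq M' (modTensor M T)) (tensorAssoc_aux M' M T)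

lemma tq_tensorAssocHom (M' M : Mod C A) (T : C) :
    tq M' M ▷ T ≫ tensorAssocHom M' M T = (α_ M'.X M.X T).hom ≫ tq M' (modTensor M T) :=
  tπ_tDescR T _ (tensorAssoc_aux M' M T)

/-- The isomorphism `(M' ⊗_A M) ⊗ T ≅ M' ⊗_A (M ⊗ T)` for `T` in `C`. -/
noncomputable def tensorAssoc (M' M : Mod C A) (T : C) :
    (tMod M' M).X ⊗ T ≅ (tMod M' (modTensor M T)).X where
  hom := tensorAssocHom M' M T
  inv := tD (N := modTensor M T) ((α_ M'.X M.X T).inv ≫ tq M' M ▷ T) (tensorAssoc_aux' M' M T)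
  hom_inv_id := by
    rw [← cancel_epi (tq M' M ▷ T), reassoc_of% tq_tensorAssocHom, tq_tD]
    simp
  inv_hom_id := by
    rw [← cancel_epi (tq M' (modTensor M T)), ← Category.assoc, tq_tD, Category.assoc,
      tq_tensorAssocHom]
    simp

lemma tq_tensorAssoc (M' M : Mod C A) (T : C) :
    tq M' M ▷ T ≫ (tensorAssoc M' M T).hom = (α_ M'.X M.X T).hom ≫ tq M' (modTensor M T) :=
  tq_tensorAssocHom M' M T

/-- Base change commutes with tensoring by an object of `C`. -/
lemma isBaseChange_modTensor {f : A ⟶ B} [IsMonHom f] {M : Mod C A} {N : Mod C B}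
    {s : M.X ⟶ N.X} {hs : IsSemi f s} (h : IsBaseChange f s hs) (T : C) :
    IsBaseChange (M := modTensor M T) (N := modTensor N T) f (s ▷ T) (isSemi_modTensor hs T) := by
  have hi := h.isIso
  have key : (tensorAssoc (res f (reg B)) M T).hom ≫
      bcMap (M := modTensor M T) (N := modTensor N T) f (s ▷ T) (isSemi_modTensor hs T) =
      bcMap f s hs ▷ T := by
    have h1 : (tq (res f (reg B)) (modTensor M T) : B ⊗ (M.X ⊗ T) ⟶ _) ≫
      bcMap (M := modTensor M T) (N := modTensor N T) f (s ▷ T) (isSemi_modTensor hs T) =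
        B ◁ (s ▷ T) ≫ (α_ B N.X T).inv ≫ act N ▷ T := tq_bcMap _ _ _
    have h2 : (tq (res f (reg B)) M : B ⊗ M.X ⟶ _) ≫ bcMap f s hs = B ◁ s ≫ act N :=
      tq_bcMap f s hs
    rw [← cancel_epi (tq (res f (reg B)) M ▷ T), reassoc_of% tq_tensorAssoc,
      ← comp_whiskerRight]
    change (α_ B M.X T).hom ≫ (tq (res f (reg B)) (modTensor M T) : B ⊗ (M.X ⊗ T) ⟶ _) ≫ _ =
      ((tq (res f (reg B)) M : B ⊗ M.X ⟶ _) ≫ bcMap f s hs) ▷ T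
    rw [h1, h2]
    monoidal
  have : IsIso ((tensorAssoc (res f (reg B)) M T).hom ≫
      bcMap (M := modTensor M T) (N := modTensor N T) f (s ▷ T) (isSemi_modTensor hs T)) := by
    rw [key]; infer_instance
  exact IsIso.of_isIso_comp_left (tensorAssoc (res f (reg B)) M T).hom _

end TensorObject

/-! ### Colimits of modules -/

section ModColimits

variable {C : Type u} [Category.{v} C] [MonoidalCategory C] [SymmetricCategory C]
  [MonoidalClosed C] {J : Type*} [Category* J]

variable {A : C} [MonObj A] {F : J ⥤ Mod C A} {c : Cocone (F ⋙ Mod.forget A)}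

/-- A leg of a cocone on the objects underlying a diagram of modules. -/
abbrev modLeg (c : Cocone (F ⋙ Mod.forget A)) (j : J) : (F.obj j).X ⟶ c.pt := c.ι.app j

lemma modLeg_w (c : Cocone (F ⋙ Mod.forget A)) {i j : J} (a : i ⟶ j) :
    (F.map a).hom ≫ modLeg c j = modLeg c i := c.w a

lemma whiskerLeft_modLeg_ext (hc : IsColimit c) (Z : C) {W : C} {f g : Z ⊗ c.pt ⟶ W}
    (h : ∀ j, Z ◁ modLeg c j ≫ f = Z ◁ modLeg c j ≫ g) : f = g :=
  (isColimitOfPreserves (tensorLeft Z) hc).hom_ext h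

variable (hc : IsColimit c)

/-- The action of `A` on a colimit of the objects underlying a diagram of modules. -/
noncomputable def colimitAct : A ⊗ c.pt ⟶ c.pt :=
  (isColimitOfPreserves (tensorLeft A) hc).desc
    ⟨c.pt, { app := fun j => act (F.obj j) ≫ modLeg c j
             naturality := fun i j a => by
              change A ◁ (F.map a).hom ≫ act (F.obj j) ≫ modLeg c j =
                (act (F.obj i) ≫ modLeg c i) ≫ 𝟙 c.pt
              rw [← reassoc_of% (act_hom (F.map a)), modLeg_w, Category.comp_id] }⟩

lemma whiskerLeft_colimitAct (j : J) :
    A ◁ modLeg c j ≫ colimitAct hc = act (F.obj j) ≫ modLeg c j :=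
  (isColimitOfPreserves (tensorLeft A) hc).fac ⟨c.pt, _⟩ j

/-- The module structure on a colimit of the objects underlying a diagram of modules. -/
noncomputable abbrev colimitMod : Mod C A :=
  letI : ModObj A c.pt :=
    { smul := colimitAct hc
      one_smul := by
        change η[A] ▷ c.pt ≫ colimitAct hc = (λ_ c.pt).hom
        refine whiskerLeft_modLeg_ext hc _ fun j => ?_
        rw [whisker_exchange_assoc, whiskerLeft_colimitAct, reassoc_of% (one_act (F.obj j)),
          leftUnitor_naturality]
      mul_smul := by
        change μ[A] ▷ c.pt ≫ colimitAct hc = (α_ A A c.pt).hom ≫ A ◁ colimitAct hc ≫ colimitAct hc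
        refine whiskerLeft_modLeg_ext hc _ fun j => ?_
        have e : (A ⊗ A) ◁ modLeg c j ≫ (α_ A A c.pt).hom =
          (α_ _ _ _).hom ≫ A ◁ A ◁ modLeg c j := by monoidal
        rw [whisker_exchange_assoc, whiskerLeft_colimitAct, reassoc_of% e,
          ← whiskerLeft_comp_assoc, whiskerLeft_colimitAct, whiskerLeft_comp_assoc,
          whiskerLeft_colimitAct, reassoc_of% (mul_act (F.obj j))] }
  ⟨c.pt⟩

lemma modLeg_semi (j : J) :
    IsSemi (M := F.obj j) (N := colimitMod hc) (𝟙 A) (modLeg c j) := by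
  rw [IsSemi, id_whiskerRight, Category.id_comp]
  exact (whiskerLeft_colimitAct hc j).symm

/-- The cocone of modules on a colimit of the underlying objects. -/
noncomputable def colimitModCocone : Cocone F :=
  ⟨colimitMod hc,
    { app := fun j => mkHom (N := colimitMod hc) (modLeg c j) (modLeg_semi hc j)
      naturality := fun i j a => Mod.hom_ext _ _
        ((modLeg_w c a).trans (Category.comp_id _).symm) }⟩

/-- A leg of a cocone of modules, as a morphism of underlying objects. -/
abbrev homLeg (d : Cocone F) (j : J) : (F.obj j).X ⟶ d.pt.X := (d.ι.app j).hom

/-- The morphism of underlying objects attached to a cocone of modules. -/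
noncomputable def modDesc (s : Cocone F) : c.pt ⟶ s.pt.X := hc.desc ((Mod.forget A).mapCocone s)

lemma modLeg_modDesc (s : Cocone F) (j : J) : modLeg c j ≫ modDesc hc s = homLeg s j :=
  hc.fac _ j

lemma modDesc_semi (s : Cocone F) :
    IsSemi (M := colimitMod hc) (N := s.pt) (𝟙 A) (modDesc hc s) := by
  change colimitAct hc ≫ modDesc hc s = A ◁ modDesc hc s ≫ 𝟙 A ▷ s.pt.X ≫ act s.pt
  rw [id_whiskerRight, Category.id_comp]
  refine whiskerLeft_modLeg_ext hc _ fun j => ?_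
  have h := whiskerLeft_colimitAct hc j
  rw [reassoc_of% h, modLeg_modDesc, ← whiskerLeft_comp_assoc, modLeg_modDesc]
  exact act_hom (s.ι.app j)

/-- The colimit of the underlying objects is a colimit of modules. -/
noncomputable def isColimitModCocone : IsColimit (colimitModCocone hc) where
  desc s := mkHom (M := colimitMod hc) (N := s.pt) (modDesc hc s) (modDesc_semi hc s)
  fac s j := Mod.hom_ext _ _ (modLeg_modDesc hc s j)
  uniq s m hm := Mod.hom_ext _ _ (hc.uniq ((Mod.forget A).mapCocone s) m.hom
    fun j => congrArg Mod.Hom.hom (hm j))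

instance hasColimit_mod [HasColimit (F ⋙ Mod.forget A)] : HasColimit F :=
  ⟨⟨⟨_, isColimitModCocone (colimit.isColimit (F ⋙ Mod.forget A))⟩⟩⟩

instance preservesColimit_modForget [HasColimit (F ⋙ Mod.forget A)] :
    PreservesColimit F (Mod.forget A) :=
  preservesColimit_of_preserves_colimit_cocone
    (isColimitModCocone (colimit.isColimit (F ⋙ Mod.forget A)))
    (IsColimit.ofIsoColimit (colimit.isColimit (F ⋙ Mod.forget A))
      (Cocone.ext (Iso.refl _) fun j => Category.comp_id _))

instance hasColimitsOfShape_mod [HasColimitsOfShape J C] : HasColimitsOfShape J (Mod C A) where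

instance preservesColimitsOfShape_modForget [HasColimitsOfShape J C] :
    PreservesColimitsOfShape J (Mod.forget (D := C) A) where

section Tensor

variable [HasCoequalizers C] [IsCommMonObj A]

instance modForget_reflectsIsomorphisms : (Mod.forget (D := C) A).ReflectsIsomorphisms where
  reflects f hf := by
    have : IsIso f.hom := hf
    exact isIso_of_hom f

lemma tq_whiskerLeft_hom (M' : Mod C A) {M N : Mod C A} (f : M ⟶ N) :
    tq M' M ≫ (M' ◁ f).hom = M'.X ◁ f.hom ≫ tq M' N := by
  refine (tq_tHom (𝟙 M') f).trans ?_
  rw [Mod.id_hom', id_tensorHom]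

/-- A leg of a cocone on the objects underlying `M' ⊗_A M_j`. -/
abbrev tensorLeg (M' : Mod C A) (s : Cocone (F ⋙ tensorLeft M' ⋙ Mod.forget A)) (j : J) :
    (tMod M' (F.obj j)).X ⟶ s.pt := s.ι.app j

/-- The morphism out of `M' ⊗ colim M_j` attached to a cocone on the objects underlying
`M' ⊗_A M_j`. -/
noncomputable def tensorColimitAux (M' : Mod C A) {d : Cocone F}
    (hd : IsColimit ((Mod.forget A).mapCocone d))
    (s : Cocone (F ⋙ tensorLeft M' ⋙ Mod.forget A)) : M'.X ⊗ d.pt.X ⟶ s.pt :=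
  (isColimitOfPreserves (tensorLeft M'.X) hd).desc
    ⟨s.pt, { app := fun j => tq M' (F.obj j) ≫ tensorLeg M' s j
             naturality := fun i j a => by
              have h : (M' ◁ F.map a).hom ≫ tensorLeg M' s j = tensorLeg M' s i := s.w a
              change M'.X ◁ (F.map a).hom ≫ tq M' (F.obj j) ≫ tensorLeg M' s j =
                (tq M' (F.obj i) ≫ tensorLeg M' s i) ≫ 𝟙 s.pt
              have h' := tq_whiskerLeft_hom M' (F.map a)
              rw [← reassoc_of% h', h, Category.comp_id] }⟩

section

variable (M' : Mod C A) {d : Cocone F} (hd : IsColimit ((Mod.forget A).mapCocone d))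
  (s : Cocone (F ⋙ tensorLeft M' ⋙ Mod.forget A))

lemma whiskerLeft_homLeg_ext {d : Cocone F} (hd : IsColimit ((Mod.forget A).mapCocone d)) (Z : C)
    {W : C} {f g : Z ⊗ d.pt.X ⟶ W}
    (h : ∀ j, Z ◁ homLeg d j ≫ f = Z ◁ homLeg d j ≫ g) : f = g :=
  (isColimitOfPreserves (tensorLeft Z) hd).hom_ext h

lemma whiskerLeft_tensorColimitAux (j : J) : M'.X ◁ homLeg d j ≫ tensorColimitAux M' hd s =
    tq M' (F.obj j) ≫ tensorLeg M' s j :=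
  (isColimitOfPreserves (tensorLeft M'.X) hd).fac ⟨s.pt, _⟩ j

lemma tensorColimitAux_bal : IsBal M' d.pt (tensorColimitAux M' hd s) := by
  refine whiskerLeft_homLeg_ext hd _ fun j => ?_
  have h1 : A ◁ homLeg d j ≫ act d.pt = act (F.obj j) ≫ homLeg d j := (act_hom (d.ι.app j)).symm
  have h2 : (M'.X ⊗ A) ◁ homLeg d j ≫ (α_ M'.X A d.pt.X).hom ≫ M'.X ◁ act d.pt =
    (α_ _ _ _).hom ≫ M'.X ◁ (A ◁ homLeg d j ≫ act d.pt) := by monoidal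
  rw [whisker_exchange_assoc, whiskerLeft_tensorColimitAux, reassoc_of% h2, h1,
    whiskerLeft_comp_assoc, whiskerLeft_tensorColimitAux, reassoc_of% (tq_bal M' (F.obj j))]

/-- The relative tensor product commutes with colimits computed on underlying objects. -/
noncomputable def isColimitTensor (M' : Mod C A) {d : Cocone F}
    (hd : IsColimit ((Mod.forget A).mapCocone d)) :
    IsColimit ((tensorLeft M' ⋙ Mod.forget A).mapCocone d) where
  desc s := tD (tensorColimitAux M' hd s) (tensorColimitAux_bal M' hd s)
  fac s j := by
    change (M' ◁ d.ι.app j).hom ≫ tD _ (tensorColimitAux_bal M' hd s) = tensorLeg M' s j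
    apply (cancel_epi (tq M' (F.obj j))).1
    have h := tq_whiskerLeft_hom M' (N := d.pt) (d.ι.app j)
    refine ((reassoc_of% h) _).trans ?_
    refine (congrArg (M'.X ◁ homLeg d j ≫ ·) (tq_tD _ (tensorColimitAux_bal M' hd s))).trans ?_
    exact whiskerLeft_tensorColimitAux M' hd s j
  uniq s m hm := by
    change (tMod M' d.pt).X ⟶ s.pt at m
    apply (cancel_epi (tq M' d.pt)).1
    refine Eq.trans ?_ (tq_tD _ (tensorColimitAux_bal M' hd s)).symm
    refine whiskerLeft_homLeg_ext hd _ fun j => ?_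
    refine Eq.trans ?_ (whiskerLeft_tensorColimitAux M' hd s j).symm
    have h := tq_whiskerLeft_hom M' (N := d.pt) (d.ι.app j)
    refine ((reassoc_of% h) m).symm.trans ?_
    exact congrArg (tq M' (F.obj j) ≫ ·) (hm j)

instance preservesColimit_tensorLeft_forget (M' : Mod C A) [HasColimit (F ⋙ Mod.forget A)] :
    PreservesColimit F (tensorLeft M' ⋙ Mod.forget A) where
  preserves hd := ⟨isColimitTensor M' (isColimitOfPreserves (Mod.forget A) hd)⟩

end

end Tensor

end ModColimits

/-! ### Colimits of base changes -/

section BaseChangeColimit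

variable {C : Type u} [Category.{v} C] [MonoidalCategory C] [SymmetricCategory C]
  [MonoidalClosed C] [HasCoequalizers C]
variable {A B : C} [MonObj A] [MonObj B] [IsCommMonObj A] [IsCommMonObj B] {f : A ⟶ B}
  [IsMonHom f]

lemma bcMap_naturality {M M' : Mod C A} {N N' : Mod C B} {s : M.X ⟶ N.X} {s' : M'.X ⟶ N'.X}
    (hs : IsSemi f s) (hs' : IsSemi f s') (k : M ⟶ M') (k' : N ⟶ N')
    (w : s ≫ k'.hom = k.hom ≫ s') :
    (res f (reg B) ◁ k).hom ≫ bcMap f s' hs' = bcMap f s hs ≫ k'.hom := by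
  have h1 : (tq (res f (reg B)) M : B ⊗ M.X ⟶ _) ≫ (res f (reg B) ◁ k).hom =
    B ◁ k.hom ≫ tq (res f (reg B)) M' := tq_whiskerLeft_hom (res f (reg B)) k
  have h2 := tq_bcMap f s hs
  have h3 := tq_bcMap f s' hs'
  apply (cancel_epi (tq (res f (reg B)) M)).1
  rw [reassoc_of% h1, h3, reassoc_of% h2, act_hom, ← whiskerLeft_comp_assoc, ← w,
    whiskerLeft_comp_assoc]

/-- A colimit of base changes is a base change. -/
lemma isBaseChange_colimit {J : Type*} [Category* J] {F : J ⥤ Mod C A} {G : J ⥤ Mod C B}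
    {c : Cocone F} {d : Cocone G} (hc : IsColimit ((Mod.forget A).mapCocone c))
    (hd : IsColimit ((Mod.forget B).mapCocone d))
    (s : ∀ j, (F.obj j).X ⟶ (G.obj j).X) (hs : ∀ j, IsSemi f (s j))
    (hb : ∀ j, IsBaseChange f (s j) (hs j))
    (w : ∀ {i j : J} (a : i ⟶ j), s i ≫ (G.map a).hom = (F.map a).hom ≫ s j)
    (t : c.pt.X ⟶ d.pt.X) (ht : IsSemi f t) (wt : ∀ j, homLeg c j ≫ t = s j ≫ homLeg d j) :
    IsBaseChange f t ht := by
  let e : F ⋙ tensorLeft (res f (reg B)) ⋙ Mod.forget A ≅ G ⋙ Mod.forget B :=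
    NatIso.ofComponents (fun j =>
      @asIso C _ _ _ (bcMap f (s j) (hs j)) (hb j).isIso)
      (fun {i j} a => bcMap_naturality (hs i) (hs j) (F.map a) (G.map a) (w a))
  let E := (isColimitTensor (res f (reg B)) hc).coconePointsIsoOfNatIso hd e
  have he : bcMap f t ht = E.hom := (isColimitTensor (res f (reg B)) hc).hom_ext fun j =>
    (bcMap_naturality (hs j) ht (c.ι.app j) (d.ι.app j) (wt j).symm).trans
      (IsColimit.comp_coconePointsIsoOfNatIso_hom (isColimitTensor (res f (reg B)) hc) hd e j).symm
  have hE : IsIso E.hom := inferInstance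
  rw [IsBaseChange, he]
  exact hE

end BaseChangeColimit

/-! ### Colimits of quasi-coherent modules -/

section QCohColimit

variable {C : Type u} [Category.{v} C] [MonoidalCategory C] [SymmetricCategory C]
  [MonoidalClosed C] [HasCoequalizers C] {X : Psh C} {J : Type*} [Category* J]
  [HasColimitsOfShape J C] (D : J ⥤ QCoh X)

namespace QCoh

/-- The sections over an affine open of the pointwise colimit of a diagram of quasi-coherent
modules. -/
noncomputable abbrev colimitCocone (U : ZarAff X) : Cocone (D ⋙ eval U) :=
  colimitModCocone (colimit.isColimit ((D ⋙ eval U) ⋙ Mod.forget U.ring.X))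

/-- The underlying cocone of `colimitCocone` is a colimit. -/
noncomputable def colimitCoconeForget (U : ZarAff X) :
    IsColimit ((Mod.forget U.ring.X).mapCocone (colimitCocone D U)) :=
  isColimitOfPreserves _ (isColimitModCocone _)

/-- A leg of `colimitCocone`, as a morphism of underlying objects. -/
noncomputable abbrev colimitLeg (U : ZarAff X) (j : J) :
    ((D.obj j).obj U).X ⟶ (colimitCocone D U).pt.X := ((colimitCocone D U).ι.app j).hom

lemma act_colimitLeg (U : ZarAff X) (j : J) : act ((D.obj j).obj U) ≫ colimitLeg D U j =
    U.ring.X ◁ colimitLeg D U j ≫ act (colimitCocone D U).pt :=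
  act_hom ((colimitCocone D U).ι.app j)

lemma colimitLeg_w (U : ZarAff X) {i j : J} (a : i ⟶ j) :
    ((D.map a).app U).hom ≫ colimitLeg D U j = colimitLeg D U i :=
  congrArg Mod.Hom.hom ((colimitCocone D U).w a)

/-- The restriction maps of the pointwise colimit. -/
noncomputable def colimitMap {U V : ZarAff X} (φ : Restr U V) :
    (colimitCocone D U).pt.X ⟶ (colimitCocone D V).pt.X :=
  (colimitCoconeForget D U).desc
    ⟨(colimitCocone D V).pt.X,
      { app := fun j => (D.obj j).map φ ≫ colimitLeg D V j
        naturality := fun i j a => by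
          have h := (D.map a).naturality φ
          change ((D.map a).app U).hom ≫ (D.obj j).map φ ≫ colimitLeg D V j =
            ((D.obj i).map φ ≫ colimitLeg D V i) ≫ 𝟙 _
          rw [← reassoc_of% h, colimitLeg_w, Category.comp_id] }⟩

lemma colimitLeg_colimitMap {U V : ZarAff X} (φ : Restr U V) (j : J) :
    colimitLeg D U j ≫ colimitMap D φ =
      (D.obj j).map φ ≫ colimitLeg D V j :=
  (colimitCoconeForget D U).fac ⟨_, _⟩ j

lemma colimitLeg_ext (U : ZarAff X) {W : C} {f g : (colimitCocone D U).pt.X ⟶ W}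
    (h : ∀ j, colimitLeg D U j ≫ f = colimitLeg D U j ≫ g) : f = g :=
  (colimitCoconeForget D U).hom_ext h

lemma colimitMap_semi {U V : ZarAff X} (φ : Restr U V) :
    IsSemi (ringHom φ.hom) (colimitMap D φ) := by
  refine whiskerLeft_homLeg_ext (colimitCoconeForget D U) _ fun j => ?_
  change U.ring.X ◁ colimitLeg D U j ≫ _ = U.ring.X ◁ colimitLeg D U j ≫ _
  have h1 := act_colimitLeg D U j
  have h2 := act_colimitLeg D V j
  have h3 := colimitLeg_colimitMap D φ j
  have h4 : act ((D.obj j).obj U) ≫ (D.obj j).map φ = U.ring.X ◁ (D.obj j).map φ ≫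
    ringHom φ.hom ▷ _ ≫ act ((D.obj j).obj V) := (D.obj j).semi φ
  have e : U.ring.X ◁ colimitLeg D V j ≫ ringHom φ.hom ▷ _ =
    ringHom φ.hom ▷ _ ≫ V.ring.X ◁ colimitLeg D V j := whisker_exchange _ _
  rw [← reassoc_of% h1, h3, reassoc_of% h4, h2, ← whiskerLeft_comp_assoc, h3,
    whiskerLeft_comp_assoc, reassoc_of% e]

/-- The pointwise colimit of a diagram of quasi-coherent modules. -/
noncomputable def colimitObj : QCoh X where
  obj U := (colimitCocone D U).pt
  map φ := colimitMap D φ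
  semi φ := colimitMap_semi D φ
  map_id U := colimitLeg_ext D U fun j => by
    rw [colimitLeg_colimitMap, (D.obj j).map_id]
    exact (Category.id_comp _).trans (Category.comp_id _).symm
  map_comp φ ψ := colimitLeg_ext D _ fun j => by
    have h := colimitLeg_colimitMap D φ j
    have h' := colimitLeg_colimitMap D ψ j
    rw [colimitLeg_colimitMap, (D.obj j).map_comp, reassoc_of% h, h', Category.assoc]
  isBaseChange {U V} φ :=
    isBaseChange_colimit (F := D ⋙ eval U) (G := D ⋙ eval V) (colimitCoconeForget D U)
      (colimitCoconeForget D V) (fun j => (D.obj j).map φ) (fun j => (D.obj j).semi φ)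
      (fun j => (D.obj j).isBaseChange φ) (fun a => (D.map a).naturality φ) (colimitMap D φ)
      (colimitMap_semi D φ) (colimitLeg_colimitMap D φ)

/-- The cocone on the pointwise colimit. -/
noncomputable def cocone : Cocone D :=
  ⟨colimitObj D,
    { app := fun j => ⟨fun U => (colimitCocone D U).ι.app j,
        fun φ => (colimitLeg_colimitMap D φ j).symm⟩
      naturality := fun i j a => hom_ext _ _ fun U => (colimitCocone D U).ι.naturality a }⟩

/-- The morphism out of the sections of the pointwise colimit attached to a cocone. -/
noncomputable def colimitDesc (s : Cocone D) (U : ZarAff X) :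
    (colimitCocone D U).pt ⟶ s.pt.obj U :=
  (isColimitModCocone _).desc ((eval U).mapCocone s)

lemma colimitLeg_colimitDesc (s : Cocone D) (U : ZarAff X) (j : J) :
    colimitLeg D U j ≫ (colimitDesc D s U).hom = ((s.ι.app j).app U).hom :=
  congrArg Mod.Hom.hom ((isColimitModCocone _).fac ((eval U).mapCocone s) j)

lemma colimitMap_colimitDesc (s : Cocone D) {U V : ZarAff X} (φ : Restr U V) :
    colimitMap D φ ≫ (colimitDesc D s V).hom = (colimitDesc D s U).hom ≫ s.pt.map φ := by
  refine colimitLeg_ext D U fun j => ?_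
  have h1 := colimitLeg_colimitDesc D s U j
  have h2 := colimitLeg_colimitMap D φ j
  change colimitLeg D U j ≫ _ = colimitLeg D U j ≫ _
  rw [reassoc_of% h1, reassoc_of% h2, colimitLeg_colimitDesc]
  exact (s.ι.app j).naturality φ

/-- The pointwise colimit is a colimit of quasi-coherent modules. -/
noncomputable def isColimitCocone : IsColimit (cocone D) where
  desc s := ⟨colimitDesc D s, colimitMap_colimitDesc D s⟩
  fac s j := hom_ext _ _ fun U => (isColimitModCocone _).fac ((eval U).mapCocone s) j
  uniq s m hm := hom_ext _ _ fun U =>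
    (isColimitModCocone _).uniq ((eval U).mapCocone s) (m.app U)
      fun j => congrArg (fun k => k.app U) (hm j)

/-- Sections over an affine open commute with colimits. -/
instance preservesColimitsOfShape_eval (U : ZarAff X) :
    PreservesColimitsOfShape J (eval U) where
  preservesColimit {D} := preservesColimit_of_preserves_colimit_cocone (isColimitCocone D)
    (isColimitModCocone (colimit.isColimit ((D ⋙ eval U) ⋙ Mod.forget U.ring.X)))

end QCoh

end QCohColimit

end SymMonGeom

namespace SymMonGeom

/-! ### The forgetful functor from modules as a lax monoidal functor -/

section ForgetLaxBraided

variable {C : Type u} [Category.{v} C] [MonoidalCategory C] [SymmetricCategory C]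
  [MonoidalClosed C] [HasCoequalizers C]

/-- The forgetful functor from `A`-modules is lax monoidal, with structure morphisms the unit of `A`
and the universal balanced morphisms. -/
noncomputable instance modForgetLaxMonoidal (A : C) [MonObj A] [IsCommMonObj A] :
    (Mod.forget (D := C) A).LaxMonoidal where
  ε := MonObj.one (X := A)
  μ M N := tq M N
  μ_natural_left f N := by
    refine Eq.trans ?_ (tq_tHom f (𝟙 N)).symm
    rw [Mod.id_hom', tensorHom_id]; rfl
  μ_natural_right M f := by
    refine Eq.trans ?_ (tq_tHom (𝟙 M) f).symm
    rw [Mod.id_hom', id_tensorHom]; rfl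
  associativity M N P := tq_assocHom M N P
  left_unitality M := by
    change (λ_ M.X).hom = MonObj.one (X := A) ▷ M.X ≫ tqA M ≫ lunit M
    rw [tqA_lunit, one_act]
  right_unitality M := by
    change (ρ_ M.X).hom = M.X ◁ MonObj.one (X := A) ≫ tqA' M ≫ (runitIso M).hom.hom
    rw [tqA'_runit, ract_one]

noncomputable instance modForgetLaxBraided (A : C) [MonObj A] [IsCommMonObj A] :
    (Mod.forget (D := C) A).LaxBraided where
  braided M N := tq_tBraid M N

end ForgetLaxBraided

open MonObj

/-- If the two unit insertions `X ⟶ X ⊗ X` of a monoid object agree, they are inverse to the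
multiplication. -/
lemma mul_unit_right_eq_id {D : Type*} [Category* D] [MonoidalCategory D] {X : D} [MonObj X]
    (h : (ρ_ X).inv ≫ X ◁ η[X] = (λ_ X).inv ≫ η[X] ▷ X) :
    (μ[X] ≫ (ρ_ X).inv) ≫ X ◁ η[X] = 𝟙 (X ⊗ X) := by
  have e : (μ[X] ≫ (ρ_ X).inv) ≫ X ◁ η[X] = X ◁ ((ρ_ X).inv ≫ X ◁ η[X]) ≫ (α_ X X X).inv ≫
      μ[X] ▷ X := by
    rw [rightUnitor_inv_naturality, Category.assoc, ← whisker_exchange]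
    monoidal
  have e' : X ◁ ((λ_ X).inv ≫ η[X] ▷ X) ≫ (α_ X X X).inv ≫ μ[X] ▷ X =
      (ρ_ X).inv ▷ X ≫ (X ◁ η[X] ≫ μ[X]) ▷ X := by monoidal
  rw [e, h, e', MonObj.mul_one, ← comp_whiskerRight, Iso.inv_hom_id, id_whiskerRight]

/-- The unit of a monoid object is a morphism of monoids from the tensor unit. -/
instance isMonHom_one {D : Type*} [Category* D] [MonoidalCategory D] (X : D) [MonObj X] :
    IsMonHom η[X] where
  one_hom := by
    change 𝟙 _ ≫ η[X] = η[X]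
    exact Category.id_comp _
  mul_hom := by
    change (λ_ (𝟙_ D)).hom ≫ η[X] = _
    rw [MonoidalCategory.tensorHom_def, Category.assoc, MonObj.mul_one,
      rightUnitor_naturality, unitors_equal]

/-! ### Tensor products of commutative algebras -/

section Algebras

variable {C : Type u} [Category.{v} C] [MonoidalCategory C] [SymmetricCategory C]
  [MonoidalClosed C] [HasCoequalizers C]

variable {A B : CommMon C} (f : A ⟶ B)

lemma ract_algMod : ract (algMod f) = B.X ◁ ringHom f ≫ μ[B.X] := by
  rw [ract_res]
  change _ ≫ (β_ B.X B.X).hom ≫ μ[B.X] = _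
  rw [IsCommMonObj.mul_comm]

lemma act_algMod : act (algMod f) = ringHom f ▷ B.X ≫ μ[B.X] := rfl

lemma algMul_bal : IsBal (algMod f) (algMod f) μ[B.X] := by
  rw [IsBal, ract_algMod, act_algMod]
  rw [comp_whiskerRight_assoc, MonObj.mul_assoc]
  monoidal

/-- The multiplication `B ⊗_A B ⟶ B`, as a morphism of `C`. -/
noncomputable def algMul : (tMod (algMod f) (algMod f)).X ⟶ B.X := tD μ[B.X] (algMul_bal f)

lemma tq_algMul : tq (algMod f) (algMod f) ≫ algMul f = μ[B.X] := tq_tD _ _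

lemma algMul_semi :
    IsSemi (M := tMod (algMod f) (algMod f)) (N := algMod f) (𝟙 A.X) (algMul f) := by
  apply isSemi_of_tq (P := algMod f)
  change (ringHom f ▷ B.X ≫ μ[B.X]) ▷ B.X ≫ tq (algMod f) (algMod f) ≫ algMul f =
    (α_ A.X B.X B.X).hom ≫ A.X ◁ (tq (algMod f) (algMod f) ≫ algMul f) ≫
      𝟙 A.X ▷ B.X ≫ ringHom f ▷ B.X ≫ μ[B.X]
  rw [tq_algMul, comp_whiskerRight_assoc, MonObj.mul_assoc, id_whiskerRight, Category.id_comp,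
    whisker_exchange_assoc]
  monoidal

lemma algOne_semi : IsSemi (M := reg A.X) (N := algMod f) (𝟙 A.X) (ringHom f) := by
  change μ[A.X] ≫ ringHom f = A.X ◁ ringHom f ≫ 𝟙 A.X ▷ B.X ≫ ringHom f ▷ B.X ≫ μ[B.X]
  rw [IsMonHom.mul_hom, MonoidalCategory.tensorHom_def', id_whiskerRight, Category.id_comp,
    Category.assoc]

/-- The unit `A ⟶ B`, as a morphism of `A`-modules. -/
abbrev algOne : 𝟙_ (Mod C A.X) ⟶ algMod f := mkHom (M := reg A.X) (ringHom f) (algOne_semi f)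

/-- The multiplication `B ⊗_A B ⟶ B`, as a morphism of `A`-modules. -/
noncomputable abbrev algMulHom : algMod f ⊗ algMod f ⟶ algMod f :=
  mkHom (M := tMod (algMod f) (algMod f)) (algMul f) (algMul_semi f)

lemma algOne_mul : algOne f ▷ algMod f ≫ algMulHom f = (λ_ (algMod f)).hom := by
  apply Mod.hom_ext
  apply (cancel_epi (tq (reg A.X) (algMod f))).1
  have h1 : tq (reg A.X) (algMod f) ≫ (algOne f ▷ algMod f).hom =
      (algOne f).hom ▷ B.X ≫ tq (algMod f) (algMod f) := by
    refine (tq_tHom (algOne f) (𝟙 (algMod f))).trans ?_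
    rw [Mod.id_hom', tensorHom_id]
  have h2 : tq (reg A.X) (algMod f) ≫ (λ_ (algMod f)).hom.hom = ringHom f ▷ B.X ≫ μ[B.X] :=
    tqA_lunit (algMod f)
  rw [h2]
  refine ((reassoc_of% h1) _).trans ?_
  exact congrArg ((algOne f).hom ▷ B.X ≫ ·) (tq_algMul f)

lemma algMul_one : algMod f ◁ algOne f ≫ algMulHom f = (ρ_ (algMod f)).hom := by
  apply Mod.hom_ext
  apply (cancel_epi (tq (algMod f) (reg A.X))).1
  have h1 : tq (algMod f) (reg A.X) ≫ (algMod f ◁ algOne f).hom =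
      B.X ◁ (algOne f).hom ≫ tq (algMod f) (algMod f) := tq_whiskerLeft_hom _ (algOne f)
  have h2 : tq (algMod f) (reg A.X) ≫ (ρ_ (algMod f)).hom.hom = B.X ◁ ringHom f ≫ μ[B.X] :=
    (tqA'_runit (algMod f)).trans (ract_algMod f)
  rw [h2]
  refine ((reassoc_of% h1) _).trans ?_
  exact congrArg (B.X ◁ (algOne f).hom ≫ ·) (tq_algMul f)

lemma algMul_assoc : algMulHom f ▷ algMod f ≫ algMulHom f =
    (α_ (algMod f) (algMod f) (algMod f)).hom ≫ algMod f ◁ algMulHom f ≫ algMulHom f := by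
  apply Mod.hom_ext
  apply t3_ext
  have hm : tq (algMod f) (algMod f) ≫ (algMulHom f).hom = μ[B.X] := tq_algMul f
  have h1 : tq (tMod (algMod f) (algMod f)) (algMod f) ≫ (algMulHom f ▷ algMod f).hom =
      (algMulHom f).hom ▷ B.X ≫ tq (algMod f) (algMod f) := by
    refine (tq_tHom (algMulHom f) (𝟙 (algMod f))).trans ?_
    rw [Mod.id_hom', tensorHom_id]
  have h2 : tq (algMod f) (tMod (algMod f) (algMod f)) ≫ (algMod f ◁ algMulHom f).hom =
      B.X ◁ (algMulHom f).hom ≫ tq (algMod f) (algMod f) := tq_whiskerLeft_hom _ (algMulHom f)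
  have h3 := tq_assocHom (algMod f) (algMod f) (algMod f)
  change tq (algMod f) (algMod f) ▷ B.X ≫ tq (tMod (algMod f) (algMod f)) (algMod f) ≫
      (algMulHom f ▷ algMod f).hom ≫ (algMulHom f).hom =
    tq (algMod f) (algMod f) ▷ B.X ≫ tq (tMod (algMod f) (algMod f)) (algMod f) ≫
      assocHom (algMod f) (algMod f) (algMod f) ≫ (algMod f ◁ algMulHom f).hom ≫ (algMulHom f).hom
  rw [reassoc_of% h1, reassoc_of% h3, reassoc_of% h2, hm, ← comp_whiskerRight_assoc, hm,
    ← whiskerLeft_comp_assoc, hm, MonObj.mul_assoc]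

lemma algMul_comm : (β_ (algMod f) (algMod f)).hom ≫ algMulHom f = algMulHom f := by
  apply Mod.hom_ext
  apply (cancel_epi (tq (algMod f) (algMod f))).1
  have hm : tq (algMod f) (algMod f) ≫ (algMulHom f).hom = μ[B.X] := tq_algMul f
  have h1 : tq (algMod f) (algMod f) ≫ (β_ (algMod f) (algMod f)).hom.hom =
    (β_ B.X B.X).hom ≫ tq (algMod f) (algMod f) := tq_tBraid (algMod f) (algMod f)
  refine ((reassoc_of% h1) _).trans ?_
  rw [hm, IsCommMonObj.mul_comm]

/-- An `A`-algebra `B` as a commutative monoid in `A`-modules. -/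
noncomputable def algMon : CommMon (Mod C A.X) :=
  letI : MonObj (algMod f) :=
    { one := algOne f
      mul := algMulHom f
      one_mul := algOne_mul f
      mul_one := algMul_one f
      mul_assoc := algMul_assoc f }
  letI : IsCommMonObj (algMod f) := { mul_comm := algMul_comm f }
  ⟨algMod f⟩

/-- The identity of `B`, from `B` to the commutative monoid underlying the monoid `algMon f` in
`A`-modules. -/
noncomputable def toForgetAlgMon : B ⟶ (Mod.forget A.X).mapCommMon.obj (algMon f) :=
  CommMon.homMk (Mon.Hom.mk' (𝟙 B.X)
    (by
      change η[B.X] ≫ 𝟙 B.X = η[A.X] ≫ ringHom f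
      rw [Category.comp_id, IsMonHom.one_hom])
    (by
      change μ[B.X] ≫ 𝟙 B.X = (𝟙 B.X ⊗ₘ 𝟙 B.X) ≫ tq (algMod f) (algMod f) ≫ algMul f
      rw [tq_algMul]
      simp))

variable {D : CommMon C} (g : A ⟶ D)

/-- The tensor product `B ⊗_A D` of commutative `A`-algebras, as a commutative monoid in
`A`-modules. -/
noncomputable abbrev algTensor : CommMon (Mod C A.X) := ⟨(algMon f).X ⊗ (algMon g).X⟩

/-- The tensor product `B ⊗_A D` of commutative `A`-algebras. -/
noncomputable abbrev pushoutAlg : CommMon C := (Mod.forget A.X).mapCommMon.obj (algTensor f g)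

/-- The inclusion of the left factor of `B ⊗_A D`, as a morphism of monoids in `A`-modules. -/
noncomputable def algInl : algMon f ⟶ algTensor f g :=
  CommMon.homMk (Mon.ofHom (A := (algMon f).X) (B := (algMon f).X ⊗ (algMon g).X)
    ((ρ_ (algMon f).X).inv ≫ (algMon f).X ◁ η[(algMon g).X]))

/-- The inclusion of the right factor of `B ⊗_A D`, as a morphism of monoids in `A`-modules. -/
noncomputable def algInr : algMon g ⟶ algTensor f g :=
  CommMon.homMk (Mon.ofHom (A := (algMon g).X) (B := (algMon f).X ⊗ (algMon g).X)
    ((λ_ (algMon g).X).inv ≫ η[(algMon f).X] ▷ (algMon g).X))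

/-- The morphism `B ⟶ B ⊗_A D`. -/
noncomputable def pushoutInl : B ⟶ pushoutAlg f g :=
  toForgetAlgMon f ≫ (Mod.forget A.X).mapCommMon.map (algInl f g)

/-- The morphism `D ⟶ B ⊗_A D`. -/
noncomputable def pushoutInr : D ⟶ pushoutAlg f g :=
  toForgetAlgMon g ≫ (Mod.forget A.X).mapCommMon.map (algInr f g)

lemma ringHom_pushoutInl : ringHom (pushoutInl f g) =
    ((ρ_ (algMon f).X).inv ≫ (algMon f).X ◁ η[(algMon g).X]).hom :=
  Category.id_comp (X := B.X) ((ρ_ (algMon f).X).inv ≫ (algMon f).X ◁ η[(algMon g).X]).hom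

lemma ringHom_pushoutInr : ringHom (pushoutInr f g) =
    ((λ_ (algMon g).X).inv ≫ η[(algMon f).X] ▷ (algMon g).X).hom :=
  Category.id_comp (X := D.X) ((λ_ (algMon g).X).inv ≫ η[(algMon f).X] ▷ (algMon g).X).hom

lemma pushout_w : f ≫ pushoutInl f g = g ≫ pushoutInr f g := by
  have h : η[(algMon f).X] ≫ (ρ_ (algMon f).X).inv ≫ (algMon f).X ◁ η[(algMon g).X] =
      η[(algMon g).X] ≫ (λ_ (algMon g).X).inv ≫ η[(algMon f).X] ▷ (algMon g).X := by
    rw [rightUnitor_inv_naturality_assoc, leftUnitor_inv_naturality_assoc, whisker_exchange,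
      unitors_inv_equal]
  have h' := congrArg Mod.Hom.hom h
  apply CommMon.hom_ext
  change ringHom f ≫ ringHom (pushoutInl f g) = ringHom g ≫ ringHom (pushoutInr f g)
  rw [ringHom_pushoutInl, ringHom_pushoutInr]
  exact h'

/-- If `A ⟶ B` is an epimorphism, then `B ≅ B ⊗_A A ⟶ B ⊗_A B` is an isomorphism. -/
lemma isIso_whiskerLeft_algOne [Epi f] : IsIso (algMod f ◁ algOne f) := by
  have h1 : pushoutInl f f = pushoutInr f f := by
    rw [← cancel_epi f, pushout_w]
  have h2 : (ρ_ (algMon f).X).inv ≫ (algMon f).X ◁ η[(algMon f).X] =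
      (λ_ (algMon f).X).inv ≫ η[(algMon f).X] ▷ (algMon f).X := by
    apply Mod.hom_ext
    rw [← ringHom_pushoutInl, ← ringHom_pushoutInr, h1]
  have h4 : (algMon f).X ◁ η[(algMon f).X] ≫ μ[(algMon f).X] ≫ (ρ_ (algMon f).X).inv = 𝟙 _ := by
    rw [← Category.assoc, MonObj.mul_one, Iso.hom_inv_id]
  exact ⟨μ[(algMon f).X] ≫ (ρ_ (algMon f).X).inv, h4, mul_unit_right_eq_id h2⟩

end Algebras

/-! ### Additivity of the tensor product of modules -/

section Additivity

variable {C : Type u} [Category.{v} C] [MonoidalCategory C] [SymmetricCategory C]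
  [MonoidalClosed C] [Preadditive C] [HasFiniteCoproducts C]

lemma whiskerLeft_zero' (Z : C) (M N : C) : Z ◁ (0 : M ⟶ N) = 0 := by
  simpa using whiskerLeft_add Z (0 : M ⟶ N) 0

variable [HasCoequalizers C]

lemma mod_whiskerLeft_add {A : C} [MonObj A] [IsCommMonObj A] (L : Mod C A) {M N : Mod C A}
    (f g : M ⟶ N) : L ◁ (f + g) = L ◁ f + L ◁ g := by
  apply Mod.hom_ext
  apply (cancel_epi (tq L M)).1
  rw [add_hom]
  refine Eq.trans ?_ (Preadditive.comp_add _ _ _ (tq L M) (L ◁ f).hom (L ◁ g).hom).symm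
  rw [tq_whiskerLeft_hom, tq_whiskerLeft_hom, tq_whiskerLeft_hom, add_hom, whiskerLeft_add,
    Preadditive.add_comp]

lemma mod_whiskerLeft_zero {A : C} [MonObj A] [IsCommMonObj A] (L M N : Mod C A) :
    L ◁ (0 : M ⟶ N) = 0 := by
  simpa using mod_whiskerLeft_add L (0 : M ⟶ N) 0

lemma mod_whiskerLeft_sub {A : C} [MonObj A] [IsCommMonObj A] (L : Mod C A) {M N : Mod C A}
    (f g : M ⟶ N) : L ◁ (f - g) = L ◁ f - L ◁ g := by
  have h := mod_whiskerLeft_add L (f - g) g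
  rw [sub_add_cancel] at h
  rw [h, add_sub_cancel_right]

lemma isZero_mod_iff {A : C} [MonObj A] (M : Mod C A) : IsZero M.X ↔ 𝟙 M = 0 := by
  rw [IsZero.iff_id_eq_zero]
  exact ⟨fun h => Mod.hom_ext _ _ h, fun h => congrArg Mod.Hom.hom h⟩

end Additivity

/-! ### Kernels of linear morphisms -/

section Kernels

variable {C : Type u} [Category.{v} C] [Abelian C] [MonoidalCategory C] [SymmetricCategory C]
  [MonoidalClosed C] {A : C} [MonObj A] {M N : Mod C A} (k : M ⟶ N)

/-- The action of `A` on the kernel of a linear morphism. -/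
noncomputable def kernelAct : A ⊗ kernel k.hom ⟶ kernel k.hom :=
  kernel.lift k.hom (A ◁ kernel.ι k.hom ≫ act M) (by
    rw [Category.assoc, act_hom, ← whiskerLeft_comp_assoc, kernel.condition, whiskerLeft_zero',
      zero_comp])

lemma kernelAct_ι : kernelAct k ≫ kernel.ι k.hom = A ◁ kernel.ι k.hom ≫ act M :=
  kernel.lift_ι _ _ _

/-- The kernel of a linear morphism, as a module. -/
noncomputable def kernelMod : Mod C A :=
  mkMod (kernel k.hom) (kernelAct k)
    (by
      rw [← cancel_mono (kernel.ι k.hom), Category.assoc, kernelAct_ι, ← whisker_exchange_assoc,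
        one_act, leftUnitor_naturality])
    (by
      rw [← cancel_mono (kernel.ι k.hom)]
      simp only [Category.assoc, kernelAct_ι]
      rw [← whisker_exchange_assoc, mul_act, ← whiskerLeft_comp_assoc, kernelAct_ι]
      monoidal)

/-- The inclusion of the kernel of a linear morphism. -/
noncomputable def kernelModι : kernelMod k ⟶ M :=
  mkHom (M := kernelMod k) (kernel.ι k.hom) (by
    change kernelAct k ≫ kernel.ι k.hom = A ◁ kernel.ι k.hom ≫ 𝟙 A ▷ M.X ≫ act M
    rw [kernelAct_ι, id_whiskerRight, Category.id_comp])

lemma kernelModι_comp : kernelModι k ≫ k = 0 := Mod.hom_ext _ _ (kernel.condition k.hom)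

lemma mono_of_mono_hom (h : Mono k.hom) : Mono k :=
  ⟨fun a b e => Mod.hom_ext _ _ ((cancel_mono k.hom).1 (congrArg Mod.Hom.hom e))⟩

instance mono_kernelModι : Mono (kernelModι k) :=
  mono_of_mono_hom _ (inferInstanceAs (Mono (kernel.ι k.hom)))

end Kernels

/-! ### Free modules -/

section Free

variable {C : Type u} [Category.{v} C] [MonoidalCategory C] {A : C} [MonObj A]

/-- The morphism from the free module `A ⊗ G` attached to a morphism `G ⟶ M`. -/
def freeDesc {G : C} {M : Mod C A} (f : G ⟶ M.X) : modTensor (reg A) G ⟶ M :=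
  mkHom (M := modTensor (reg A) G) (A ◁ f ≫ act M) (by
    change ((α_ A A G).inv ≫ μ[A] ▷ G) ≫ A ◁ f ≫ act M =
      A ◁ (A ◁ f ≫ act M) ≫ 𝟙 A ▷ M.X ≫ act M
    rw [Category.assoc, ← whisker_exchange_assoc, mul_act]
    monoidal)

/-- The unit `G ⟶ A ⊗ G`. -/
def freeUnit (A : C) [MonObj A] (G : C) : G ⟶ (modTensor (reg A) G).X := (λ_ G).inv ≫ η[A] ▷ G

lemma freeUnit_desc {G : C} {M : Mod C A} (f : G ⟶ M.X) :
    freeUnit A G ≫ (freeDesc f).hom = f := by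
  change ((λ_ G).inv ≫ η[A] ▷ G) ≫ A ◁ f ≫ act M = f
  rw [Category.assoc, ← whisker_exchange_assoc, one_act]
  simp

lemma freeDesc_unit {G : C} {M : Mod C A} (g : modTensor (reg A) G ⟶ M) :
    freeDesc (freeUnit A G ≫ g.hom) = g := by
  apply Mod.hom_ext
  have h : ((α_ A A G).inv ≫ μ[A] ▷ G) ≫ g.hom = A ◁ g.hom ≫ act M := act_hom g
  change A ◁ (((λ_ G).inv ≫ η[A] ▷ G) ≫ g.hom) ≫ act M = g.hom
  rw [whiskerLeft_comp_assoc, ← h]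
  have e : A ◁ ((λ_ G).inv ≫ η[A] ▷ G) ≫ (α_ A A G).inv ≫ μ[A] ▷ G =
    (ρ_ A).inv ▷ G ≫ (A ◁ η[A] ≫ μ[A]) ▷ G := by monoidal
  rw [Category.assoc, reassoc_of% e, MonObj.mul_one, ← comp_whiskerRight_assoc, Iso.inv_hom_id,
    id_whiskerRight]
  exact Category.id_comp g.hom

/-- `A ⊗ G` is the free `A`-module on `G`. -/
def freeIso (A : C) [MonObj A] (G : C) :
    coyoneda.obj (op (modTensor (reg A) G)) ≅ Mod.forget A ⋙ coyoneda.obj (op G) :=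
  NatIso.ofComponents (fun M =>
    { hom := ↾fun g => freeUnit A G ≫ g.hom
      inv := ↾fun f => freeDesc f
      hom_inv_id := by ext g; exact freeDesc_unit g
      inv_hom_id := by ext f; exact freeUnit_desc f })
    (fun {M N} h => by
      ext g
      change freeUnit A G ≫ g.hom ≫ h.hom = (freeUnit A G ≫ g.hom) ≫ h.hom
      rw [Category.assoc])

end Free

/-! ### Flat epimorphisms out of a field object -/

section Field

variable {C : Type u} [Category.{v} C] [Abelian C] [MonoidalCategory C] [SymmetricCategory C]
  [MonoidalClosed C] [HasColimits C]

lemma mono_hom_of_mono {A : C} [MonObj A] {M N : Mod C A} (k : M ⟶ N) [Mono k] : Mono k.hom := by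
  apply Preadditive.mono_of_kernel_zero
  have h : kernelModι k = 0 := by rw [← cancel_mono k, kernelModι_comp, zero_comp]
  exact congrArg Mod.Hom.hom h

/-- The free `A`-module on a finitely generated object is finitely generated. -/
lemma isFG_free (A : C) [MonObj A] {G : C} (hG : IsFG G) : IsFG (modTensor (reg A) G) := by
  intro J _ _ F hF
  have h1 : PreservesColimit (F ⋙ Mod.forget A) (coyoneda.obj (op G)) :=
    hG J (F ⋙ Mod.forget A) fun a => by
      have := hF a
      exact mono_hom_of_mono (F.map a)
  have h2 : PreservesColimit F (Mod.forget A ⋙ coyoneda.obj (op G)) := inferInstance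
  exact preservesColimit_of_natIso F (freeIso A G).symm

/-- Over a Noetherian `K`, the module `K` is a generator: modules are quotients of sums of free
modules on finitely generated objects, and those are quotients of finite powers of `K`. -/
lemma eq_zero_of_forall_reg (hC : HasFGSubobjects C) {K : CommMon C} (hK : IsNoetherian K)
    {M N : Mod C K.X} (w : M ⟶ N) (hw : ∀ x : reg K.X ⟶ M, x ≫ w = 0) : w = 0 := by
  obtain ⟨J, _, _, F, c, ⟨hc⟩, -, hF⟩ := hC M.X
  apply Mod.hom_ext
  refine hc.hom_ext fun j => ?_
  change c.app j ≫ w.hom = c.app j ≫ 0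
  obtain ⟨m, n, -, -, P, Q, -, hQ, q, π, hπ, ⟨hcok⟩⟩ := hK _ (isFG_free K.X (hF j))
  have : Epi π := Cofork.IsColimit.epi hcok
  have h : π ≫ freeDesc (c.app j) ≫ w = 0 := by
    refine Cofan.IsColimit.hom_ext hQ _ _ fun i => ?_
    have h1 := hw (Q.inj i ≫ π ≫ freeDesc (c.app j))
    simp only [Category.assoc] at h1
    rw [h1, comp_zero]
  have h2 : freeDesc (c.app j) ≫ w = 0 := by
    rw [← cancel_epi π, h, comp_zero]
  have h3 : freeUnit K.X (F.obj j) ≫ (freeDesc (c.app j)).hom ≫ w.hom =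
      freeUnit K.X (F.obj j) ≫ 0 := congrArg (freeUnit K.X (F.obj j) ≫ Mod.Hom.hom ·) h2
  have h4 := freeUnit_desc (M := M) (c.app j)
  refine Eq.trans ?_ (h3.trans (by rw [comp_zero, comp_zero]))
  rw [← Category.assoc]
  exact congrArg (· ≫ w.hom) h4.symm

variable {K L : CommMon C} (g : K ⟶ L)

/-- Nonzero linear morphisms out of a field object are monomorphisms. -/
lemma IsFieldObject.mono_of_ne_zero (hK : IsFieldObject K) {M : Mod C K.X} (k : reg K.X ⟶ M)
    (hk : k ≠ 0) : Mono k := by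
  rcases hK.isIso_or_zero _ (kernelModι k) inferInstance with h | h
  · exact absurd (by rw [← cancel_epi (kernelModι k), kernelModι_comp, comp_zero]) hk
  · exact mono_of_mono_hom _ (Preadditive.mono_of_kernel_zero (congrArg Mod.Hom.hom h))

/-- Tensoring with a nonzero flat algebra over a field object is faithful. -/
lemma IsFieldObject.whiskerLeft_injective (hC : HasFGSubobjects C) (hK : IsFieldObject K)
    (hg : PreservesFiniteLimits (tensorLeft (algMod g))) (hL : ¬ IsZero L.X)
    {M N : Mod C K.X} {u w : M ⟶ N} (h : algMod g ◁ u = algMod g ◁ w) : u = w := by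
  rw [← sub_eq_zero]
  refine eq_zero_of_forall_reg hC hK.isNoetherian _ fun x => ?_
  -- A nonzero `x ≫ (u - w) : K ⟶ N` is a monomorphism, and so is its tensor product with `L`, by
  -- flatness; but the latter is zero, so that `L = 0`.
  by_contra hx
  have h0 : algMod g ◁ (x ≫ (u - w)) = 0 := by
    rw [whiskerLeft_comp, mod_whiskerLeft_sub, h, sub_self, comp_zero]
  have : Mono (x ≫ (u - w)) := hK.mono_of_ne_zero _ hx
  have hm : Mono (algMod g ◁ (x ≫ (u - w))) :=
    inferInstanceAs (Mono ((tensorLeft (algMod g)).map (x ≫ (u - w))))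
  have h1 : 𝟙 (algMod g ⊗ 𝟙_ (Mod C K.X)) = 0 :=
    (cancel_mono (algMod g ◁ (x ≫ (u - w)))).1 (by rw [h0, comp_zero, comp_zero])
  apply hL
  refine (isZero_mod_iff (algMod g)).2 ?_
  rw [← (ρ_ (algMod g)).inv_hom_id, ← Category.id_comp (ρ_ (algMod g)).hom, h1, zero_comp,
    comp_zero]

/-- A nonzero Zariski open of the spectrum of a field object is the whole spectrum. -/
lemma IsFieldObject.isIso_of_isZariskiOpen (hC : HasFGSubobjects C) (hK : IsFieldObject K)
    (hg : IsZariskiOpen g) (hL : ¬ IsZero L.X) : IsIso g := by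
  have := hg.epi
  have hi : IsIso (algMod g ◁ algOne g) := isIso_whiskerLeft_algOne g
  -- As `L ≅ L ⊗_K K ⟶ L ⊗_K L` is invertible and `L ≠ 0`, the unit `K ⟶ L` is nonzero; it is an
  -- epimorphism of modules because it becomes one after the faithful functor `L ⊗_K -`.
  have h0 : algOne g ≠ 0 := by
    intro h
    rw [h, mod_whiskerLeft_zero] at hi
    apply hL
    refine (isZero_mod_iff (algMod g)).2 ?_
    rw [← (ρ_ (algMod g)).inv_hom_id, ← Category.id_comp (ρ_ (algMod g)).hom,
      ← IsIso.hom_inv_id (0 : algMod g ⊗ 𝟙_ (Mod C K.X) ⟶ algMod g ⊗ algMod g), zero_comp,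
      zero_comp, comp_zero]
  have he : Epi (algOne g) := ⟨fun u w e => hK.whiskerLeft_injective g hC hg.flat hL (by
    rw [← cancel_epi (algMod g ◁ algOne g), ← whiskerLeft_comp, e, whiskerLeft_comp])⟩
  have hm : Mono (algOne g) := hK.mono_of_ne_zero (algOne g) h0
  have hm' : Mono (ringHom g) := mono_hom_of_mono (algOne g)
  have : (Mod.forget (D := C) K.X).PreservesEpimorphisms :=
    preservesEpimorphisms_of_preservesColimitsOfShape _
  have he' : Epi (ringHom g) := inferInstanceAs (Epi ((Mod.forget K.X).map (algOne g)))
  have : IsIso (ringHom g) := isIso_of_mono_of_epi _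
  have : IsIso ((Mon.forget C).map g.hom) := this
  have : IsIso ((CommMon.forget₂Mon C).map g) := isIso_of_reflects_iso g.hom (Mon.forget C)
  exact isIso_of_reflects_iso g (CommMon.forget₂Mon C)

end Field

/-! ### Points of schemes with values in a field object -/

section Covers

variable {C : Type u} [Category.{v} C] [Abelian C] [MonoidalCategory C] [SymmetricCategory C]
  [MonoidalClosed C]

/-- The trivial ring is only mapped to the trivial ring. -/
lemma isZero_of_ringHom {A B : CommMon C} (f : A ⟶ B) (hA : IsZero A.X) : IsZero B.X := by
  rw [IsZero.iff_id_eq_zero]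
  have h : η[B.X] = 0 := by
    rw [← IsMonHom.one_hom (ringHom f), hA.eq_of_src (ringHom f) 0, comp_zero]
  have h1 : B.X ◁ η[B.X] ≫ μ[B.X] = (ρ_ B.X).hom := MonObj.mul_one _
  rw [← (ρ_ B.X).inv_hom_id, ← h1, h, whiskerLeft_zero', zero_comp, comp_zero]

/-- A covering sieve of `Spec A` meets every nonzero `A`-algebra in a nonzero algebra. -/
lemma exists_nonzero_of_covering {A : (CommMon C)ᵒᵖ} {S : Sieve A} (hS : S ∈ zariskiTopology C A)
    {A' : CommMon C} (a : A.unop ⟶ A') (hA' : ¬ IsZero A'.X) :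
    ∃ (B : CommMon C) (b : A' ⟶ B), ¬ IsZero B.X ∧ S (a ≫ b).op := by
  induction hS generalizing A' with
  | of A R hR =>
    obtain ⟨-, s, -, hs, hcons⟩ := hR
    -- Otherwise `B ⊗_A A' = 0` for all members `B` of the covering family, so that the zero
    -- endomorphism of `A'` becomes invertible over each of them, and is therefore invertible.
    by_contra! hcon
    have h : IsIso (0 : algMod a ⟶ algMod a) := hcons _ fun g hg => by
      have hz : IsZero (pushoutAlg g.hom.unop a).X := by
        by_contra hz
        refine hcon _ (pushoutInr g.hom.unop a) hz
          ⟨_, (pushoutInl g.hom.unop a).op, g.hom, hs g hg, ?_⟩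
        rw [← pushout_w]
        rfl
      have hz' : 𝟙 (algMod g.hom.unop ⊗ algMod a) = 0 := (isZero_mod_iff _).1 hz
      refine ⟨0, ?_, ?_⟩ <;> rw [hz', mod_whiskerLeft_zero, comp_zero]
    apply hA'
    refine (isZero_mod_iff (algMod a)).2 ?_
    rw [← IsIso.hom_inv_id (0 : algMod a ⟶ algMod a), zero_comp]
  | top A =>
    exact ⟨A', 𝟙 _, hA', trivial⟩
  | pullback A S hS Y f ih =>
    obtain ⟨B, b, hB, hb⟩ := ih (f.unop ≫ a) hA'
    refine ⟨B, b, hB, ?_⟩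
    rw [Category.assoc] at hb
    exact hb
  | transitive A S R hS hR ih ih' =>
    obtain ⟨B, b, hB, hb⟩ := ih a hA'
    obtain ⟨B', b', hB', hb'⟩ := ih' hb (𝟙 B) hB
    refine ⟨B', b ≫ b', hB', ?_⟩
    rw [Category.id_comp] at hb'
    rw [← Category.assoc]
    exact hb'

/-- The sieve of morphisms `Spec B ⟶ Spec A` whose composite with `f : Spec A ⟶ X` factors through
a member of a family of affine opens of `X`. -/
def factorSieve {X : Psh C} (S : Set (ZarAff X)) {A : CommMon C} (f : Spec A ⟶ X) :
    Sieve (op A) where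
  arrows B b := ∃ U ∈ S, ∃ x : Spec B.unop ⟶ Spec U.ring, x ≫ U.incl = SpecMap b.unop ≫ f
  downward_closed := by
    rintro B B' b ⟨U, hU, x, hx⟩ b'
    refine ⟨U, hU, SpecMap b'.unop ≫ x, ?_⟩
    rw [Category.assoc, hx]
    simp [SpecMap]

lemma factorSieve_comp {X : Psh C} (S : Set (ZarAff X)) {A B : (CommMon C)ᵒᵖ}
    (f : uliftYoneda.{u}.obj A ⟶ X) (b : B ⟶ A) :
    factorSieve S (A := B.unop) (uliftYoneda.{u}.map b ≫ f) =
      (factorSieve S (A := A.unop) f).pullback b := by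
  ext D d
  change (∃ U ∈ S, ∃ x : Spec D.unop ⟶ Spec U.ring, x ≫ U.incl =
    uliftYoneda.{u}.map d ≫ uliftYoneda.{u}.map b ≫ f) ↔
    ∃ U ∈ S, ∃ x : Spec D.unop ⟶ Spec U.ring, x ≫ U.incl = uliftYoneda.{u}.map (d ≫ b) ≫ f
  rw [Functor.map_comp, Category.assoc]

/-- The morphism to the sheaf of closed sieves which classifies the subsheaf covered by a family of
affine opens. -/
def coverClassifier {X : Psh C} (S : Set (ZarAff X)) :
    X ⟶ (Functor.closedSieves (zariskiTopology C)).toFunctor where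
  app A := ↾fun x => ⟨(zariskiTopology C).close
    (factorSieve S (A := A.unop.unop) (uliftYonedaEquiv.{u}.symm x)),
    (zariskiTopology C).close_isClosed _⟩
  naturality A B b := by
    ext x
    apply Subtype.ext
    change (zariskiTopology C).close (factorSieve S (A := B.unop.unop)
        (uliftYonedaEquiv.{u}.symm (X.map b x))) =
      ((zariskiTopology C).close (factorSieve S (A := A.unop.unop)
        (uliftYonedaEquiv.{u}.symm x))).pullback b.unop
    rw [← GrothendieckTopology.pullback_close, uliftYonedaEquiv_symm_map, factorSieve_comp]

/-- The morphism to the sheaf of closed sieves which classifies the whole of `X`. -/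
def topClassifier (X : Psh C) : X ⟶ (Functor.closedSieves (zariskiTopology C)).toFunctor where
  app A := ↾fun x => ⟨(⊤ : Sieve A.unop), fun _ _ _ => trivial⟩
  naturality A B b := by
    ext x
    apply Subtype.ext
    exact (Sieve.pullback_top (f := b.unop)).symm

/-- A cover of `X` by affine opens is locally surjective on points. -/
lemma factorSieve_mem {X : Psh C} {S : Set (ZarAff X)} (hS : IsCover S) {A : CommMon C}
    (f : Spec A ⟶ X) : factorSieve S f ∈ zariskiTopology C (op A) := by
  have h : coverClassifier S = topClassifier X := by
    refine hS ((isSheaf_iff_isSheaf_of_type _ _).2 (classifier_isSheaf _)) _ _ fun U hU => ?_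
    ext B x
    apply Subtype.ext
    change (zariskiTopology C).close (factorSieve S (A := B.unop.unop)
        (uliftYonedaEquiv.{u}.symm (U.incl.app B x))) = ⊤
    have ht : factorSieve S (A := B.unop.unop) (uliftYonedaEquiv.{u}.symm (U.incl.app B x)) =
        ⊤ := by
      rw [← Sieve.id_mem_iff_eq_top]
      refine ⟨U, hU, uliftYonedaEquiv.{u}.symm x, ?_⟩
      refine (uliftYonedaEquiv_symm_comp x U.incl).trans ?_
      change _ = uliftYoneda.{u}.map (𝟙 _) ≫ _
      rw [CategoryTheory.Functor.map_id, Category.id_comp]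
    rw [ht, GrothendieckTopology.close_eq_top_iff_mem]
    exact (zariskiTopology C).top_mem _
  rw [← GrothendieckTopology.close_eq_top_iff_mem]
  have h1 := congrArg (fun k => (k.app (op (op A)) (uliftYonedaEquiv.{u} f)).1) h
  change (zariskiTopology C).close (factorSieve S (A := A)
        (uliftYonedaEquiv.{u}.symm (uliftYonedaEquiv.{u} f))) = ⊤ at h1
  rwa [Equiv.symm_apply_apply] at h1

variable [HasColimits C]

/-- A morphism from the spectrum of a field object to a scheme factors through an affine open. -/
lemma IsFieldObject.exists_factor (hC : HasFGSubobjects C) {K : CommMon C} (hK : IsFieldObject K)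
    (X : Scheme C) (f : Spec K ⟶ X.presheaf) :
    ∃ (U : ZarAff X.presheaf) (g : U.ring ⟶ K), SpecMap g ≫ U.incl = f := by
  obtain ⟨S, hS⟩ := X.exists_cover
  -- Some nonzero `K`-algebra `B` has spectrum mapping to an affine open `U` of the cover.
  obtain ⟨B, b, hB, U, hU, x, hx⟩ :=
    exists_nonzero_of_covering (factorSieve_mem hS f) (𝟙 K) hK.ne_zero
  -- The inverse image of `U` in `Spec K` is the union of a family `R` of affine opens. As `B` is
  -- nonzero, so is some member of `R`, and this member is all of `Spec K`.
  obtain ⟨R, hR, hRU⟩ := U.isOpen.isOpen f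
  obtain ⟨B', b', hB', Y, r, g, hg, hr⟩ :=
    exists_nonzero_of_covering ((hRU (𝟙 K ≫ b)).1 ⟨x, hx⟩) (𝟙 B) hB
  have hY : ¬ IsZero Y.unop.X := fun h => hB' (isZero_of_ringHom r.unop h)
  have : IsIso g.unop := hK.isIso_of_isZariskiOpen _ hC (hR g hg) hY
  have hgi : IsIso g := (isIso_unop_iff g).1 this
  have htop : Sieve.generate R = ⊤ := by
    rw [← Sieve.id_mem_iff_eq_top]
    exact ⟨Y, inv g, g, hg, IsIso.inv_hom_id g⟩
  obtain ⟨y, hy⟩ := (hRU (𝟙 K)).2 (by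
    rw [htop, Sieve.pullback_top]
    exact (zariskiTopology C).top_mem _)
  obtain ⟨g₀, rfl⟩ := uliftYoneda.{u}.map_surjective y
  refine ⟨U, g₀.unop, ?_⟩
  refine hy.trans ?_
  simp [SpecMap]

end Covers

/-! ### Extension of scalars -/

section ExtensionOfScalars

variable {C : Type u} [Category.{v} C] [MonoidalCategory C] [SymmetricCategory C]
  [MonoidalClosed C] [HasCoequalizers C]
variable {A B : C} [MonObj A] [MonObj B] [IsCommMonObj A] [IsCommMonObj B] (f : A ⟶ B)
  [IsMonHom f] (M : Mod C A)

/-- The universal balanced morphism `B ⊗ M ⟶ B ⊗_A M`. -/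
noncomputable abbrev extπ : B ⊗ M.X ⟶ (tMod (res f (reg B)) M).X := tq (res f (reg B)) M

instance : Epi (extπ f M) := inferInstanceAs (Epi (tq (res f (reg B)) M))

lemma ract_reg (B : C) [MonObj B] [IsCommMonObj B] : ract (reg B) = μ[B] := IsCommMonObj.mul_comm B

lemma extπ_bal : (B ◁ f ≫ μ[B]) ▷ M.X ≫ extπ f M =
    (α_ B A M.X).hom ≫ B ◁ act M ≫ extπ f M := by
  have h := tq_bal (res f (reg B)) M
  rw [ract_res, ract_reg] at h
  exact h

/-- The action of `B` on `B ⊗_A M`. -/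
noncomputable abbrev extAct : B ⊗ (tMod (res f (reg B)) M).X ⟶ (tMod (res f (reg B)) M).X :=
  bcAux f (reg B) M

lemma extπ_act : B ◁ extπ f M ≫ extAct f M = (α_ B B M.X).inv ≫ μ[B] ▷ M.X ≫ extπ f M := by
  have h := tq_bcAux f (reg B) M
  rw [ract_reg] at h
  exact h

/-- Extension of scalars `B ⊗_A M` along `f : A ⟶ B`, as a `B`-module. -/
noncomputable abbrev ext : Mod C B :=
  letI : ModObj B (tMod (res f (reg B)) M).X :=
    { smul := extAct f M
      one_smul := by
        change η[B] ▷ _ ≫ extAct f M = (λ_ _).hom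
        rw [← cancel_epi (𝟙_ C ◁ extπ f M), whisker_exchange_assoc, extπ_act,
          leftUnitor_naturality]
        have e : η[B] ▷ (B ⊗ M.X) ≫ (α_ B B M.X).inv ≫ μ[B] ▷ M.X =
          (α_ _ _ _).inv ≫ (η[B] ▷ B ≫ μ[B]) ▷ M.X := by monoidal
        rw [reassoc_of% e, MonObj.one_mul]
        monoidal
      mul_smul := by
        change μ[B] ▷ _ ≫ extAct f M = (α_ B B _).hom ≫ B ◁ extAct f M ≫ extAct f M
        have e1 : (B ⊗ B) ◁ extπ f M ≫ (α_ B B _).hom = (α_ _ _ _).hom ≫ B ◁ B ◁ extπ f M := by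
          monoidal
        rw [← cancel_epi ((B ⊗ B) ◁ extπ f M), whisker_exchange_assoc, extπ_act,
          reassoc_of% e1, ← whiskerLeft_comp_assoc, extπ_act]
        simp only [whiskerLeft_comp, Category.assoc, extπ_act]
        have e2 : μ[B] ▷ (B ⊗ M.X) ≫ (α_ B B M.X).inv ≫ μ[B] ▷ M.X =
          (α_ _ _ _).inv ≫ (μ[B] ▷ B ≫ μ[B]) ▷ M.X := by monoidal
        rw [reassoc_of% e2, MonObj.mul_assoc]
        monoidal }
  ⟨(tMod (res f (reg B)) M).X⟩

/-- The morphism `M ⟶ B ⊗_A M`. -/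
noncomputable def extUnit : M.X ⟶ (ext f M).X := (λ_ M.X).inv ≫ η[B] ▷ M.X ≫ extπ f M

lemma extUnit_act : B ◁ extUnit f M ≫ act (ext f M) = extπ f M := by
  change B ◁ ((λ_ M.X).inv ≫ η[B] ▷ M.X ≫ extπ f M) ≫ extAct f M = extπ f M
  simp only [whiskerLeft_comp, Category.assoc]
  rw [extπ_act]
  have e : B ◁ (λ_ M.X).inv ≫ B ◁ η[B] ▷ M.X ≫ (α_ B B M.X).inv ≫ μ[B] ▷ M.X =
    (ρ_ B).inv ▷ M.X ≫ (B ◁ η[B] ≫ μ[B]) ▷ M.X := by monoidal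
  rw [reassoc_of% e, MonObj.mul_one, ← comp_whiskerRight_assoc, Iso.inv_hom_id, id_whiskerRight,
    Category.id_comp]

lemma extUnit_semi : IsSemi (N := ext f M) f (extUnit f M) := by
  have e : A ◁ extUnit f M ≫ f ▷ (ext f M).X ≫ act (ext f M) = f ▷ M.X ≫ extπ f M := by
    rw [whisker_exchange_assoc, extUnit_act]
  rw [IsSemi, e]
  have h := extπ_bal f M
  have e1 : act M ≫ (λ_ M.X).inv ≫ η[B] ▷ M.X = (λ_ _).inv ≫ η[B] ▷ (A ⊗ M.X) ≫ B ◁ act M := by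
    rw [← whisker_exchange]; monoidal
  have e2 : η[B] ▷ (A ⊗ M.X) ≫ B ◁ act M ≫ extπ f M =
      (α_ _ _ _).inv ≫ (η[B] ▷ A) ▷ M.X ≫ (B ◁ f ≫ μ[B]) ▷ M.X ≫ extπ f M := by
    rw [h]; monoidal
  have e3 : η[B] ▷ A ≫ B ◁ f ≫ μ[B] = (λ_ A).hom ≫ f := by
    rw [← whisker_exchange_assoc, MonObj.one_mul, leftUnitor_naturality]
  change act M ≫ (λ_ M.X).inv ≫ η[B] ▷ M.X ≫ extπ f M = _
  rw [reassoc_of% e1, e2, ← comp_whiskerRight_assoc, e3]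
  monoidal

lemma isBaseChange_ext : IsBaseChange (N := ext f M) f (extUnit f M) (extUnit_semi f M) := by
  have h : bcMap (N := ext f M) f (extUnit f M) (extUnit_semi f M) = 𝟙 _ := by
    apply (cancel_epi (extπ f M)).1
    refine (tq_bcMap (N := ext f M) f (extUnit f M) (extUnit_semi f M)).trans ?_
    rw [extUnit_act]
    exact (Category.comp_id _).symm
  rw [IsBaseChange, h]
  exact inferInstanceAs (IsIso (𝟙 (tMod (res f (reg B)) M).X))

variable {f M}

lemma IsSemi.comp {D : C} [MonObj D] {g : B ⟶ D} {N : Mod C B} {P : Mod C D} {s : M.X ⟶ N.X}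
    {k : N.X ⟶ P.X} (hs : IsSemi f s) (hk : IsSemi g k) : IsSemi (f ≫ g) (s ≫ k) := by
  have h1 : act M ≫ s = A ◁ s ≫ f ▷ N.X ≫ act N := hs
  have h2 : act N ≫ k = B ◁ k ≫ g ▷ P.X ≫ act P := hk
  rw [IsSemi, reassoc_of% h1, h2, comp_whiskerRight, whiskerLeft_comp, Category.assoc,
    ← whisker_exchange_assoc, Category.assoc]

lemma IsSemi.comp_id {N N' : Mod C B} {s : M.X ⟶ N.X} {k : N.X ⟶ N'.X} (hs : IsSemi f s)
    (hk : IsSemi (𝟙 B) k) : IsSemi f (s ≫ k) := by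
  have := hs.comp hk
  rwa [Category.comp_id] at this

lemma IsSemi.id_comp {M' : Mod C A} {N : Mod C B} {k : M'.X ⟶ M.X} {s : M.X ⟶ N.X}
    (hk : IsSemi (𝟙 A) k) (hs : IsSemi f s) : IsSemi f (k ≫ s) := by
  have := hk.comp hs
  rwa [Category.id_comp] at this

/-- The linear extension along a base change `s : M ⟶ N` of a semilinear morphism. -/
noncomputable def IsBaseChange.desc {N P : Mod C B} {s : M.X ⟶ N.X} {hs : IsSemi f s}
    (h : IsBaseChange f s hs) (s' : M.X ⟶ P.X) (hs' : IsSemi f s') : N.X ⟶ P.X :=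
  h.lift (g := 𝟙 B) s' (by rwa [Category.comp_id])

section

variable {N P : Mod C B} {s : M.X ⟶ N.X} {hs : IsSemi f s}
    (h : IsBaseChange f s hs) (s' : M.X ⟶ P.X) (hs' : IsSemi f s')

lemma IsBaseChange.fac_desc : s ≫ h.desc s' hs' = s' := h.fac _ _

lemma IsBaseChange.desc_semi : IsSemi (𝟙 B) (h.desc s' hs') := h.lift_semi _ _

end

/-- A semilinear morphism `s : M ⟶ N` is a base change if linear endomorphisms of `N` are determined
by their composites with `s`, and `M ⟶ B ⊗_A M` factors linearly through `s`. -/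
lemma isBaseChange_of_universal {N : Mod C B} {s : M.X ⟶ N.X} (hs : IsSemi f s)
    (r : N.X ⟶ (ext f M).X) (hr : IsSemi (N := ext f M) (𝟙 B) r) (w : s ≫ r = extUnit f M)
    (hext : ∀ k : N.X ⟶ N.X, IsSemi (𝟙 B) k → s ≫ k = s → k = 𝟙 _) : IsBaseChange f s hs := by
  let e : (ext f M).X ⟶ N.X := (isBaseChange_ext f M).desc s hs
  have he : IsSemi (M := ext f M) (𝟙 B) e := (isBaseChange_ext f M).desc_semi s hs
  have we : extUnit f M ≫ e = s := (isBaseChange_ext f M).fac_desc s hs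
  have h1 : r ≫ e = 𝟙 _ := by
    apply hext
    · exact hr.comp_id he
    · rw [reassoc_of% w, we]
  have h2 : e ≫ r = 𝟙 _ := by
    apply (isBaseChange_ext f M).hom_ext (g := 𝟙 B) (P := ext f M)
    · exact he.comp_id hr
    · exact isSemi_hom (𝟙 (ext f M))
    · rw [reassoc_of% we, w]
      exact (Category.comp_id _).symm
  have h3 : bcMap f s hs = e := by
    apply (cancel_epi (extπ f M)).1
    refine (tq_bcMap f s hs).trans ?_
    have h4 := whiskerLeft_act_semi (N := ext f M) he (extUnit f M)
    rw [extUnit_act, we, id_whiskerRight, Category.id_comp] at h4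
    exact h4.symm
  rw [IsBaseChange, h3]
  exact ⟨r, h2, h1⟩

variable {D : C} [MonObj D] [IsCommMonObj D] {g : B ⟶ D} [IsMonHom g] {N : Mod C B} {P : Mod C D}
  {s : M.X ⟶ N.X} {k : N.X ⟶ P.X} {hs : IsSemi f s} {hk : IsSemi g k}

lemma IsBaseChange.comp (h : IsBaseChange f s hs) (h' : IsBaseChange g k hk) :
    IsBaseChange (f ≫ g) (s ≫ k) (hs.comp hk) := by
  have h1 := h.lift_semi (P := ext (f ≫ g) M) (extUnit (f ≫ g) M) (extUnit_semi (f ≫ g) M)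
  refine isBaseChange_of_universal _ (h'.desc (h.lift (P := ext (f ≫ g) M)
    (extUnit (f ≫ g) M) (extUnit_semi (f ≫ g) M)) h1) (h'.desc_semi _ _) ?_ fun a ha e => ?_
  · rw [Category.assoc, h'.fac_desc, h.fac]
  · refine h'.hom_ext ha (isSemi_hom (𝟙 P)) (h.hom_ext (hk.comp_id ha)
      (hk.comp_id (isSemi_hom (𝟙 P))) ?_)
    simp only [Category.assoc] at e
    rw [e]
    exact congrArg (s ≫ ·) (Category.comp_id k).symm

/-- If `s` and `s ≫ k` are base changes, then so is `k`. -/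
lemma IsBaseChange.of_comp (h : IsBaseChange f s hs) (hk : IsSemi g k)
    (h' : IsBaseChange (f ≫ g) (s ≫ k) (hs.comp hk)) : IsBaseChange g k hk := by
  have hu : IsSemi (N := ext g N) (f ≫ g) (s ≫ extUnit g N) := hs.comp (extUnit_semi g N)
  refine isBaseChange_of_universal hk (h'.desc (s ≫ extUnit g N) hu) (h'.desc_semi _ _) ?_
    fun a ha e => ?_
  · refine h.hom_ext (P := ext g N) (hk.comp_id (h'.desc_semi _ hu)) (extUnit_semi g N) ?_
    rw [← Category.assoc, h'.fac_desc]
  · refine h'.hom_ext ha (isSemi_hom (𝟙 P)) ?_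
    rw [Category.assoc, e]
    exact (Category.comp_id _).symm

end ExtensionOfScalars

/-! ### Refinements of affine opens -/

section Pullback

variable {C : Type u} [Category.{v} C] [MonoidalCategory C] [SymmetricCategory C]
  [MonoidalClosed C] [HasCoequalizers C]

/-- The morphism of rings attached to a morphism of affine schemes. -/
noncomputable def specHom {A B : CommMon C} (x : Spec B ⟶ Spec A) : A ⟶ B :=
  (uliftYoneda.{u}.preimage x).unop

lemma SpecMap_specHom {A B : CommMon C} (x : Spec B ⟶ Spec A) : SpecMap (specHom x) = x :=
  uliftYoneda.{u}.map_preimage x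

lemma SpecMap_injective {A B : CommMon C} {g h : A ⟶ B} (e : SpecMap g = SpecMap h) : g = h :=
  Quiver.Hom.op_inj (uliftYoneda.{u}.map_injective e)

lemma SpecMap_comp {A B D : CommMon C} (g : A ⟶ B) (h : B ⟶ D) :
    SpecMap (g ≫ h) = SpecMap h ≫ SpecMap g := by
  simp [SpecMap]

/-- The structure morphism of an affine open of `Spec K`. -/
noncomputable def structHom {K : CommMon C} (T : ZarAff (Spec K)) : K ⟶ T.ring := specHom T.incl

lemma SpecMap_structHom {K : CommMon C} (T : ZarAff (Spec K)) : SpecMap (structHom T) = T.incl :=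
  SpecMap_specHom _

lemma structHom_comp {K : CommMon C} {T T' : ZarAff (Spec K)} (t : Restr T T') :
    structHom T ≫ t.hom = structHom T' :=
  SpecMap_injective (by rw [SpecMap_comp, SpecMap_structHom, SpecMap_structHom, t.w])

variable {X : Psh C}

lemma Restr.ext {U V : ZarAff X} {φ ψ : Restr U V} (h : φ.hom = ψ.hom) : φ = ψ := by
  cases φ
  cases ψ
  cases h
  rfl

/-- Every two affine opens of `X` have an affine intersection: semi-separatedness, for an arbitrary
presheaf `X`. -/
def SemiSep (X : Psh C) : Prop :=
  ∀ U V : ZarAff X, ∃ (P : ZarAff X) (p : Restr U P) (q : Restr V P),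
    IsPullback (SpecMap p.hom) (SpecMap q.hom) U.incl V.incl

/-- A common refinement of two affine opens `U` and `W` through which a point of both, with values
in `B`, factors. -/
structure Refinement {U W : ZarAff X} {B : CommMon C} (g : U.ring ⟶ B) (g' : W.ring ⟶ B) where
  /-- The refinement. -/
  P : ZarAff X
  /-- The restriction from the first open. -/
  p : Restr U P
  /-- The restriction from the second open. -/
  q : Restr W P
  /-- The factorization of the point. -/
  h : P.ring ⟶ B
  hp : p.hom ≫ h = g
  hq : q.hom ≫ h = g'

/-- The intersection of `U` and `W` refines every other refinement. -/
lemma SemiSep.exists_refinement (hX : SemiSep X) {U W : ZarAff X} {B : CommMon C}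
    (g : U.ring ⟶ B) (g' : W.ring ⟶ B) (w : SpecMap g ≫ U.incl = SpecMap g' ≫ W.incl) :
    ∃ r : Refinement g g', ∀ r' : Refinement g g', ∃ φ : Restr r.P r'.P,
      r.p.comp φ = r'.p ∧ r.q.comp φ = r'.q ∧ φ.hom ≫ r'.h = r.h := by
  obtain ⟨P, p, q, hP⟩ := hX U W
  have h1 : p.hom ≫ specHom (hP.lift _ _ w) = g :=
    SpecMap_injective (by rw [SpecMap_comp, SpecMap_specHom, hP.lift_fst])
  have h2 : q.hom ≫ specHom (hP.lift _ _ w) = g' :=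
    SpecMap_injective (by rw [SpecMap_comp, SpecMap_specHom, hP.lift_snd])
  refine ⟨⟨P, p, q, _, h1, h2⟩, fun r' => ?_⟩
  have w' : SpecMap r'.p.hom ≫ U.incl = SpecMap r'.q.hom ≫ W.incl := by rw [r'.p.w, r'.q.w]
  have e1 : p.hom ≫ specHom (hP.lift _ _ w') = r'.p.hom :=
    SpecMap_injective (by rw [SpecMap_comp, SpecMap_specHom, hP.lift_fst])
  have e2 : q.hom ≫ specHom (hP.lift _ _ w') = r'.q.hom :=
    SpecMap_injective (by rw [SpecMap_comp, SpecMap_specHom, hP.lift_snd])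
  obtain ⟨φ, hφ⟩ : ∃ φ : Restr P r'.P, φ.hom = specHom (hP.lift _ _ w') :=
    ⟨⟨specHom (hP.lift _ _ w'), by
      rw [← p.w, ← Category.assoc, ← SpecMap_comp, e1, r'.p.w]⟩, rfl⟩
  rw [← hφ] at e1 e2
  refine ⟨φ, Restr.ext e1, Restr.ext e2, SpecMap_injective (hP.hom_ext ?_ ?_)⟩
  · rw [← SpecMap_comp, ← SpecMap_comp, h1, ← Category.assoc, e1, r'.hp]
  · rw [← SpecMap_comp, ← SpecMap_comp, h2, ← Category.assoc, e2, r'.hq]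

end Pullback

/-! ### Construction of the pullback functor -/

section PullbackConstruction

variable {C : Type u} [Category.{v} C] [MonoidalCategory C] [SymmetricCategory C]
  [MonoidalClosed C] [HasCoequalizers C] {X : Psh C} {K : CommMon C}

namespace AffinePullback

variable {U₀ : ZarAff X} (g₀ : U₀.ring ⟶ K)

/-- The morphism `O(U₀) ⟶ O(T)`, for an affine open `T` of `Spec K`. -/
noncomputable def toRing (T : ZarAff (Spec K)) : U₀.ring ⟶ T.ring := g₀ ≫ structHom T

lemma toRing_comp {T T' : ZarAff (Spec K)} (t : Restr T T') :
    toRing g₀ T ≫ t.hom = toRing g₀ T' := by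
  rw [toRing, Category.assoc, structHom_comp, toRing]

lemma toRing_w {f : Spec K ⟶ X} (hf : SpecMap g₀ ≫ U₀.incl = f) (T : ZarAff (Spec K)) :
    SpecMap (toRing g₀ T) ≫ U₀.incl = T.incl ≫ f := by
  rw [toRing, SpecMap_comp, SpecMap_structHom, Category.assoc, hf]

variable (M N : QCoh X)

/-- The sections over `T` of the pullback of `M`. -/
noncomputable abbrev sections (T : ZarAff (Spec K)) : Mod C T.ring.X :=
  ext (ringHom (toRing g₀ T)) (M.obj U₀)

/-- Pullback of sections over `U₀`. -/
noncomputable abbrev unit (T : ZarAff (Spec K)) : (M.obj U₀).X ⟶ (sections g₀ M T).X :=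
  extUnit (ringHom (toRing g₀ T)) (M.obj U₀)

lemma unit_semi (T : ZarAff (Spec K)) :
    IsSemi (N := sections g₀ M T) (ringHom (toRing g₀ T)) (unit g₀ M T) := extUnit_semi _ _

lemma unit_isBaseChange (T : ZarAff (Spec K)) : IsBaseChange (N := sections g₀ M T)
    (ringHom (toRing g₀ T)) (unit g₀ M T) (unit_semi g₀ M T) := isBaseChange_ext _ _

lemma unit_semi_of_eq {D : CommMon C} {T : ZarAff (Spec K)} (a : U₀.ring ⟶ D) (b : D ⟶ T.ring)
    (h : a ≫ b = toRing g₀ T) :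
    IsSemi (N := sections g₀ M T) (ringHom a ≫ ringHom b) (unit g₀ M T) := by
  rw [← ringHom_comp, h]
  exact unit_semi g₀ M T

lemma unit_isBaseChange_of_eq {D : CommMon C} {T : ZarAff (Spec K)} (a : U₀.ring ⟶ D)
    (b : D ⟶ T.ring) (h : a ≫ b = toRing g₀ T) :
    IsBaseChange (N := sections g₀ M T) (ringHom a ≫ ringHom b) (unit g₀ M T)
      (unit_semi_of_eq g₀ M a b h) := by
  have e : ringHom a ≫ ringHom b = ringHom (toRing g₀ T) := by rw [← ringHom_comp, h]
  have : ∀ (c : U₀.ring.X ⟶ T.ring.X) [IsMonHom c] (hc : c = ringHom (toRing g₀ T))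
      (hs : IsSemi (N := sections g₀ M T) c (unit g₀ M T)),
      IsBaseChange (N := sections g₀ M T) c (unit g₀ M T) hs := by
    rintro _ _ rfl _
    exact unit_isBaseChange g₀ M T
  exact this _ e _

/-- The semilinear extension of `unit` to the sections over an affine open `P` contained in `U₀`. -/
noncomputable def extend {P : ZarAff X} (p : Restr U₀ P) {T : ZarAff (Spec K)}
    (h : P.ring ⟶ T.ring) (hp : p.hom ≫ h = toRing g₀ T) : (M.obj P).X ⟶ (sections g₀ M T).X :=
  (M.isBaseChange p).lift (P := sections g₀ M T) (g := ringHom h) (unit g₀ M T)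
    (unit_semi_of_eq g₀ M p.hom h hp)

section

variable {P : ZarAff X} (p : Restr U₀ P) {T : ZarAff (Spec K)}
    (h : P.ring ⟶ T.ring) (hp : p.hom ≫ h = toRing g₀ T)

lemma extend_semi : IsSemi (N := sections g₀ M T) (ringHom h) (extend g₀ M p h hp) :=
  (M.isBaseChange p).lift_semi _ _

lemma map_extend : M.map p ≫ extend g₀ M p h hp = unit g₀ M T := (M.isBaseChange p).fac _ _

lemma extend_unique {k : (M.obj P).X ⟶ (sections g₀ M T).X}
    (hk : IsSemi (N := sections g₀ M T) (ringHom h) k) (w : M.map p ≫ k = unit g₀ M T) :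
    k = extend g₀ M p h hp :=
  (M.isBaseChange p).hom_ext (P := sections g₀ M T) hk (extend_semi g₀ M p h hp)
    (by rw [w, map_extend])

lemma extend_isBaseChange : IsBaseChange (N := sections g₀ M T) (ringHom h)
    (extend g₀ M p h hp) (extend_semi g₀ M p h hp) := by
  refine (M.isBaseChange p).of_comp (P := sections g₀ M T) (extend_semi g₀ M p h hp) ?_
  have := unit_isBaseChange_of_eq g₀ M p.hom h hp
  simp only [map_extend]
  exact this

lemma map_comp_extend {P' : ZarAff X} (φ : Restr P P') (h' : P'.ring ⟶ T.ring)
    (hp' : (p.comp φ).hom ≫ h' = toRing g₀ T) (e : φ.hom ≫ h' = h) :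
    M.map φ ≫ extend g₀ M (p.comp φ) h' hp' = extend g₀ M p h hp := by
  apply extend_unique
  · rw [← e]
    exact (M.semi φ).comp (extend_semi g₀ M _ h' hp')
  · rw [← Category.assoc, ← M.map_comp, map_extend]

end

/-- The restriction morphisms of the pullback of `M`. -/
noncomputable def restrict {T T' : ZarAff (Spec K)} (t : Restr T T') :
    (sections g₀ M T).X ⟶ (sections g₀ M T').X :=
  (unit_isBaseChange g₀ M T).lift (P := sections g₀ M T') (g := ringHom t.hom) (unit g₀ M T')
    (unit_semi_of_eq g₀ M _ t.hom (toRing_comp g₀ t))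

lemma restrict_semi {T T' : ZarAff (Spec K)} (t : Restr T T') :
    IsSemi (M := sections g₀ M T) (N := sections g₀ M T') (ringHom t.hom) (restrict g₀ M t) :=
  (unit_isBaseChange g₀ M T).lift_semi _ _

lemma unit_restrict {T T' : ZarAff (Spec K)} (t : Restr T T') :
    unit g₀ M T ≫ restrict g₀ M t = unit g₀ M T' := (unit_isBaseChange g₀ M T).fac _ _

lemma sections_ext {T T' : ZarAff (Spec K)} {a : T.ring ⟶ T'.ring} {N : Mod C T'.ring.X}
    {k k' : (sections g₀ M T).X ⟶ N.X} (hk : IsSemi (M := sections g₀ M T) (ringHom a) k)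
    (hk' : IsSemi (M := sections g₀ M T) (ringHom a) k')
    (e : unit g₀ M T ≫ k = unit g₀ M T ≫ k') : k = k' :=
  (unit_isBaseChange g₀ M T).hom_ext hk hk' e

/-- The pullback of `M`. -/
noncomputable def obj : QCoh (Spec K) where
  obj T := sections g₀ M T
  map t := restrict g₀ M t
  semi t := restrict_semi g₀ M t
  map_id T := sections_ext g₀ M (a := 𝟙 _) (restrict_semi g₀ M (Restr.id T))
    (isSemi_hom (𝟙 (sections g₀ M T)))
    ((unit_restrict g₀ M (Restr.id T)).trans (Category.comp_id _).symm)
  map_comp {T T' T''} t t' := sections_ext g₀ M (a := t.hom ≫ t'.hom)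
    (restrict_semi g₀ M (t.comp t')) ((restrict_semi g₀ M t).comp (restrict_semi g₀ M t'))
    (by
      have h := unit_restrict g₀ M t
      rw [reassoc_of% h, unit_restrict, unit_restrict])
  isBaseChange {T T'} t := by
    refine (unit_isBaseChange g₀ M T).of_comp (P := sections g₀ M T') (restrict_semi g₀ M t) ?_
    have := unit_isBaseChange_of_eq g₀ M _ t.hom (toRing_comp g₀ t)
    simp only [unit_restrict]
    exact this

variable {M N}

/-- Functoriality of the sections of the pullback. -/
noncomputable def sectionsMap (k : M ⟶ N) (T : ZarAff (Spec K)) :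
    sections g₀ M T ⟶ sections g₀ N T :=
  mkHom ((unit_isBaseChange g₀ M T).desc ((k.app U₀).hom ≫ unit g₀ N T)
      ((isSemi_hom (k.app U₀)).id_comp (unit_semi g₀ N T)))
    ((unit_isBaseChange g₀ M T).desc_semi ((k.app U₀).hom ≫ unit g₀ N T)
      ((isSemi_hom (k.app U₀)).id_comp (unit_semi g₀ N T)))

lemma unit_sectionsMap (k : M ⟶ N) (T : ZarAff (Spec K)) :
    unit g₀ M T ≫ (sectionsMap g₀ k T).hom = (k.app U₀).hom ≫ unit g₀ N T :=
  (unit_isBaseChange g₀ M T).fac_desc ((k.app U₀).hom ≫ unit g₀ N T)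
    ((isSemi_hom (k.app U₀)).id_comp (unit_semi g₀ N T))

lemma sections_hom_ext {T : ZarAff (Spec K)} {N' : Mod C T.ring.X} {k k' : sections g₀ M T ⟶ N'}
    (e : unit g₀ M T ≫ k.hom = unit g₀ M T ≫ k'.hom) : k = k' :=
  Mod.hom_ext _ _ (sections_ext g₀ M (a := 𝟙 _) (isSemi_hom k) (isSemi_hom k') e)

/-- The pullback functor along `Spec K ⟶ U₀ ⟶ X`. -/
noncomputable def functor : QCoh X ⥤ QCoh (Spec K) where
  obj M := obj g₀ M
  map {M N} k := ⟨sectionsMap g₀ k, fun {T T'} t => by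
    refine sections_ext g₀ M (a := t.hom) (N := sections g₀ N T')
      ((restrict_semi g₀ M t).comp_id (isSemi_hom _))
      ((isSemi_hom (sectionsMap g₀ k T)).id_comp (restrict_semi g₀ N t)) ?_
    have h1 := unit_restrict g₀ M t
    have h2 := unit_sectionsMap g₀ k T
    have h3 := unit_sectionsMap g₀ k T'
    have h4 := unit_restrict g₀ N t
    change unit g₀ M T ≫ restrict g₀ M t ≫ (sectionsMap g₀ k T').hom =
      unit g₀ M T ≫ (sectionsMap g₀ k T).hom ≫ restrict g₀ N t
    rw [reassoc_of% h1, reassoc_of% h2, h3, h4]⟩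
  map_id M := QCoh.hom_ext _ _ fun T => sections_hom_ext g₀ (by
    refine (unit_sectionsMap g₀ (𝟙 M) T).trans ?_
    exact (Category.id_comp _).trans (Category.comp_id _).symm)
  map_comp {M N P} k l := QCoh.hom_ext _ _ fun T => sections_hom_ext g₀ (by
    have h1 := unit_sectionsMap g₀ k T
    have h2 := unit_sectionsMap g₀ l T
    refine (unit_sectionsMap g₀ (k ≫ l) T).trans ?_
    change ((k.app U₀).hom ≫ (l.app U₀).hom) ≫ _ =
      unit g₀ M T ≫ (sectionsMap g₀ k T).hom ≫ (sectionsMap g₀ l T).hom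
    rw [reassoc_of% h1, h2, Category.assoc])

variable (M)

/-- Pullback of sections over `W`, through a common refinement of `U₀` and `W`. -/
noncomputable def pull {W : ZarAff X} {T : ZarAff (Spec K)} {g : W.ring ⟶ T.ring}
    (r : Refinement (toRing g₀ T) g) : (M.obj W).X ⟶ (sections g₀ M T).X :=
  M.map r.q ≫ extend g₀ M r.p r.h r.hp

section

variable {W : ZarAff X} {T : ZarAff (Spec K)} {g : W.ring ⟶ T.ring}

lemma pull_semi (r : Refinement (toRing g₀ T) g) :
    IsSemi (N := sections g₀ M T) (ringHom g) (pull g₀ M r) := by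
  have h := (M.semi r.q).comp (extend_semi g₀ M r.p r.h r.hp)
  rw [← ringHom_comp, r.hq] at h
  exact h

lemma pull_isBaseChange (r : Refinement (toRing g₀ T) g) :
    IsBaseChange (N := sections g₀ M T) (ringHom g) (pull g₀ M r) (pull_semi g₀ M r) := by
  obtain ⟨P, p, q, h, hp, rfl⟩ := r
  have := (M.isBaseChange q).comp (g := ringHom h) (extend_isBaseChange g₀ M p h hp)
  exact this

lemma pull_naturality (k : M ⟶ N) (r : Refinement (toRing g₀ T) g) :
    pull g₀ M r ≫ (sectionsMap g₀ k T).hom = (k.app W).hom ≫ pull g₀ N r := by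
  have h : extend g₀ M r.p r.h r.hp ≫ (sectionsMap g₀ k T).hom =
      (k.app r.P).hom ≫ extend g₀ N r.p r.h r.hp := by
    refine (M.isBaseChange r.p).hom_ext (P := sections g₀ N T)
      ((extend_semi g₀ M r.p r.h r.hp).comp_id (isSemi_hom _))
      ((isSemi_hom (k.app r.P)).id_comp (extend_semi g₀ N r.p r.h r.hp)) ?_
    have h1 := map_extend g₀ M r.p r.h r.hp
    have h2 := k.naturality r.p
    rw [reassoc_of% h1, reassoc_of% h2, map_extend, unit_sectionsMap]
  have h3 := k.naturality r.q
  rw [pull, pull, Category.assoc, h, reassoc_of% h3]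

/-- `pull` does not depend on the refinement. -/
lemma pull_eq_of_hom {r r' : Refinement (toRing g₀ T) g} (φ : Restr r.P r'.P)
    (hp : r.p.comp φ = r'.p) (hq : r.q.comp φ = r'.q) (h : φ.hom ≫ r'.h = r.h) :
    pull g₀ M r = pull g₀ M r' := by
  obtain ⟨P', p', q', h', hp', hq'⟩ := r'
  change Restr r.P P' at φ
  change r.p.comp φ = p' at hp
  change r.q.comp φ = q' at hq
  change φ.hom ≫ h' = r.h at h
  subst hp hq
  rw [pull, pull, M.map_comp, Category.assoc]
  exact congrArg (M.map r.q ≫ ·) (map_comp_extend g₀ M r.p r.h r.hp φ h' hp' h).symm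

lemma pull_restrict {T' : ZarAff (Spec K)} (t : Restr T T') (r : Refinement (toRing g₀ T) g)
    (r' : Refinement (toRing g₀ T') (g ≫ t.hom)) (hr : pull g₀ M r' = pull g₀ M
      (⟨r.P, r.p, r.q, r.h ≫ t.hom, by rw [← Category.assoc, r.hp, toRing_comp],
        by rw [← Category.assoc, r.hq]⟩ : Refinement (toRing g₀ T') (g ≫ t.hom))) :
    pull g₀ M r ≫ restrict g₀ M t = pull g₀ M r' := by
  rw [hr, pull, pull, Category.assoc]
  refine congrArg (M.map r.q ≫ ·) ?_
  apply extend_unique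
  · exact (extend_semi g₀ M r.p r.h r.hp).comp (restrict_semi g₀ M t)
  · have h1 := map_extend g₀ M r.p r.h r.hp
    rw [reassoc_of% h1, unit_restrict]

end

variable (hX : SemiSep X) {f : Spec K ⟶ X} (hf : SpecMap g₀ ≫ U₀.incl = f)

section

variable {W : ZarAff X} {T : ZarAff (Spec K)} (g : W.ring ⟶ T.ring)
  (h : SpecMap g ≫ W.incl = T.incl ≫ f)

/-- The refinement of `U₀` and `W` by their intersection. -/
noncomputable def interRefinement : Refinement (toRing g₀ T) g :=
  (hX.exists_refinement (toRing g₀ T) g ((toRing_w g₀ hf T).trans h.symm)).choose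

lemma pull_eq (r : Refinement (toRing g₀ T) g) :
    pull g₀ M (interRefinement g₀ hX hf g h) = pull g₀ M r := by
  obtain ⟨φ, h1, h2, h3⟩ :=
    (hX.exists_refinement (toRing g₀ T) g ((toRing_w g₀ hf T).trans h.symm)).choose_spec r
  exact pull_eq_of_hom g₀ M φ h1 h2 h3

end

/-- The functor `functor g₀` is a pullback functor along `f`. -/
noncomputable def pullbackData : PullbackData f (functor (X := X) g₀) where
  σ M W T g h := pull g₀ M (interRefinement g₀ hX hf g h)
  semi M W T g h := pull_semi g₀ M _
  isBaseChange M W T g h := pull_isBaseChange g₀ M _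
  naturality k W T g h := pull_naturality g₀ _ k _
  comp_map M W T T' g h t := pull_restrict g₀ M t _ _ (pull_eq g₀ M hX hf _ _ _)
  map_comp M W W' T w g h := by
    let r := interRefinement g₀ hX hf g h
    refine Eq.trans ?_ (pull_eq g₀ M hX hf (w.hom ≫ g) _ ⟨r.P, r.p, w.comp r.q, r.h, r.hp, by
      change (w.hom ≫ r.q.hom) ≫ r.h = _
      rw [Category.assoc, r.hq]⟩).symm
    change M.map w ≫ M.map r.q ≫ extend g₀ M r.p r.h r.hp =
      M.map (w.comp r.q) ≫ extend g₀ M r.p r.h r.hp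
    rw [M.map_comp, Category.assoc]

end AffinePullback

end PullbackConstruction

/-! ### Tensor products of semilinear morphisms -/

section TensorMaps

variable {C : Type u} [Category.{v} C] [MonoidalCategory C] [SymmetricCategory C]
  [MonoidalClosed C] [HasCoequalizers C]
variable {A B : C} [MonObj A] [MonObj B] [IsCommMonObj A] [IsCommMonObj B] {f : A ⟶ B}
  {M N M₁ N₁ : Mod C A} {M' N' M₁' N₁' : Mod C B}
  {s : M.X ⟶ M'.X} {t : N.X ⟶ N'.X} {hs : IsSemi f s} {ht : IsSemi f t}

lemma tMap_tHom (k : M' ⟶ M₁') (l : N' ⟶ N₁') {s₁ : M.X ⟶ M₁'.X} {t₁ : N.X ⟶ N₁'.X}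
    (hs₁ : IsSemi f s₁) (ht₁ : IsSemi f t₁) (es : s ≫ k.hom = s₁) (et : t ≫ l.hom = t₁) :
    tMap f s t hs ht ≫ (tHom k l).hom = tMap f s₁ t₁ hs₁ ht₁ := by
  subst es et
  rw [← cancel_epi (tq M N), reassoc_of% tq_tMap, tq_tHom, tq_tMap,
    tensorHom_comp_tensorHom_assoc]

lemma tHom_tMap (k : M₁ ⟶ M) (l : N₁ ⟶ N) {s₁ : M₁.X ⟶ M'.X} {t₁ : N₁.X ⟶ N'.X}
    (hs₁ : IsSemi f s₁) (ht₁ : IsSemi f t₁) (es : k.hom ≫ s = s₁) (et : l.hom ≫ t = t₁) :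
    (tHom k l).hom ≫ tMap f s t hs ht = tMap f s₁ t₁ hs₁ ht₁ := by
  subst es et
  rw [← cancel_epi (tq M₁ N₁), reassoc_of% tq_tHom, tq_tMap, tq_tMap,
    tensorHom_comp_tensorHom_assoc]

lemma tMap_runit (hs : IsSemi f s) (hf : IsSemi (M := reg A) (N := reg B) f f) :
    tMap (N := reg A) (N' := reg B) f s f hs hf ≫ (runitIso M').hom.hom =
      (runitIso M).hom.hom ≫ s := by
  have h1 := tMap_tBraid hs hf
  have h2 := tMap_lunit hf hs
  change tMap (N := reg A) (N' := reg B) f s f hs hf ≫ tBraid M' (reg B) ≫ lunit M' =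
    (tBraid M (reg A) ≫ lunit M) ≫ s
  rw [Category.assoc, ← h2, ← Category.assoc, ← Category.assoc]
  exact congrArg (· ≫ lunit M') h1

/-- Two base changes of the same module are isomorphic. -/
noncomputable def IsBaseChange.iso [IsMonHom f] (h : IsBaseChange f s hs) {s₁ : M.X ⟶ M₁'.X}
    {hs₁ : IsSemi f s₁} (h₁ : IsBaseChange f s₁ hs₁) : M' ≅ M₁' :=
  mkIso (h.desc s₁ hs₁) (h₁.desc s hs) (h.desc_semi s₁ hs₁)
    (h.hom_ext ((h.desc_semi s₁ hs₁).comp_id (h₁.desc_semi s hs)) (isSemi_hom (𝟙 M')) (by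
      have e := h.fac_desc s₁ hs₁
      rw [reassoc_of% e, h₁.fac_desc]
      exact (Category.comp_id s).symm))
    (h₁.hom_ext ((h₁.desc_semi s hs).comp_id (h.desc_semi s₁ hs₁)) (isSemi_hom (𝟙 M₁')) (by
      have e := h₁.fac_desc s hs
      rw [reassoc_of% e, h.fac_desc]
      exact (Category.comp_id s₁).symm))

lemma IsBaseChange.fac_iso [IsMonHom f] (h : IsBaseChange f s hs) {s₁ : M.X ⟶ M₁'.X}
    {hs₁ : IsSemi f s₁} (h₁ : IsBaseChange f s₁ hs₁) : s ≫ (h.iso h₁).hom.hom = s₁ :=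
  h.fac_desc s₁ hs₁

/-- Morphisms of modules out of a base change are determined by their restriction. -/
lemma IsBaseChange.mod_hom_ext [IsMonHom f] (h : IsBaseChange f s hs) {k k' : M' ⟶ M₁'}
    (e : s ≫ k.hom = s ≫ k'.hom) : k = k' :=
  Mod.hom_ext _ _ (h.hom_ext (isSemi_hom k) (isSemi_hom k') e)

end TensorMaps

namespace PullbackData

/-! ### Cocontinuity and additivity of pullback functors -/

section Colimits

variable {C : Type u} [Category.{v} C] [MonoidalCategory C] [SymmetricCategory C]
  [MonoidalClosed C] [HasCoequalizers C] {X Y : Psh C} {f : Y ⟶ X} {F : QCoh X ⥤ QCoh Y}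
  (d : PullbackData f F) {U : ZarAff X} {T : ZarAff Y} (g : U.ring ⟶ T.ring)
  (h : SpecMap g ≫ U.incl = T.incl ≫ f)

/-- The sections over `T` of the pullback are obtained by extension of scalars from `U`. -/
noncomputable def evalIso :
    QCoh.eval U ⋙ tensorLeft (algMod g) ⋙ Mod.forget U.ring.X ≅
      (F ⋙ QCoh.eval T) ⋙ Mod.forget T.ring.X :=
  NatIso.ofComponents (fun M =>
    have := (d.isBaseChange M g h).isIso
    (asIso (bcMap (ringHom g) (d.σ M g h) (d.semi M g h)) :
      (tMod (algMod g) (M.obj U)).X ≅ ((F.obj M).obj T).X))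
    (fun {M N} k => bcMap_naturality (d.semi M g h) (d.semi N g h) (k.app U) ((F.map k).app T)
      (d.naturality k g h))

/-- Pullback functors preserve colimits: over an affine, they are given by extension of scalars. -/
lemma preservesColimitsOfShape (J : Type*) [Category* J] [HasColimitsOfShape J C]
    (d : PullbackData f F) {U : ZarAff X} {T : ZarAff Y} (g : U.ring ⟶ T.ring)
    (h : SpecMap g ≫ U.incl = T.incl ≫ f) :
    PreservesColimitsOfShape J (F ⋙ QCoh.eval T) := by
  have h1 : PreservesColimitsOfShape J (tensorLeft (algMod g) ⋙ Mod.forget U.ring.X) :=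
    ⟨inferInstance⟩
  have h2 : PreservesColimitsOfShape J
      (QCoh.eval U ⋙ tensorLeft (algMod g) ⋙ Mod.forget U.ring.X) := inferInstance
  have h3 : PreservesColimitsOfShape J ((F ⋙ QCoh.eval T) ⋙ Mod.forget T.ring.X) :=
    preservesColimitsOfShape_of_natIso (d.evalIso g h)
  have h4 : ReflectsColimitsOfShape J (Mod.forget (D := C) T.ring.X) :=
    reflectsColimitsOfShape_of_reflectsIsomorphisms
  exact preservesColimitsOfShape_of_reflects_of_preserves _ (Mod.forget T.ring.X)

end Colimits

section Additive

variable {C : Type u} [Category.{v} C] [MonoidalCategory C] [SymmetricCategory C]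
  [MonoidalClosed C] [Preadditive C] [HasFiniteCoproducts C] [HasCoequalizers C]
  {X Y : Psh C} {f : Y ⟶ X} {F : QCoh X ⥤ QCoh Y}

lemma additive (d : PullbackData f F) {U : ZarAff X} {T : ZarAff Y} (g : U.ring ⟶ T.ring)
    (h : SpecMap g ≫ U.incl = T.incl ≫ f) : (F ⋙ QCoh.eval T).Additive where
  map_add {M N k l} := by
    refine (d.isBaseChange M g h).mod_hom_ext ?_
    refine (d.naturality (k + l) g h).trans ?_
    change ((k.app U).hom + (l.app U).hom) ≫ d.σ N g h =
      d.σ M g h ≫ (((F.map k).app T).hom + ((F.map l).app T).hom)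
    rw [Preadditive.comp_add, Preadditive.add_comp, d.naturality, d.naturality]

end Additive

/-! ### The monoidal structure of pullback functors -/

section Monoidal

variable {C : Type u} [Category.{v} C] [MonoidalCategory C] [SymmetricCategory C]
  [MonoidalClosed C] [HasCoequalizers C] {X Y : Psh C} {f : Y ⟶ X} {F : QCoh X ⥤ QCoh Y}
  (d : PullbackData f F) {U : ZarAff X} {T : ZarAff Y} (g : U.ring ⟶ T.ring)
  (h : SpecMap g ≫ U.incl = T.incl ≫ f)

/-- The tensor product of two pullbacks of sections. -/
noncomputable abbrev σTensor (M N : QCoh X) :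
    (tMod (M.obj U) (N.obj U)).X ⟶ (tMod ((F.obj M).obj T) ((F.obj N).obj T)).X :=
  tMap (ringHom g) (d.σ M g h) (d.σ N g h) (d.semi M g h) (d.semi N g h)

lemma σTensor_semi (M N : QCoh X) : IsSemi (ringHom g) (d.σTensor g h M N) := tMap_semi _ _ _ _

/-- The tensor product of two base changes is a base change. -/
lemma σTensor_isBaseChange (M N : QCoh X) :
    IsBaseChange (ringHom g) (d.σTensor g h M N) (d.σTensor_semi g h M N) :=
  isBaseChange_tMap _ _ _ (d.isBaseChange M g h) (d.isBaseChange N g h)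

/-- Pullback of sections of a tensor product. -/
noncomputable abbrev σMul (M N : QCoh X) :
    (tMod (M.obj U) (N.obj U)).X ⟶ ((F.obj (M ⊗ N)).obj T).X := d.σ (M ⊗ N) g h

lemma σMul_semi (M N : QCoh X) :
    IsSemi (M := tMod (M.obj U) (N.obj U)) (ringHom g) (d.σMul g h M N) := d.semi (M ⊗ N) g h

lemma σMul_isBaseChange (M N : QCoh X) : IsBaseChange (M := tMod (M.obj U) (N.obj U))
    (ringHom g) (d.σMul g h M N) (d.σMul_semi g h M N) := d.isBaseChange (M ⊗ N) g h

/-- The tensorator of the pullback functor. -/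
noncomputable def mulIso (M N : QCoh X) :
    tMod ((F.obj M).obj T) ((F.obj N).obj T) ≅ (F.obj (M ⊗ N)).obj T :=
  (d.σTensor_isBaseChange g h M N).iso (d.σMul_isBaseChange g h M N)

lemma σTensor_mulIso (M N : QCoh X) :
    d.σTensor g h M N ≫ (d.mulIso g h M N).hom.hom = d.σMul g h M N :=
  (d.σTensor_isBaseChange g h M N).fac_iso (d.σMul_isBaseChange g h M N)

/-- Pullback of functions. -/
noncomputable abbrev σUnit : (reg U.ring.X).X ⟶ ((F.obj (𝟙_ (QCoh X))).obj T).X :=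
  d.σ (𝟙_ (QCoh X)) g h

lemma σUnit_semi : IsSemi (M := reg U.ring.X) (ringHom g) (d.σUnit g h) := d.semi (𝟙_ (QCoh X)) g h

/-- The unit constraint of the pullback functor. -/
noncomputable def unitIso : reg T.ring.X ≅ (F.obj (𝟙_ (QCoh X))).obj T :=
  (isBaseChange_regular (ringHom g)).iso
    (d.isBaseChange (𝟙_ (QCoh X)) g h : IsBaseChange (M := reg U.ring.X) (ringHom g)
      (d.σUnit g h) (d.σUnit_semi g h))

lemma ringHom_unitIso : ringHom g ≫ (d.unitIso g h).hom.hom = d.σUnit g h :=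
  (isBaseChange_regular (ringHom g)).fac_iso
    (d.isBaseChange (𝟙_ (QCoh X)) g h : IsBaseChange (M := reg U.ring.X) (ringHom g)
      (d.σUnit g h) (d.σUnit_semi g h))

lemma mul_natural {M M' N N' : QCoh X} (k : M ⟶ M') (l : N ⟶ N') :
    tHom ((F.map k).app T) ((F.map l).app T) ≫ (d.mulIso g h M' N').hom =
      (d.mulIso g h M N).hom ≫ (F.map (k ⊗ₘ l)).app T := by
  refine (d.σTensor_isBaseChange g h M N).mod_hom_ext ?_
  have hs := (d.semi M g h).comp_id (isSemi_hom ((F.map k).app T))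
  have ht := (d.semi N g h).comp_id (isSemi_hom ((F.map l).app T))
  have e1 : d.σTensor g h M N ≫ (tHom ((F.map k).app T) ((F.map l).app T)).hom =
      (tHom (k.app U) (l.app U)).hom ≫ d.σTensor g h M' N' := by
    rw [tMap_tHom _ _ hs ht rfl rfl]
    exact (tHom_tMap _ _ hs ht (d.naturality k g h).symm (d.naturality l g h).symm).symm
  have e2 : d.σMul g h M N ≫ ((F.map (k ⊗ₘ l)).app T).hom =
      (tHom (k.app U) (l.app U)).hom ≫ d.σMul g h M' N' := d.naturality (k ⊗ₘ l) g h
  have e3 := d.σTensor_mulIso g h M N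
  have e4 := d.σTensor_mulIso g h M' N'
  rw [Mod.comp_hom', Mod.comp_hom', reassoc_of% e1, reassoc_of% e3, e4, e2]

lemma mul_assoc (M N P : QCoh X) :
    tHom (d.mulIso g h M N).hom (𝟙 ((F.obj P).obj T)) ≫ (d.mulIso g h (M ⊗ N) P).hom ≫
      (F.map (α_ M N P).hom).app T =
    (assocIso ((F.obj M).obj T) ((F.obj N).obj T) ((F.obj P).obj T)).hom ≫
      tHom (𝟙 ((F.obj M).obj T)) (d.mulIso g h N P).hom ≫ (d.mulIso g h M (N ⊗ P)).hom := by
  have hb := isBaseChange_tMap _ _ _ (d.σTensor_isBaseChange g h M N) (d.isBaseChange P g h)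
  refine hb.mod_hom_ext ?_
  have e1 : tMap (ringHom g) (d.σTensor g h M N) (d.σ P g h) (d.σTensor_semi g h M N)
      (d.semi P g h) ≫ (tHom (d.mulIso g h M N).hom (𝟙 ((F.obj P).obj T))).hom =
      d.σTensor g h (M ⊗ N) P :=
    tMap_tHom _ _ (d.semi (M ⊗ N) g h) (d.semi P g h) (d.σTensor_mulIso g h M N)
      (Category.comp_id _)
  have e2 : tMap (ringHom g) (d.σ M g h) (d.σTensor g h N P) (d.semi M g h)
      (d.σTensor_semi g h N P) ≫ (tHom (𝟙 ((F.obj M).obj T)) (d.mulIso g h N P).hom).hom =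
      d.σTensor g h M (N ⊗ P) :=
    tMap_tHom _ _ (d.semi M g h) (d.semi (N ⊗ P) g h) (Category.comp_id _)
      (d.σTensor_mulIso g h N P)
  have e3 := d.σTensor_mulIso g h (M ⊗ N) P
  have e4 := d.σTensor_mulIso g h M (N ⊗ P)
  have e5 : d.σMul g h (M ⊗ N) P ≫ ((F.map (α_ M N P).hom).app T).hom =
      assocHom (M.obj U) (N.obj U) (P.obj U) ≫ d.σMul g h M (N ⊗ P) :=
    d.naturality (α_ M N P).hom g h
  have e6 := tMap_assoc (d.semi M g h) (d.semi N g h) (d.semi P g h)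
  simp only [Mod.comp_hom']
  refine ((reassoc_of% e1) _).trans (((reassoc_of% e3) _).trans (e5.trans ?_))
  refine Eq.trans ?_ ((reassoc_of% e6) _).symm
  exact (congrArg (assocHom (M.obj U) (N.obj U) (P.obj U) ≫ ·)
    (((reassoc_of% e2) _).trans e4)).symm

lemma mul_unit_left (M : QCoh X) :
    (lunitIso ((F.obj M).obj T)).hom = tHom (d.unitIso g h).hom (𝟙 ((F.obj M).obj T)) ≫
      (d.mulIso g h (𝟙_ (QCoh X)) M).hom ≫ (F.map (λ_ M).hom).app T := by
  have hb := isBaseChange_tMap _ _ _ (isBaseChange_regular (ringHom g)) (d.isBaseChange M g h)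
  refine hb.mod_hom_ext ?_
  have e1 : tMap (M := reg U.ring.X) (M' := reg T.ring.X) (ringHom g) (ringHom g) (d.σ M g h)
      (regular_semi _) (d.semi M g h) ≫
      (tHom (d.unitIso g h).hom (𝟙 ((F.obj M).obj T))).hom = d.σTensor g h (𝟙_ (QCoh X)) M :=
    tMap_tHom _ _ (d.semi (𝟙_ (QCoh X)) g h) (d.semi M g h) (d.ringHom_unitIso g h)
      (Category.comp_id _)
  have e3 := d.σTensor_mulIso g h (𝟙_ (QCoh X)) M
  have e5 : d.σMul g h (𝟙_ (QCoh X)) M ≫ ((F.map (λ_ M).hom).app T).hom =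
      lunit (M.obj U) ≫ d.σ M g h := d.naturality (λ_ M).hom g h
  simp only [Mod.comp_hom']
  exact (tMap_lunit (regular_semi _) (d.semi M g h)).trans
    (((reassoc_of% e1) _).trans (((reassoc_of% e3) _).trans e5)).symm

lemma mul_unit_right (M : QCoh X) :
    (runitIso ((F.obj M).obj T)).hom = tHom (𝟙 ((F.obj M).obj T)) (d.unitIso g h).hom ≫
      (d.mulIso g h M (𝟙_ (QCoh X))).hom ≫ (F.map (ρ_ M).hom).app T := by
  have hb := isBaseChange_tMap _ _ _ (d.isBaseChange M g h) (isBaseChange_regular (ringHom g))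
  refine hb.mod_hom_ext ?_
  have e1 : tMap (N := reg U.ring.X) (N' := reg T.ring.X) (ringHom g) (d.σ M g h) (ringHom g)
      (d.semi M g h) (regular_semi _) ≫
      (tHom (𝟙 ((F.obj M).obj T)) (d.unitIso g h).hom).hom = d.σTensor g h M (𝟙_ (QCoh X)) :=
    tMap_tHom _ _ (d.semi M g h) (d.semi (𝟙_ (QCoh X)) g h) (Category.comp_id _)
      (d.ringHom_unitIso g h)
  have e3 := d.σTensor_mulIso g h M (𝟙_ (QCoh X))
  have e5 : d.σMul g h M (𝟙_ (QCoh X)) ≫ ((F.map (ρ_ M).hom).app T).hom =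
      (runitIso (M.obj U)).hom.hom ≫ d.σ M g h := d.naturality (ρ_ M).hom g h
  simp only [Mod.comp_hom']
  exact (tMap_runit (d.semi M g h) (regular_semi _)).trans
    (((reassoc_of% e1) _).trans (((reassoc_of% e3) _).trans e5)).symm

lemma mul_braid (M N : QCoh X) :
    (d.mulIso g h M N).hom ≫ (F.map (β_ M N).hom).app T =
      (braidIso ((F.obj M).obj T) ((F.obj N).obj T)).hom ≫ (d.mulIso g h N M).hom := by
  refine (d.σTensor_isBaseChange g h M N).mod_hom_ext ?_
  have e3 := d.σTensor_mulIso g h M N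
  have e4 := d.σTensor_mulIso g h N M
  have e5 : d.σMul g h M N ≫ ((F.map (β_ M N).hom).app T).hom =
      tBraid (M.obj U) (N.obj U) ≫ d.σMul g h N M := d.naturality (β_ M N).hom g h
  have e6 := tMap_tBraid (d.semi M g h) (d.semi N g h)
  rw [Mod.comp_hom', Mod.comp_hom', reassoc_of% e3, e5]
  refine Eq.trans ?_ ((reassoc_of% e6) _).symm
  rw [e4]

/-- The monoidal structure of the functor of sections over `T` of the pullback. -/
noncomputable def coreMonoidal : (F ⋙ QCoh.eval T).CoreMonoidal :=
  ⟨d.unitIso g h, d.mulIso g h,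
    fun {M M'} k N => by
      have e := d.mul_natural g h k (𝟙 N)
      rw [F.map_id, tensorHom_id] at e
      exact e,
    fun {N N'} M l => by
      have e := d.mul_natural g h (𝟙 M) l
      rw [F.map_id, id_tensorHom] at e
      exact e,
    d.mul_assoc g h, d.mul_unit_left g h, d.mul_unit_right g h⟩

/-- The braided monoidal structure of the functor of sections over `T` of the pullback. -/
@[reducible]
noncomputable def braided : (F ⋙ QCoh.eval T).Braided :=
  letI := (d.coreMonoidal g h).toMonoidal
  { braided := d.mul_braid g h }

lemma map_σ (M : QCoh X) {P : ZarAff X} (p : Restr U P) (b : P.ring ⟶ T.ring)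
    (e : p.hom ≫ b = g) (hb : SpecMap b ≫ P.incl = T.incl ≫ f) :
    M.map p ≫ d.σ M b hb = d.σ M g h := by
  subst e
  exact d.map_comp M p b hb

lemma map_σTensor (M N : QCoh X) {P : ZarAff X} (p : Restr U P) (b : P.ring ⟶ T.ring)
    (e : p.hom ≫ b = g) (hb : SpecMap b ≫ P.incl = T.incl ≫ f) :
    (M ⊗ N).map p ≫ d.σTensor b hb M N = d.σTensor g h M N := by
  have hs := (M.semi p).comp (d.semi M b hb)
  have ht := (N.semi p).comp (d.semi N b hb)
  refine (tMap_comp (M.semi p) (N.semi p) (d.semi M b hb) (d.semi N b hb) hs ht).trans ?_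
  subst e
  exact QCoh.tMap_congr (d.map_comp M p b hb) (d.map_comp N p b hb)

/-- The tensorator is compatible with pullback of sections over a smaller affine open. -/
lemma σTensor_mulIso_of_restr (M N : QCoh X) {P : ZarAff X} (p : Restr U P) (b : P.ring ⟶ T.ring)
    (e : p.hom ≫ b = g) (hb : SpecMap b ≫ P.incl = T.incl ≫ f) :
    d.σTensor b hb M N ≫ (d.mulIso g h M N).hom.hom = d.σMul b hb M N := by
  have hk := (d.σTensor_semi b hb M N).comp_id (isSemi_hom (d.mulIso g h M N).hom)
  refine ((M ⊗ N).isBaseChange p).hom_ext (P := (F.obj (M ⊗ N)).obj T) hk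
    (d.semi (M ⊗ N) b hb) ?_
  refine Eq.trans ?_ (d.map_σ g h (M ⊗ N) p b e hb).symm
  exact (Category.assoc _ _ _).symm.trans ((congrArg (· ≫ (d.mulIso g h M N).hom.hom)
    (d.map_σTensor g h M N p b e hb)).trans (d.σTensor_mulIso g h M N))

lemma ringHom_unitIso_of_restr {P : ZarAff X} (p : Restr U P) (b : P.ring ⟶ T.ring)
    (e : p.hom ≫ b = g) (hb : SpecMap b ≫ P.incl = T.incl ≫ f) :
    ringHom b ≫ (d.unitIso g h).hom.hom = d.σUnit b hb := by
  have hk := (regular_semi (ringHom b)).comp_id (isSemi_hom (d.unitIso g h).hom)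
  refine ((𝟙_ (QCoh X)).isBaseChange p).hom_ext (P := (F.obj (𝟙_ (QCoh X))).obj T) hk
    (d.semi (𝟙_ (QCoh X)) b hb) ?_
  refine Eq.trans ?_ (d.map_σ g h (𝟙_ (QCoh X)) p b e hb).symm
  subst e
  exact (Category.assoc _ _ _).symm.trans (d.ringHom_unitIso _ h)

section Canonical

variable {W : ZarAff X} (g' : W.ring ⟶ T.ring) (h' : SpecMap g' ≫ W.incl = T.incl ≫ f)

/-- The tensorator defined through `U` is compatible with pullback of sections over every `W`. -/
lemma σTensor_mulIso_of_semiSep (hX : SemiSep X) (M N : QCoh X) :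
    d.σTensor g' h' M N ≫ (d.mulIso g h M N).hom.hom = d.σMul g' h' M N := by
  obtain ⟨⟨P, p, q, b, hp, rfl⟩, -⟩ := hX.exists_refinement g g' (h.trans h'.symm)
  have hb : SpecMap b ≫ P.incl = T.incl ≫ f := by
    rw [← h, ← hp, SpecMap_comp, Category.assoc, p.w]
  rw [← d.map_σTensor (q.hom ≫ b) h' M N q b rfl hb]
  refine (Category.assoc _ _ _).trans ?_
  exact (congrArg ((M ⊗ N).map q ≫ ·) (d.σTensor_mulIso_of_restr g h M N p b hp hb)).trans
    (d.map_comp (M ⊗ N) q b hb)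

/-- The unit constraint defined through `U` is compatible with pullback of functions on every `W`.
-/
lemma ringHom_unitIso_of_semiSep (hX : SemiSep X) :
    ringHom g' ≫ (d.unitIso g h).hom.hom = d.σUnit g' h' := by
  obtain ⟨⟨P, p, q, b, hp, rfl⟩, -⟩ := hX.exists_refinement g g' (h.trans h'.symm)
  have hb : SpecMap b ≫ P.incl = T.incl ≫ f := by
    rw [← h, ← hp, SpecMap_comp, Category.assoc, p.w]
  refine (Category.assoc (ringHom q.hom) (ringHom b) _).trans ?_
  rw [d.ringHom_unitIso_of_restr g h p b hp hb]
  exact d.map_comp (𝟙_ (QCoh X)) q b hb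

end Canonical

end Monoidal

section Canonical

variable {C : Type u} [Category.{v} C] [MonoidalCategory C] [SymmetricCategory C]
  [MonoidalClosed C] [HasCoequalizers C] {X : Psh C} {K : CommMon C} {f : Spec K ⟶ X}
  {F : QCoh X ⥤ QCoh (Spec K)}

/-- The monoidal structure defined through one affine open `U` is the canonical one, since every
other affine open meets `U` in an affine open. -/
lemma isCanonical_braided (d : PullbackData f F) {U : ZarAff X}
    (g : U.ring ⟶ (ZarAff.self K).ring)
    (h : SpecMap g ≫ U.incl = (ZarAff.self K).incl ≫ f) (hX : SemiSep X) :
    d.IsCanonical (A := K) (d.braided g h).toMonoidal where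
  tensor M N _ g' h' := d.σTensor_mulIso_of_semiSep g h g' h' hX M N
  unit g' h' := d.ringHom_unitIso_of_semiSep g h g' h' hX

end Canonical

end PullbackData

/-! ### Strengths -/

section Tensoring

variable {C : Type u} [Category.{v} C] [MonoidalCategory C] {A : C} [MonObj A]

/-- Functoriality of `M ⊗ Z` in the module `M`. -/
def modTensorMap {M N : Mod C A} (k : M ⟶ N) (Z : C) : modTensor M Z ⟶ modTensor N Z :=
  mkHom (M := modTensor M Z) (N := modTensor N Z) (k.hom ▷ Z) (isSemi_modTensor (isSemi_hom k) Z)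

/-- Functoriality of `M ⊗ Z` in the object `Z` of `C`. -/
def modTensorRight (M : Mod C A) {Z Z' : C} (t : Z ⟶ Z') : modTensor M Z ⟶ modTensor M Z' :=
  mkHom (M := modTensor M Z) (N := modTensor M Z') (M.X ◁ t) (by
    change ((α_ A M.X Z).inv ≫ act M ▷ Z) ≫ M.X ◁ t =
      A ◁ M.X ◁ t ≫ 𝟙 A ▷ (M.X ⊗ Z') ≫ (α_ A M.X Z').inv ≫ act M ▷ Z'
    rw [Category.assoc, ← whisker_exchange]
    monoidal)

/-- The isomorphism `M ⊗ 1 ⟶ M`. -/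
def modTensorUnit (M : Mod C A) : modTensor M (𝟙_ C) ⟶ M :=
  mkHom (M := modTensor M (𝟙_ C)) (ρ_ M.X).hom (by
    change ((α_ A M.X (𝟙_ C)).inv ≫ act M ▷ 𝟙_ C) ≫ (ρ_ M.X).hom =
      A ◁ (ρ_ M.X).hom ≫ 𝟙 A ▷ M.X ≫ act M
    monoidal)

/-- The isomorphism `M ⊗ (Z ⊗ Z') ⟶ (M ⊗ Z) ⊗ Z'`. -/
def modTensorAssocInv (M : Mod C A) (Z Z' : C) :
    modTensor M (Z ⊗ Z') ⟶ modTensor (modTensor M Z) Z' :=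
  mkHom (M := modTensor M (Z ⊗ Z')) (N := modTensor (modTensor M Z) Z') (α_ M.X Z Z').inv (by
    change ((α_ A M.X (Z ⊗ Z')).inv ≫ act M ▷ (Z ⊗ Z')) ≫ (α_ M.X Z Z').inv =
      A ◁ (α_ M.X Z Z').inv ≫ 𝟙 A ▷ ((M.X ⊗ Z) ⊗ Z') ≫
        (α_ A (M.X ⊗ Z) Z').inv ≫ ((α_ A M.X Z).inv ≫ act M ▷ Z) ▷ Z'
    monoidal)

lemma modTensorMap_comp {M N P : Mod C A} (k : M ⟶ N) (l : N ⟶ P) (Z : C) :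
    modTensorMap (k ≫ l) Z = modTensorMap k Z ≫ modTensorMap l Z :=
  Mod.hom_ext _ _ (comp_whiskerRight k.hom l.hom Z)

/-- A strength of a functor `G` between categories of modules: morphisms `G(M) ⊗ Z ⟶ G(M ⊗ Z)`, for
`Z` in `C`, natural in `M` and `Z` and compatible with the action of `C` on modules. -/
structure Strength {B : C} [MonObj B] (G : Mod C A ⥤ Mod C B) where
  /-- The structure morphisms of a strength. -/
  str : ∀ (M : Mod C A) (Z : C), modTensor (G.obj M) Z ⟶ G.obj (modTensor M Z)
  naturality_left : ∀ {M N : Mod C A} (k : M ⟶ N) (Z : C),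
    modTensorMap (G.map k) Z ≫ str N Z = str M Z ≫ G.map (modTensorMap k Z)
  naturality_right : ∀ (M : Mod C A) {Z Z' : C} (t : Z ⟶ Z'),
    modTensorRight (G.obj M) t ≫ str M Z' = str M Z ≫ G.map (modTensorRight M t)
  unit : ∀ M : Mod C A, str M (𝟙_ C) ≫ G.map (modTensorUnit M) = modTensorUnit (G.obj M)
  assoc : ∀ (M : Mod C A) (Z Z' : C),
    modTensorAssocInv (G.obj M) Z Z' ≫ modTensorMap (str M Z) Z' ≫ str (modTensor M Z) Z' =
      str M (Z ⊗ Z') ≫ G.map (modTensorAssocInv M Z Z')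

end Tensoring

/-! ### Strong functors are normal -/

section StrengthNormal

variable {C : Type u} [Category.{v} C] [MonoidalCategory C] [MonoidalClosed C] [HasEqualizers C]
  {A B : C} [MonObj A] [MonObj B]

/-- The evaluation `M ⊗ Hom_A(M, N) ⟶ N`, as a morphism of modules. -/
noncomputable def iEvHom (M N : Mod C A) : modTensor M (IHom M N) ⟶ N :=
  mkHom (M := modTensor M (IHom M N)) (iEv M N) (by
    change ((α_ A M.X (IHom M N)).inv ≫ act M ▷ IHom M N) ≫ iEv M N =
      A ◁ iEv M N ≫ 𝟙 A ▷ N.X ≫ act N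
    rw [Category.assoc, iEv_linear]
    simp)

/-- Morphisms to `Hom_A(M, N)` are determined by the corresponding morphisms `M ⊗ Z ⟶ N`. -/
lemma iHom_ext {M N : Mod C A} {Z : C} {t t' : Z ⟶ IHom M N}
    (e : M.X ◁ t ≫ iEv M N = M.X ◁ t' ≫ iEv M N) : t = t' := by
  have h : ∀ t : Z ⟶ IHom M N, t ≫ iIncl M N = MonoidalClosed.curry (M.X ◁ t ≫ iEv M N) := by
    intro t
    apply MonoidalClosed.uncurry_injective
    rw [MonoidalClosed.uncurry_curry, MonoidalClosed.uncurry_eq, whiskerLeft_comp_assoc, iEv]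
  have : Mono (iIncl M N) := equalizer.ι_mono
  rw [← cancel_mono (iIncl M N), h, h, e]

/-- Linearity of a morphism `M ⊗ Z ⟶ N`, in the form required by `iLift`. -/
lemma modTensor_linear {M N : Mod C A} {Z : C} (k : modTensor M Z ⟶ N) :
    act M ▷ Z ≫ k.hom = (α_ A M.X Z).hom ≫ A ◁ k.hom ≫ act N := by
  have h : ((α_ A M.X Z).inv ≫ act M ▷ Z) ≫ k.hom = A ◁ k.hom ≫ act N := act_hom k
  rw [← h, Category.assoc, Iso.hom_inv_id_assoc]

namespace Strength

variable {G : Mod C A ⥤ Mod C B} (s : Strength G)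

/-- The action of a strong functor on internal homs: `Hom_A(M, N) ⟶ Hom_B(G M, G N)` corresponds to
`G(M) ⊗ Hom_A(M, N) ⟶ G(M ⊗ Hom_A(M, N)) ⟶ G(N)`. -/
noncomputable def τ (M N : Mod C A) : IHom M N ⟶ IHom (G.obj M) (G.obj N) :=
  iLift (s.str M (IHom M N) ≫ G.map (iEvHom M N)).hom (modTensor_linear _)

lemma whiskerLeft_τ_ev {M N : Mod C A} :
    (G.obj M).X ◁ s.τ M N ≫ iEv (G.obj M) (G.obj N) =
      (s.str M (IHom M N) ≫ G.map (iEvHom M N)).hom := iLift_iEv _ _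

/-- The morphism `t ≫ τ` corresponds to the image under `G` of the morphism corresponding
to `t`. -/
lemma comp_τ_ev {M N : Mod C A} {Z : C} (t : Z ⟶ IHom M N) :
    (G.obj M).X ◁ (t ≫ s.τ M N) ≫ iEv (G.obj M) (G.obj N) =
      (s.str M Z ≫ G.map (modTensorRight M t ≫ iEvHom M N)).hom := by
  rw [whiskerLeft_comp_assoc, whiskerLeft_τ_ev, G.map_comp, ← Category.assoc, ← s.naturality_right,
    Category.assoc]
  rfl

/-- Strong functors are normal. -/
noncomputable def normalStructure : NormalStructure G where
  τ := s.τ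
  naturality_left {M' M} f N := by
    apply iHom_ext
    rw [comp_τ_ev, whiskerLeft_comp_assoc]
    have e1 : (G.obj M').X ◁ iPre (G.map f) (G.obj N) ≫ iEv (G.obj M') (G.obj N) =
      (G.map f).hom ▷ _ ≫ iEv (G.obj M) (G.obj N) := iLift_iEv _ _
    have e2 : modTensorRight M' (iPre f N) ≫ iEvHom M' N =
        modTensorMap f (IHom M N) ≫ iEvHom M N := Mod.hom_ext _ _ (iLift_iEv _ _)
    rw [e1, whisker_exchange_assoc, whiskerLeft_τ_ev, e2, G.map_comp, ← Category.assoc,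
      ← s.naturality_left, Category.assoc]
    rfl
  naturality_right M {N N'} g := by
    apply iHom_ext
    rw [comp_τ_ev, whiskerLeft_comp_assoc]
    have e1 : (G.obj M).X ◁ iPost (G.obj M) (G.map g) ≫ iEv (G.obj M) (G.obj N') =
      iEv (G.obj M) (G.obj N) ≫ (G.map g).hom := iLift_iEv _ _
    have e2 : modTensorRight M (iPost M g) ≫ iEvHom M N' = iEvHom M N ≫ g :=
      Mod.hom_ext _ _ (iLift_iEv _ _)
    rw [e1, ← Category.assoc, whiskerLeft_τ_ev, e2, G.map_comp]
    exact (congrArg Mod.Hom.hom (Category.assoc (s.str M (IHom M N)) _ _)).symm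
  comp M N P := by
    apply iHom_ext
    rw [comp_τ_ev, whiskerLeft_comp_assoc]
    have e1 : (G.obj M).X ◁ iComp (G.obj M) (G.obj N) (G.obj P) ≫ iEv (G.obj M) (G.obj P) =
      (α_ _ _ _).inv ≫ iEv (G.obj M) (G.obj N) ▷ _ ≫ iEv (G.obj N) (G.obj P) := iLift_iEv _ _
    have e2 : modTensorRight M (iComp M N P) ≫ iEvHom M P = modTensorAssocInv M _ _ ≫
        modTensorMap (iEvHom M N) (IHom N P) ≫ iEvHom N P := Mod.hom_ext _ _ (iLift_iEv _ _)
    have e3 : (G.obj M).X ◁ (s.τ M N ⊗ₘ s.τ N P) ≫ (α_ _ _ _).inv ≫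
        iEv (G.obj M) (G.obj N) ▷ _ = (α_ _ _ _).inv ≫
          ((G.obj M).X ◁ s.τ M N ≫ iEv (G.obj M) (G.obj N)) ▷ _ ≫ (G.obj N).X ◁ s.τ N P := by
      rw [MonoidalCategory.tensorHom_def, ← whisker_exchange]
      have e : ((G.obj M).X ⊗ IHom M N) ◁ s.τ N P ≫
          ((G.obj M).X ◁ s.τ M N ≫ iEv (G.obj M) (G.obj N)) ▷ _ =
        ((G.obj M).X ◁ s.τ M N ≫ iEv (G.obj M) (G.obj N)) ▷ _ ≫ (G.obj N).X ◁ s.τ N P :=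
        whisker_exchange _ _
      rw [← e]
      monoidal
    rw [e1, reassoc_of% e3, whiskerLeft_τ_ev, whiskerLeft_τ_ev, e2, G.map_comp, G.map_comp,
      ← Category.assoc (s.str M _), ← s.assoc, Category.assoc, Category.assoc,
      ← Category.assoc (s.str (modTensor M _) _), ← s.naturality_left, Category.assoc,
      ← Category.assoc (modTensorMap _ _) (modTensorMap _ _), ← modTensorMap_comp]
    rfl
  id M := by
    apply iHom_ext
    rw [comp_τ_ev]
    have e1 : (G.obj M).X ◁ iOf (𝟙 (G.obj M)) ≫ iEv (G.obj M) (G.obj M) =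
      (ρ_ (G.obj M).X).hom ≫ (𝟙 (G.obj M) : G.obj M ⟶ G.obj M).hom := iLift_iEv _ _
    have e2 : modTensorRight M (iOf (𝟙 M)) ≫ iEvHom M M = modTensorUnit M ≫ 𝟙 M :=
      Mod.hom_ext _ _ (iLift_iEv _ _)
    rw [e1, e2, Category.comp_id, s.unit]
    exact (Category.comp_id _).symm
  ofHom {M N} f := by
    apply iHom_ext
    rw [comp_τ_ev]
    have e1 : (G.obj M).X ◁ iOf (G.map f) ≫ iEv (G.obj M) (G.obj N) =
      (ρ_ (G.obj M).X).hom ≫ (G.map f).hom := iLift_iEv _ _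
    have e2 : modTensorRight M (iOf f) ≫ iEvHom M N = modTensorUnit M ≫ f :=
      Mod.hom_ext _ _ (iLift_iEv _ _)
    rw [e1, e2, G.map_comp, ← Category.assoc, s.unit]
    rfl

end Strength

end StrengthNormal

/-! ### Tensor products of quasi-coherent modules with objects of `C` -/

section QCohTensoring

variable {C : Type u} [Category.{v} C] [MonoidalCategory C] [SymmetricCategory C]
  [MonoidalClosed C] [HasCoequalizers C] {X : Psh C}

namespace QCoh

/-- The quasi-coherent module `U ↦ M(U) ⊗ Z`, for an object `Z` of `C`. -/
noncomputable def tens (M : QCoh X) (Z : C) : QCoh X where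
  obj U := modTensor (M.obj U) Z
  map φ := M.map φ ▷ Z
  semi φ := isSemi_modTensor (M.semi φ) Z
  map_id U := (congrArg (· ▷ Z) (M.map_id U)).trans (id_whiskerRight _ _)
  map_comp φ ψ := (congrArg (· ▷ Z) (M.map_comp φ ψ)).trans (comp_whiskerRight _ _ _)
  isBaseChange φ := isBaseChange_modTensor (M.isBaseChange φ) Z

/-- Functoriality of `M ⊗ Z` in the quasi-coherent module `M`. -/
noncomputable def tensMap {M N : QCoh X} (k : M ⟶ N) (Z : C) : tens M Z ⟶ tens N Z :=
  ⟨fun U => modTensorMap (k.app U) Z, fun {U V} φ => by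
    change M.map φ ▷ Z ≫ (k.app V).hom ▷ Z = (k.app U).hom ▷ Z ≫ N.map φ ▷ Z
    rw [← comp_whiskerRight, ← comp_whiskerRight, k.naturality]⟩

/-- Functoriality of `M ⊗ Z` in the object `Z` of `C`. -/
noncomputable def tensRight (M : QCoh X) {Z Z' : C} (t : Z ⟶ Z') : tens M Z ⟶ tens M Z' :=
  ⟨fun U => modTensorRight (M.obj U) t, fun φ => (whisker_exchange (M.map φ) t).symm⟩

/-- The isomorphism `M ⊗ 1 ⟶ M`. -/
noncomputable def tensUnit (M : QCoh X) : tens M (𝟙_ C) ⟶ M :=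
  ⟨fun U => modTensorUnit (M.obj U), fun φ => rightUnitor_naturality (M.map φ)⟩

/-- The isomorphism `M ⊗ (Z ⊗ Z') ⟶ (M ⊗ Z) ⊗ Z'`. -/
noncomputable def tensAssocInv (M : QCoh X) (Z Z' : C) :
    tens M (Z ⊗ Z') ⟶ tens (tens M Z) Z' :=
  ⟨fun U => modTensorAssocInv (M.obj U) Z Z',
    fun φ => associator_inv_naturality_left (M.map φ) Z Z'⟩

end QCoh

end QCohTensoring

section ModTensorLemmas

variable {C : Type u} [Category.{v} C] [MonoidalCategory C] {A : C} [MonObj A]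

lemma modTensorMap_right {M N : Mod C A} (k : M ⟶ N) {Z Z' : C} (t : Z ⟶ Z') :
    modTensorMap k Z ≫ modTensorRight N t = modTensorRight M t ≫ modTensorMap k Z' :=
  Mod.hom_ext _ _ (whisker_exchange k.hom t).symm

lemma modTensorMap_unit {M N : Mod C A} (k : M ⟶ N) :
    modTensorMap k (𝟙_ C) ≫ modTensorUnit N = modTensorUnit M ≫ k :=
  Mod.hom_ext _ _ (rightUnitor_naturality k.hom)

lemma modTensorMap_assocInv {M N : Mod C A} (k : M ⟶ N) (Z Z' : C) :
    modTensorMap k (Z ⊗ Z') ≫ modTensorAssocInv N Z Z' =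
      modTensorAssocInv M Z Z' ≫ modTensorMap (modTensorMap k Z) Z' :=
  Mod.hom_ext _ _ (associator_inv_naturality_left k.hom Z Z')

end ModTensorLemmas

/-! ### The strength of direct image functors -/

section DirectImage

variable {C : Type u} [Category.{v} C] [MonoidalCategory C] [SymmetricCategory C]
  [MonoidalClosed C] [HasCoequalizers C] {X : Psh C} {U : ZarAff X}
  {R : Mod C U.ring.X ⥤ QCoh X} (adj : QCoh.eval U ⊣ R)

/-- Morphisms `M(U) ⟶ N`, as morphisms `M ⟶ R(N)` to the direct image. -/
noncomputable def dirMk {M : QCoh X} {N : Mod C U.ring.X} (k : M.obj U ⟶ N) : M ⟶ R.obj N :=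
  adj.homEquiv M N k

/-- The counit `R(N)(U) ⟶ N`. -/
noncomputable def dirCounit (N : Mod C U.ring.X) : (R.obj N).obj U ⟶ N := adj.counit.app N

lemma dirMk_counit {M : QCoh X} {N : Mod C U.ring.X} (k : M.obj U ⟶ N) :
    (dirMk adj k).app U ≫ dirCounit adj N = k :=
  (adj.homEquiv_counit M N (dirMk adj k)).symm.trans ((adj.homEquiv M N).symm_apply_apply k)

lemma dir_ext {M : QCoh X} {N : Mod C U.ring.X} {k l : M ⟶ R.obj N}
    (e : k.app U ≫ dirCounit adj N = l.app U ≫ dirCounit adj N) : k = l :=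
  (adj.homEquiv M N).symm.injective
    ((adj.homEquiv_counit M N k).trans (e.trans (adj.homEquiv_counit M N l).symm))

lemma dirCounit_naturality {M N : Mod C U.ring.X} (k : M ⟶ N) :
    (R.map k).app U ≫ dirCounit adj N = dirCounit adj M ≫ k := adj.counit.naturality k

/-- The morphism `R(M) ⊗ Z ⟶ R(M ⊗ Z)` for the direct image functor `R`. -/
noncomputable def dirStr (M : Mod C U.ring.X) (Z : C) :
    QCoh.tens (R.obj M) Z ⟶ R.obj (modTensor M Z) :=
  dirMk (M := QCoh.tens (R.obj M) Z) adj (modTensorMap (dirCounit adj M) Z)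

lemma dirStr_counit (M : Mod C U.ring.X) (Z : C) :
    (dirStr adj M Z).app U ≫ dirCounit adj (modTensor M Z) = modTensorMap (dirCounit adj M) Z :=
  dirMk_counit _ _

lemma dirStr_natural_left {M N : Mod C U.ring.X} (k : M ⟶ N) (Z : C) :
    QCoh.tensMap (R.map k) Z ≫ dirStr adj N Z = dirStr adj M Z ≫ R.map (modTensorMap k Z) := by
  apply dir_ext adj
  rw [QCoh.comp_app, QCoh.comp_app, Category.assoc, Category.assoc, dirStr_counit,
    dirCounit_naturality, ← Category.assoc, dirStr_counit]
  exact (modTensorMap_comp _ _ Z).symm.trans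
    ((congrArg (modTensorMap · Z) (dirCounit_naturality adj k)).trans (modTensorMap_comp _ _ Z))

lemma dirStr_natural_right (M : Mod C U.ring.X) {Z Z' : C} (t : Z ⟶ Z') :
    QCoh.tensRight (R.obj M) t ≫ dirStr adj M Z' = dirStr adj M Z ≫ R.map (modTensorRight M t) := by
  apply dir_ext adj
  rw [QCoh.comp_app, QCoh.comp_app, Category.assoc, Category.assoc, dirStr_counit,
    dirCounit_naturality, ← Category.assoc, dirStr_counit]
  exact (modTensorMap_right _ t).symm

lemma dirStr_unit (M : Mod C U.ring.X) :
    dirStr adj M (𝟙_ C) ≫ R.map (modTensorUnit M) = QCoh.tensUnit (R.obj M) := by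
  apply dir_ext adj
  rw [QCoh.comp_app, Category.assoc, dirCounit_naturality, ← Category.assoc, dirStr_counit]
  exact modTensorMap_unit _

lemma dirStr_assoc (M : Mod C U.ring.X) (Z Z' : C) :
    QCoh.tensAssocInv (R.obj M) Z Z' ≫ QCoh.tensMap (dirStr adj M Z) Z' ≫
        dirStr adj (modTensor M Z) Z' =
      dirStr adj M (Z ⊗ Z') ≫ R.map (modTensorAssocInv M Z Z') := by
  apply dir_ext adj
  rw [QCoh.comp_app, QCoh.comp_app, QCoh.comp_app, Category.assoc, Category.assoc, Category.assoc,
    dirStr_counit, dirCounit_naturality, ← Category.assoc ((dirStr adj M _).app U), dirStr_counit]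
  refine Eq.trans ?_ (modTensorMap_assocInv (dirCounit adj M) Z Z').symm
  exact congrArg (modTensorAssocInv ((R.obj M).obj U) Z Z' ≫ ·)
    ((modTensorMap_comp _ _ Z').symm.trans (congrArg (modTensorMap · Z') (dirStr_counit adj M Z)))

end DirectImage

namespace PullbackData

/-! ### The strength of pullback functors -/

section Strength

variable {C : Type u} [Category.{v} C] [MonoidalCategory C] [SymmetricCategory C]
  [MonoidalClosed C] [HasCoequalizers C] {X Y : Psh C} {f : Y ⟶ X} {F : QCoh X ⥤ QCoh Y}
  (d : PullbackData f F) {V : ZarAff X} {T : ZarAff Y} (g : V.ring ⟶ T.ring)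
  (h : SpecMap g ≫ V.incl = T.incl ≫ f)

lemma tens_isBaseChange (M : QCoh X) (Z : C) : IsBaseChange (M := modTensor (M.obj V) Z)
    (N := modTensor ((F.obj M).obj T) Z) (ringHom g) (d.σ M g h ▷ Z)
    (isSemi_modTensor (d.semi M g h) Z) := isBaseChange_modTensor (d.isBaseChange M g h) Z

/-- The morphism `(F M)(T) ⊗ Z ⟶ (F (M ⊗ Z))(T)` for a pullback functor `F`. -/
noncomputable def str (M : QCoh X) (Z : C) :
    modTensor ((F.obj M).obj T) Z ⟶ (F.obj (QCoh.tens M Z)).obj T :=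
  mkHom (M := modTensor ((F.obj M).obj T) Z) (N := (F.obj (QCoh.tens M Z)).obj T)
    ((d.tens_isBaseChange g h M Z).desc (d.σ (QCoh.tens M Z) g h) (d.semi (QCoh.tens M Z) g h))
    ((d.tens_isBaseChange g h M Z).desc_semi _ _)

lemma σ_str (M : QCoh X) (Z : C) :
    d.σ M g h ▷ Z ≫ (d.str g h M Z).hom = d.σ (QCoh.tens M Z) g h :=
  (d.tens_isBaseChange g h M Z).fac_desc _ (d.semi (QCoh.tens M Z) g h)

lemma str_natural_left {M N : QCoh X} (k : M ⟶ N) (Z : C) :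
    modTensorMap ((F.map k).app T) Z ≫ d.str g h N Z =
      d.str g h M Z ≫ (F.map (QCoh.tensMap k Z)).app T := by
  refine (d.tens_isBaseChange g h M Z).mod_hom_ext ?_
  have e1 : d.σ M g h ▷ Z ≫ ((F.map k).app T).hom ▷ Z = (k.app V).hom ▷ Z ≫ d.σ N g h ▷ Z := by
    rw [← comp_whiskerRight, ← comp_whiskerRight, d.naturality]
  have e2 : d.σ (QCoh.tens M Z) g h ≫ ((F.map (QCoh.tensMap k Z)).app T).hom =
      (k.app V).hom ▷ Z ≫ d.σ (QCoh.tens N Z) g h := d.naturality (QCoh.tensMap k Z) g h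
  refine ((reassoc_of% e1) _).trans ?_
  refine Eq.trans ?_ (((reassoc_of% (d.σ_str g h M Z)) _).trans e2).symm
  exact congrArg ((k.app V).hom ▷ Z ≫ ·) (d.σ_str g h N Z)

lemma str_natural_right (M : QCoh X) {Z Z' : C} (t : Z ⟶ Z') :
    modTensorRight ((F.obj M).obj T) t ≫ d.str g h M Z' =
      d.str g h M Z ≫ (F.map (QCoh.tensRight M t)).app T := by
  refine (d.tens_isBaseChange g h M Z).mod_hom_ext ?_
  have e1 : d.σ M g h ▷ Z ≫ ((F.obj M).obj T).X ◁ t = (M.obj V).X ◁ t ≫ d.σ M g h ▷ Z' :=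
    (whisker_exchange _ _).symm
  have e2 : d.σ (QCoh.tens M Z) g h ≫ ((F.map (QCoh.tensRight M t)).app T).hom =
      (M.obj V).X ◁ t ≫ d.σ (QCoh.tens M Z') g h := d.naturality (QCoh.tensRight M t) g h
  refine ((reassoc_of% e1) _).trans ?_
  refine Eq.trans ?_ (((reassoc_of% (d.σ_str g h M Z)) _).trans e2).symm
  exact congrArg ((M.obj V).X ◁ t ≫ ·) (d.σ_str g h M Z')

lemma str_unit (M : QCoh X) :
    d.str g h M (𝟙_ C) ≫ (F.map (QCoh.tensUnit M)).app T = modTensorUnit ((F.obj M).obj T) := by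
  refine (d.tens_isBaseChange g h M (𝟙_ C)).mod_hom_ext ?_
  have e2 : d.σ (QCoh.tens M (𝟙_ C)) g h ≫ ((F.map (QCoh.tensUnit M)).app T).hom =
      (ρ_ (M.obj V).X).hom ≫ d.σ M g h := d.naturality (QCoh.tensUnit M) g h
  refine ((reassoc_of% (d.σ_str g h M (𝟙_ C))) _).trans (e2.trans ?_)
  exact (rightUnitor_naturality _).symm

lemma str_assoc (M : QCoh X) (Z Z' : C) :
    modTensorAssocInv ((F.obj M).obj T) Z Z' ≫ modTensorMap (d.str g h M Z) Z' ≫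
        d.str g h (QCoh.tens M Z) Z' =
      d.str g h M (Z ⊗ Z') ≫ (F.map (QCoh.tensAssocInv M Z Z')).app T := by
  refine (d.tens_isBaseChange g h M (Z ⊗ Z')).mod_hom_ext ?_
  have e1 : d.σ M g h ▷ (Z ⊗ Z') ≫ (α_ ((F.obj M).obj T).X Z Z').inv =
      (α_ (M.obj V).X Z Z').inv ≫ d.σ M g h ▷ Z ▷ Z' := associator_inv_naturality_left _ _ _
  have e2 : d.σ (QCoh.tens M (Z ⊗ Z')) g h ≫ ((F.map (QCoh.tensAssocInv M Z Z')).app T).hom =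
      (α_ (M.obj V).X Z Z').inv ≫ d.σ (QCoh.tens (QCoh.tens M Z) Z') g h :=
    d.naturality (QCoh.tensAssocInv M Z Z') g h
  have e3 : d.σ M g h ▷ Z ▷ Z' ≫ (d.str g h M Z).hom ▷ Z' = d.σ (QCoh.tens M Z) g h ▷ Z' := by
    rw [← comp_whiskerRight, d.σ_str]
    rfl
  refine ((reassoc_of% e1) _).trans ?_
  refine Eq.trans ?_ (((reassoc_of% (d.σ_str g h M (Z ⊗ Z'))) _).trans e2).symm
  exact congrArg ((α_ (M.obj V).X Z Z').inv ≫ ·)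
    (((reassoc_of% e3) _).trans (d.σ_str g h (QCoh.tens M Z) Z'))

lemma map_comp_app {M N P : QCoh X} (k : M ⟶ N) (l : N ⟶ P) :
    (F.map (k ≫ l)).app T = (F.map k).app T ≫ (F.map l).app T :=
  congrArg (fun a => QCoh.Hom.app a T) (F.map_comp k l)

/-- The composition of a direct image functor and a pullback functor has a strength. -/
noncomputable def strength {U : ZarAff X} {R : Mod C U.ring.X ⥤ QCoh X} (adj : QCoh.eval U ⊣ R) :
    Strength (R ⋙ F ⋙ QCoh.eval T) where
  str M Z := d.str g h (R.obj M) Z ≫ (F.map (dirStr adj M Z)).app T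
  naturality_left {M N} k Z := by
    change modTensorMap ((F.map (R.map k)).app T) Z ≫ d.str g h (R.obj N) Z ≫ _ =
      (d.str g h (R.obj M) Z ≫ _) ≫ (F.map (R.map (modTensorMap k Z))).app T
    rw [← Category.assoc, str_natural_left, Category.assoc, Category.assoc, ← map_comp_app,
      ← map_comp_app, dirStr_natural_left]
  naturality_right M {Z Z'} t := by
    change modTensorRight ((F.obj (R.obj M)).obj T) t ≫ d.str g h (R.obj M) Z' ≫ _ =
      (d.str g h (R.obj M) Z ≫ _) ≫ (F.map (R.map (modTensorRight M t))).app T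
    rw [← Category.assoc, str_natural_right, Category.assoc, Category.assoc, ← map_comp_app,
      ← map_comp_app, dirStr_natural_right]
  unit M := by
    change (d.str g h (R.obj M) (𝟙_ C) ≫ _) ≫ (F.map (R.map (modTensorUnit M))).app T =
      modTensorUnit ((F.obj (R.obj M)).obj T)
    rw [Category.assoc, ← map_comp_app, dirStr_unit, str_unit]
  assoc M Z Z' := by
    change modTensorAssocInv ((F.obj (R.obj M)).obj T) Z Z' ≫
        modTensorMap (d.str g h (R.obj M) Z ≫ (F.map (dirStr adj M Z)).app T) Z' ≫
        d.str g h (R.obj (modTensor M Z)) Z' ≫ _ =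
      (d.str g h (R.obj M) (Z ⊗ Z') ≫ _) ≫ (F.map (R.map (modTensorAssocInv M Z Z'))).app T
    rw [modTensorMap_comp, Category.assoc, ← Category.assoc (modTensorMap _ Z') (d.str g h _ Z'),
      str_natural_left, Category.assoc, Category.assoc, ← map_comp_app, ← map_comp_app,
      ← dirStr_assoc]
    refine Eq.trans ?_ (congrArg (d.str g h (R.obj M) (Z ⊗ Z') ≫ ·)
      (map_comp_app (QCoh.tensAssocInv (R.obj M) Z Z') _)).symm
    refine Eq.trans ?_ (Category.assoc (d.str g h (R.obj M) (Z ⊗ Z')) _ _)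
    rw [← d.str_assoc g h (R.obj M) Z Z', Category.assoc, Category.assoc]

/-- Pullback functors to affine schemes are normal: if `F` is local with respect to `U` and `R` is
the direct image functor, then `F` is the composition of `i^*` with the strong functor `F ∘ R`. -/
lemma isNormal [HasEqualizers C] (d : PullbackData f F) {V : ZarAff X} {T : ZarAff Y}
    (g : V.ring ⟶ T.ring) (h : SpecMap g ≫ V.incl = T.incl ≫ f) :
    IsNormal (F ⋙ QCoh.eval T) := by
  rintro U ⟨R, adj, hR⟩
  exact ⟨R ⋙ F ⋙ QCoh.eval T, ⟨(d.strength g h adj).normalStructure⟩,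
    ⟨NatIso.ofComponents (fun M => have := hR M; asIso ((F ⋙ QCoh.eval T).map (adj.unit.app M)))
      fun k => by
        have e := congrArg (F ⋙ QCoh.eval T).map (adj.unit.naturality k)
        rw [Functor.map_comp, Functor.map_comp] at e
        exact e⟩⟩

end Strength

end PullbackData

end SymMonGeom

theorem theorem5p14 {C : Type u} [Category.{v} C] [Abelian C] [MonoidalCategory C]
    [SymmetricCategory C] [MonoidalClosed C] [HasLimits C] [HasColimits C] [AB5 C]
    (hC : HasFGSubobjects C)
    (X : Scheme C) (hqc : X.IsQuasiCompact) (hss : X.IsSemiSeparated) (hN : X.IsNoetherian)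
    (K : CommMon C) (hK : IsFieldObject K) (f : Spec K ⟶ X.presheaf) :
    (∃ F : QCoh X.presheaf ⥤ QCoh (Spec K), Nonempty (PullbackData f F)) ∧
    ∀ (F : QCoh X.presheaf ⥤ QCoh (Spec K)) (d : PullbackData f F),
      PreservesColimitsOfSize.{v, v} (F ⋙ globalSections K) ∧
      (F ⋙ globalSections K).Additive ∧
      (∃ b : (F ⋙ globalSections K).Braided, d.IsCanonical b.toMonoidal) ∧
      IsNormal (F ⋙ globalSections K) := by
  obtain ⟨U, g, hg⟩ := hK.exists_factor hC X f
  refine ⟨⟨_, ⟨AffinePullback.pullbackData g hss hg⟩⟩, fun F d => ?_⟩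
  have h : SpecMap (B := (ZarAff.self K).ring) g ≫ U.incl = (ZarAff.self K).incl ≫ f :=
    hg.trans (Category.id_comp f).symm
  exact ⟨⟨fun {J} _ => d.preservesColimitsOfShape J g h⟩, d.additive g h,
    ⟨d.braided g h, d.isCanonical_braided g h hss⟩, d.isNormal g h⟩
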